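/- Conventions. All matrices are complex. For $N\ge 1$ let $A=A_N$, $B=B_N$ be random Hermitian $N\times N$ matrices on a common probability space (which may depend on $N$). Write $[N]=\{1,\dots,N\}$, let $\Delta(X)$ be the diagonal part of a matrix $X$, and $\|X\|_F^2=\mathrm{Tr}(XX^*)$. A random matrix $X$ is permutation invariant if $VXV^{-1}$ has the same law as $X$ for every permutation matrix $V$. A speed is a sequence of non-negative integers $M=M(N)\to\infty$ with $M(N)\le \log N/\log\log N$ for all large $N$. A test graph $T=(V,E,\varepsilon)$ is a finite directed multigraph (not necessarily connected, loops allowed) with edge labels $\varepsilon:E\to\{1,*\}$; its injective trace in a matrix $X$ is $$\mathrm{Tr}^0(T(X))=\sum_{\phi:V\to[N]\text{ injective}}\ \prod_{e\in E}X^{\varepsilon(e)}(\phi(\mathrm{tar}\,e),\phi(\mathrm{src}\,e)).$$ Assumption H at speed $M$ with constant $h>0$, for a sequence $X_N$ of random matrices: for every $c>0$ and every sequence of test graphs $T_N$ with at most $cM(N)$ vertices, at most $cM(N)$ edges and $K(N)$ connected components, the expectation below is well defined for large $N$ and $$\mathbb E\Big[N^{-K(N)}\,\mathrm{Tr}^0(T_N(X_N))\Big]=O\big(N^{ch}\big)\qquad(N\to\infty).$$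 Frobenius assumption (Assumption 2) at speed $M$ with constant $C>0$: for all $N$, $\ \mathbb E\,\frac1N\|X_N^{M(N)}\|_F^2\le C^{M(N)}$. Free sum over the diagonal. Fix a root $x\in[N]$. Let $V_N^x$ consist of $x$ and of all tuples $(j_1,\dots,j_n,s)$ with $n\ge1$, $s\in\{a,b\}$, $j_i\in[N]$, $x\ne j_1\neq j_2\neq\dots\ne j_n$ (consecutive indices distinct). Let $j(v)$ be the last index $j_n$ of $v$, and $j(x)=x$. For $s\in\{a,b\}$ and $v_0$ equal to the root or to a tuple whose last letter is not $s$, with indices $(j_1,\dots,j_n)$ ($n=0$ for the root), put $R_s(v_0)=\{v_0\}\cup\{(j_1,\dots,j_n,k,s):k\ne j(v_0)\}$; for each $s$ these sets partition $V_N^x$. The bounded operator $a$ on $\ell^2(V_N^x)$ is given by $\langle a\delta_v,\delta_w\rangle=A(j(w),j(v))$ if $v,w$ lie in the same set $R_a(\cdot)$, and $0$ otherwise; $b$ is defined in the same way from $B$ and the sets $R_b(\cdot)$. For $\operatorname{Im}z>0$, $G_{a+b}(z)$ is the diagonal $N\times N$ matrix whose $i$-th entry is $\langle (z-a-b)^{-1}\delta_{v_i},\delta_{v_i}\rangle$,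 where $v_x=x$ and $v_i=(i,a)$ for $i\ne x$, and $G_{A+B}(z)=\Delta\big((zI-A-B)^{-1}\big)$. Theorem. Assume that, for every $N$, $A$ and $B$ are independent, and that one of the two sequences is permutation invariant. Let $M$ be a speed. Suppose that $A$ and $B$ satisfy Assumption H at speed $M$ with constants $h_1$ and $h_2$ respectively, and both satisfy the Frobenius assumption at speed $M$ with the same constant $C$. Let $0\le c\le \frac1{h_1+h_2+6}$, let $r_0=\sqrt{\max\{4C,2c^2\}}$, and let $z\in\mathbb C$ with $\operatorname{Im}z>0$ and $|z|^2>r_0^2$. Then there is $N_0$ (which may depend on all these data, in particular on $z$) such that for all $N\ge N_0$ and every choice of the root $x\in[N]$, $$\mathbb E\,\frac1N\big\|G_{a+b}(z)-G_{A+B}(z)\big\|_F^2\ \le\ \frac{4}{|z|^2}\Big(\frac{r_0}{|z|}\Big)^{2cM(N)}.$$ -/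

import Mathlib

open MeasureTheory ProbabilityTheory Filter Topology
open scoped ENNReal Matrix

namespace DiagFreeSum

/-! ### Random matrices -/

/-- The entrywise (Borel) sigma-algebra on square complex matrices. -/
noncomputable instance matrixMeasurableSpace (N : ℕ) : MeasurableSpace (Matrix (Fin N) (Fin N) ℂ) :=
  inferInstanceAs (MeasurableSpace (Fin N → Fin N → ℂ))

/-- The squared Frobenius norm `Tr (X X*)`. -/
noncomputable def frobSq {N : ℕ} (X : Matrix (Fin N) (Fin N) ℂ) : ℝ :=
  (X * Xᴴ).trace.re

/-- A random matrix is permutation invariant if `V X V⁻¹` has the same law as `X` for every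
permutation matrix `V`. -/
def PermInvariant {Ω : Type*} [MeasurableSpace Ω] (P : Measure Ω) {N : ℕ}
    (X : Ω → Matrix (Fin N) (Fin N) ℂ) : Prop :=
  ∀ σ : Equiv.Perm (Fin N),
    P.map (fun ω => σ.permMatrix ℂ * X ω * (σ.permMatrix ℂ)⁻¹) = P.map X

/-! ### Test graphs and the injective trace -/

/-- A finite multi-digraph, possibly with several connected components, with loops and multiple
edges allowed, whose edges are labelled by `1` or `*` (`star e = true` meaning `*`). -/
structure TestGraph where
  nV : ℕ
  nE : ℕ
  src : Fin nE → Fin nV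
  tar : Fin nE → Fin nV
  star : Fin nE → Bool

namespace TestGraph

/-- The underlying undirected simple graph. -/
def toSimpleGraph (T : TestGraph) : SimpleGraph (Fin T.nV) :=
  SimpleGraph.fromRel fun v w => ∃ e, T.src e = v ∧ T.tar e = w

/-- The number of connected components. -/
noncomputable def numComponents (T : TestGraph) : ℕ :=
  Nat.card T.toSimpleGraph.ConnectedComponent

/-- The injective trace
`Tr⁰ (T (X)) = ∑_{φ : V → [N] injective} ∏_{e ∈ E} X^{ε(e)} (φ (tar e), φ (src e))`. -/
noncomputable def injTrace (T : TestGraph) {N : ℕ} (X : Matrix (Fin N) (Fin N) ℂ) : ℂ :=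
  ∑ φ : Fin T.nV ↪ Fin N, ∏ e : Fin T.nE,
    (if T.star e then Xᴴ else X) (φ (T.tar e)) (φ (T.src e))

end TestGraph

/-! ### The two growth assumptions and the speed -/

/-- `M` tends to infinity and `M(N) ≤ log N / log log N` for all large `N`. -/
def IsSpeed (M : ℕ → ℕ) : Prop :=
  Tendsto M atTop atTop ∧
    ∀ᶠ N : ℕ in atTop, (M N : ℝ) ≤ Real.log N / Real.log (Real.log N)

/-- The injective trace growth assumption at speed `M` with constant `h > 0`: for every `c > 0` and
every sequence of test graphs `T N` with at most `c M(N)` vertices and at most `c M(N)` edges, and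
`K(N)` connected components,
`𝔼 [N^{-K(N)} Tr⁰ (T_N (X_N))] = O (N^{c h})`, the expectation being well defined for large `N`. -/
def TrafficGrowth {Ω : ℕ → Type*} [∀ N, MeasurableSpace (Ω N)] (P : ∀ N, Measure (Ω N))
    (X : ∀ N, Ω N → Matrix (Fin N) (Fin N) ℂ) (M : ℕ → ℕ) (h : ℝ) : Prop :=
  0 < h ∧ ∀ c : ℝ, 0 < c → ∀ T : ℕ → TestGraph,
    (∀ N, ((T N).nV : ℝ) ≤ c * M N ∧ ((T N).nE : ℝ) ≤ c * M N) →
    (∀ᶠ N in atTop, Integrable (fun ω => (T N).injTrace (X N ω)) (P N)) ∧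
    (fun N : ℕ => ∫ ω, ((N : ℂ) ^ (T N).numComponents)⁻¹ * (T N).injTrace (X N ω) ∂(P N))
      =O[atTop] fun N : ℕ => (N : ℝ) ^ (c * h)

/-- The Frobenius (Schatten) assumption at speed `M` with constant `C > 0`: for all `N`,
`𝔼 [N⁻¹ ‖X_N ^ M(N)‖_F²] ≤ C ^ M(N)`, this expectation being finite. -/
def FrobeniusGrowth {Ω : ℕ → Type*} [∀ N, MeasurableSpace (Ω N)] (P : ∀ N, Measure (Ω N))
    (X : ∀ N, Ω N → Matrix (Fin N) (Fin N) ℂ) (M : ℕ → ℕ) (C : ℝ) : Prop :=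
  0 < C ∧ ∀ N : ℕ, Integrable (fun ω => frobSq (X N ω ^ M N)) (P N) ∧
    ∫ ω, (N : ℝ)⁻¹ * frobSq (X N ω ^ M N) ∂(P N) ≤ C ^ M N

/-! ### The vertex set of the free sum -/

/-- The two colours: `Side.a` for the matrix `A`, `Side.b` for the matrix `B`. -/
inductive Side where
  | a
  | b
  deriving DecidableEq

/-- The opposite colour. -/
def Side.other : Side → Side
  | .a => .b
  | .b => .a

variable {N : ℕ} {x : Fin N}

/-- The vertex set with root `x`. The root is `none`. The vertex `(j₁, …, jₙ, s)`, where `n ≥ 1`,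
`s` is a colour and `x ≠ j₁`, `j₁ ≠ j₂`, …, `jₙ₋₁ ≠ jₙ`, is `some ([jₙ, …, j₁], s)`: the word is
stored with its last index first. -/
abbrev Vertex (x : Fin N) : Type :=
  Option {p : List (Fin N) × Side // p.1 ≠ [] ∧ (p.1 ++ [x]).IsChain (· ≠ ·)}

namespace Vertex

/-- The vertex `(j₁, …, jₙ, s)` given by the reversed word `[jₙ, …, j₁]`; for `n = 0` it is the root,
whatever the colour. -/
def mk (s : Side) (l : List (Fin N)) (h : (l ++ [x]).IsChain (· ≠ ·)) : Vertex x :=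
  if hl : l = [] then none else some ⟨(l, s), hl, h⟩

/-- The reversed word `[jₙ, …, j₁]` of a vertex, which is empty for the root. -/
def word : Vertex x → List (Fin N)
  | none => []
  | some p => p.1.1

theorem word_chain : ∀ v : Vertex x, (word v ++ [x]).IsChain (· ≠ ·)
  | none => by simp [word]
  | some p => p.2.2

/-- The last index `j(v)` of a vertex; it is `x` for the root. -/
def last (v : Vertex x) : Fin N :=
  (word v ++ [x]).head (by simp)

theorem cons_chain (v : Vertex x) (k : Fin N) (hk : k ≠ last v) :
    ((k :: word v) ++ [x]).IsChain (· ≠ ·) := by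
  have h := word_chain v
  unfold last at hk
  cases hw : word v with
  | nil => simp_all
  | cons j l => simp_all

/-- The base vertex `v₀` of the component `R_s(v₀)` of colour `s` that contains `v`: it is `v` itself
if `v` is the root or ends in the other colour, and `(j₁, …, jₙ₋₁, s')` with `s'` the other colour
if `v = (j₁, …, jₙ, s)`. -/
def base (s : Side) : Vertex x → Vertex x
  | none => none
  | some p =>
    if p.1.2 = s then
      mk s.other p.1.1.tail (by
        obtain ⟨⟨l, t⟩, hl, h⟩ := p
        cases l with
        | nil => simp at hl
        | cons j l => exact h.tail)
    else some p

/-- For a vertex `v₀ = (j₁, …, jₙ, s')`, with `s'` the colour other than `s`, or the root, the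
vertex with last index `k` in the component
`R_s(v₀) = {v₀} ∪ {(j₁, …, jₙ, k, s) | k ≠ j(v₀)}`. -/
def child (s : Side) (v : Vertex x) (k : Fin N) : Vertex x :=
  if hk : k = last v then v else mk s (k :: word v) (cons_chain v k hk)

/-- The vertex with last index `k` in the component of colour `s` that contains `v`. -/
def move (s : Side) (v : Vertex x) (k : Fin N) : Vertex x :=
  child s (base s v) k

@[simp] theorem last_child (s : Side) (v : Vertex x) (k : Fin N) : last (child s v k) = k := by
  unfold child
  split_ifs with h
  · exact h.symm
  · simp [mk, last, word]

@[simp] theorem last_move (s : Side) (v : Vertex x) (k : Fin N) : last (move s v k) = k :=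
  last_child _ _ _

theorem base_child_base (s : Side) (v : Vertex x) (k : Fin N) :
    base s (child s (base s v) k) = base s v := by
  have hb : ∀ v : Vertex x, base s (base s v) = base s v := by
    rintro (_ | ⟨⟨l, t⟩, hl, h⟩)
    · rfl
    · by_cases ht : t = s
      · subst ht
        by_cases hl' : l.tail = []
        · simp [base, mk, hl']
        · cases t <;> simp [base, mk, hl', Side.other]
      · simp [base, ht]
  have key : ∀ u : Vertex x, base s u = u → base s (child s u k) = u := by
    intro u hu
    unfold child
    split_ifs with h
    · exact hu
    · rcases u with _ | ⟨⟨l, t⟩, hl, hc⟩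
      · simp [base, mk, word]
      · by_cases ht : t = s
        · exfalso
          subst ht
          by_cases hl' : l.tail = []
          · simp [base, mk, hl'] at hu
          · cases t <;> simp [base, mk, hl', Side.other] at hu
        · have ht' : t = s.other := by cases s <;> cases t <;> simp_all [Side.other]
          simp only [base, mk, word, reduceCtorEq, ↓reduceDIte, ↓reduceIte, List.tail_cons]
          simp [hl, ht']
  exact key _ (hb v)

theorem child_base_last (s : Side) (v : Vertex x) : child s (base s v) (last v) = v := by
  rcases v with _ | ⟨⟨l, t⟩, hl, hc⟩
  · simp [base, child]
  · by_cases ht : t = s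
    · subst ht
      cases l with
      | nil => simp at hl
      | cons j l =>
        cases l with
        | nil =>
          have : j ≠ x := by simpa using hc
          simp [base, child, mk, last, word, this]
        | cons i l =>
          have : j ≠ i := by
            simp only [List.cons_append, List.isChain_cons_cons] at hc
            exact hc.1
          simp [base, child, mk, last, word, this]
    · simp [base, child, ht]

/-- `move s v k = w` says that `v` and `w` lie in the same component of colour `s` and that `w` has
last index `k`. -/
theorem move_eq_iff (s : Side) (v w : Vertex x) (k : Fin N) :
    move s v k = w ↔ base s v = base s w ∧ k = last w := by
  constructor
  · rintro rfl
    exact ⟨(base_child_base s v k).symm, (last_move s v k).symm⟩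
  · rintro ⟨h, rfl⟩
    rw [move, h, child_base_last]

theorem injective_last_move (s : Side) (k : Fin N) :
    Function.Injective fun v : Vertex x => (last v, move s v k) := by
  intro v w h
  simp only [Prod.mk.injEq] at h
  have hb : base s v = base s w := by
    have := congrArg (base s) h.2
    simpa [move, base_child_base] using this
  rw [← child_base_last s v, ← child_base_last s w, hb, h.1]

end Vertex

/-! ### The operators `a`, `b` and the Cauchy transforms -/

/-- The Hilbert space `ℓ²(V_N^x)`. -/
abbrev H (x : Fin N) : Type := lp (fun _ : Vertex x => ℂ) 2

/-- The basis vector `δ_v`. -/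
noncomputable def delta (v : Vertex x) : H x := lp.single 2 v 1

theorem summable_move (s : Side) (k : Fin N) (f : H x) :
    Summable (fun v : Vertex x => ‖f (Vertex.move s v k)‖ ^ 2) ∧
      ∑' v : Vertex x, ‖f (Vertex.move s v k)‖ ^ 2 ≤ N * ‖f‖ ^ 2 := by
  have hf : Summable fun v => ‖f v‖ ^ 2 := by
    simpa using (lp.memℓp f).summable (by norm_num)
  have hn : ∑' v, ‖f v‖ ^ 2 = ‖f‖ ^ 2 := by
    simpa using (lp.norm_rpow_eq_tsum (p := 2) (by norm_num) f).symm
  have hg : Summable fun q : Fin N × Vertex x => ‖f q.2‖ ^ 2 := by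
    rw [summable_prod_of_nonneg (fun _ => by positivity)]
    exact ⟨fun _ => hf, (hasSum_fintype _).summable⟩
  have hs := hg.comp_injective (Vertex.injective_last_move (x := x) s k)
  refine ⟨hs, ?_⟩
  calc ∑' v : Vertex x, ‖f (Vertex.move s v k)‖ ^ 2
      ≤ ∑' q : Fin N × Vertex x, ‖f q.2‖ ^ 2 :=
        tsum_comp_le_tsum_of_inj hg (fun _ => by positivity) (Vertex.injective_last_move s k)
    _ = N * ‖f‖ ^ 2 := by
        rw [hg.tsum_prod' (fun _ => hf)]
        simp [hn]

/-- Square summability of `v ↦ ∑ k, X (j(v), k) f (move s v k)`, with a bound. -/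
theorem compOp_bound (s : Side) (X : Matrix (Fin N) (Fin N) ℂ) (f : H x) :
    Summable (fun v : Vertex x =>
        ‖∑ k, X (Vertex.last v) k * f (Vertex.move s v k)‖ ^ 2) ∧
      ∑' v : Vertex x, ‖∑ k, X (Vertex.last v) k * f (Vertex.move s v k)‖ ^ 2 ≤
        (∑ i, ∑ k, ‖X i k‖ ^ 2) * (N * (N * ‖f‖ ^ 2)) := by
  set K : ℝ := ∑ i, ∑ k, ‖X i k‖ ^ 2 with hK
  have hpt : ∀ v : Vertex x, ‖∑ k, X (Vertex.last v) k * f (Vertex.move s v k)‖ ^ 2 ≤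
      K * ∑ k, ‖f (Vertex.move s v k)‖ ^ 2 := by
    intro v
    calc ‖∑ k, X (Vertex.last v) k * f (Vertex.move s v k)‖ ^ 2
        ≤ (∑ k, ‖X (Vertex.last v) k‖ * ‖f (Vertex.move s v k)‖) ^ 2 := by
          gcongr
          exact (norm_sum_le _ _).trans_eq (by simp)
      _ ≤ (∑ k, ‖X (Vertex.last v) k‖ ^ 2) * ∑ k, ‖f (Vertex.move s v k)‖ ^ 2 :=
          Finset.sum_mul_sq_le_sq_mul_sq _ _ _
      _ ≤ K * ∑ k, ‖f (Vertex.move s v k)‖ ^ 2 := by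
          gcongr
          exact Finset.single_le_sum (f := fun i => ∑ k, ‖X i k‖ ^ 2)
            (fun _ _ => by positivity) (Finset.mem_univ _)
  have hsum : Summable fun v : Vertex x => K * ∑ k, ‖f (Vertex.move s v k)‖ ^ 2 :=
    (summable_sum fun k _ => (summable_move s k f).1).mul_left K
  have hs := Summable.of_nonneg_of_le (fun _ => by positivity) hpt hsum
  refine ⟨hs, (hs.tsum_le_tsum hpt hsum).trans ?_⟩
  rw [tsum_mul_left, Summable.tsum_finsetSum fun k _ => (summable_move s k f).1]
  have hK0 : 0 ≤ K := by positivity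
  refine mul_le_mul_of_nonneg_left ?_ hK0
  calc ∑ k, ∑' v : Vertex x, ‖f (Vertex.move s v k)‖ ^ 2
      ≤ ∑ _k : Fin N, (N : ℝ) * ‖f‖ ^ 2 := Finset.sum_le_sum fun k _ => (summable_move s k f).2
    _ = N * (N * ‖f‖ ^ 2) := by simp

/-- The bounded operator on `ℓ²(V_N^x)` that acts as the matrix `X` on every component of colour
`s`: `(T f) (v) = ∑_w X (j(v), j(w)) f(w)`, the sum running over the component of `v`. -/
noncomputable def compOp (s : Side) (X : Matrix (Fin N) (Fin N) ℂ) : H x →L[ℂ] H x :=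
  LinearMap.mkContinuous
    { toFun := fun f => ⟨fun v => ∑ k, X (Vertex.last v) k * f (Vertex.move s v k),
        memℓp_gen (by simpa using (compOp_bound s X f).1)⟩
      map_add' := fun f g => by
        ext v
        simp only [lp.coeFn_add, Pi.add_apply, mul_add, Finset.sum_add_distrib]
      map_smul' := fun c f => by
        ext v
        simp [Finset.mul_sum, mul_left_comm] }
    (Real.sqrt (∑ i, ∑ k, ‖X i k‖ ^ 2) * N)
    (fun f => by
      refine le_of_sq_le_sq ?_ (by positivity)
      rw [mul_pow, mul_pow, Real.sq_sqrt (by positivity)]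
      refine le_trans (le_of_eq ?_) ((compOp_bound s X f).2.trans_eq (by ring))
      simpa using lp.norm_rpow_eq_tsum (p := 2) (by norm_num)
        (⟨fun v => ∑ k, X (Vertex.last v) k * f (Vertex.move s v k),
          memℓp_gen (by simpa using (compOp_bound s X f).1)⟩ : H x))

theorem compOp_apply (s : Side) (X : Matrix (Fin N) (Fin N) ℂ) (f : H x) (v : Vertex x) :
    compOp s X f v = ∑ k, X (Vertex.last v) k * f (Vertex.move s v k) := rfl

/-- The matrix coefficients: `⟨T δ_v, δ_w⟩` is `X (j(w), j(v))` if `v` and `w` lie in the same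
component of colour `s`, and `0` otherwise. -/
theorem inner_delta_compOp_delta (s : Side) (X : Matrix (Fin N) (Fin N) ℂ) (v w : Vertex x) :
    inner ℂ (delta w) (compOp s X (delta v)) =
      if Vertex.base s v = Vertex.base s w then X (Vertex.last w) (Vertex.last v) else 0 := by
  rw [delta, lp.inner_single_left, compOp_apply]
  simp only [delta, lp.single_apply, Pi.single_apply, Vertex.move_eq_iff]
  by_cases h : Vertex.base s v = Vertex.base s w
  · simp [h]
  · simp [h, Ne.symm h]

/-- The free sum over the diagonal `a + b` of `A` and `B`, as an operator on `ℓ²(V_N^x)`. -/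
noncomputable def freeSum (x : Fin N) (A B : Matrix (Fin N) (Fin N) ℂ) : H x →L[ℂ] H x :=
  compOp Side.a A + compOp Side.b B

/-- The conditional expectation onto diagonal matrices of an operator on `ℓ²(V_N^x)`: the `i`-th
diagonal entry is `⟨T δ_v, δ_v⟩` with `v = (i, a)` for `i ≠ x`, and `v` the root for `i = x`. -/
noncomputable def diagExp (T : H x →L[ℂ] H x) : Matrix (Fin N) (Fin N) ℂ :=
  Matrix.diagonal fun i =>
    inner ℂ (delta (Vertex.child Side.a none i)) (T (delta (Vertex.child Side.a none i)))

/-- The diagonal-valued Cauchy transform `G_{A+B}(zI) = Δ ((zI - (A + B))⁻¹)`. -/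
noncomputable def cauchySum (A B : Matrix (Fin N) (Fin N) ℂ) (z : ℂ) :
    Matrix (Fin N) (Fin N) ℂ :=
  Matrix.diagonal (Matrix.diag (resolvent (A + B) z))

/-- The diagonal-valued Cauchy transform `G_{a+b}(zI)` of the free sum over the diagonal. -/
noncomputable def cauchyFreeSum (x : Fin N) (A B : Matrix (Fin N) (Fin N) ℂ) (z : ℂ) :
    Matrix (Fin N) (Fin N) ℂ :=
  diagExp (resolvent (freeSum x A B) z)

end DiagFreeSum

/-!
The moments of the free sum are compared with those of `A + B` by lifting closed walks on the labels
to the vertex set `V_N^x`: the error collects the closed walks with an open lift. Such a walk, cut at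
a non-separating vertex, is a single trail, which bounds the associated injective sums of `A` and `B`
by the operator norms. Independence and permutation invariance then bound the mean square error, and
the resolvents are expanded into finitely many moments with a remainder controlled by traces.
-/

/-! Both resolvents are expanded in powers of 1/z, so that diagonal moments have to be compared. The
entry ((A+B)^n)_ii is a sum over closed coloured walks on the labels. The matching entry for the
free sum is the same sum restricted to the walks whose lift to the vertex set is closed as well. The
error of a moment therefore collects the walks that close on the labels but not upstairs
(`momentError_eq_sum`). Whether a lift closes depends only on the coincidences between labels
(`Vertex.lift_eq_self_of_relabel`), and a walk with an open lift has a vertex at which the two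
colours stay connected to each other after being detached (`Vertex.lift_eq_self_of_isSeparating`).

The squared error is a sum over pairs of such walks with a common base point. Fix a pattern of
coincidences with m vertices. By independence and permutation invariance, the expectation of the sum
over injective labellings is the expected injective sum of the A-steps times that of the B-steps,
divided by N(N-1)...(N-m+1), which is of order N^m for fixed m. It remains to bound the product of
the two injective sums by N^m, up to powers of the operator norms and a factor depending on m only
(`norm_injective_sums_le`). Injectivity is removed by a random colouring of the labels. Then the
A-labels and B-labels are coupled: once their differences away from the non-separating vertex v are
fixed, in N^(m-1) ways, there remains one sum over the labellings of the walk with v split in two.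
Since v does not separate, the edges of the split graph can be ordered as a single trail
(`oneTrail_of_not_isSeparating`). The repeated visits of the trail can be decoupled by characters of
Z/N, so its sum is an average of bilinear forms in products of contractions, hence at most N
(`trail_sum_le`). Altogether this gives N · N^(m-1).

The operator norms cost little: ‖A‖^(2M) is at most ‖A^M‖_F², of mean at most N C^M, so the 2n
factors of a pair of walks cost a constant multiple of (N C^M)^(n/M). The patterns cost about
(2n+1)^(4n+2). For n at most 0.19 M, with M^M ≤ N along a speed, the whole is N^0.97 times an
exponential in M, and the normalisation 1/N wins.

The expansion is cut at an even order n = 2p. For self-adjoint operators the remainder is then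
bounded by the diagonal moment of order n (`norm_inner_resolvent_sub_le`), whose normalised mean
square is at most 4(4C)^n by convexity of traces. This leaves a constant times (r₀/|z|)^(2n). With p
near 0.095 M one has 2n ≥ 0.34 M, which exceeds 2cM because c < 1/6. -/

namespace DiagFreeSum

/-! ### Walks -/

section Walks

variable {κ α γ : Type*}

/-- The endpoint of the walk that starts at `a` and whose steps have labels and targets `l`. -/
def walkEnd : α → List (κ × α) → α
  | a, [] => a
  | _, p :: l => walkEnd p.2 l

/-- The list of the steps (source, label, target) of a walk. -/
def walkSteps : α → List (κ × α) → List (α × κ × α)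
  | _, [] => []
  | a, p :: l => (a, p.1, p.2) :: walkSteps p.2 l

@[simp] theorem walkEnd_nil (a : α) : walkEnd a ([] : List (κ × α)) = a := rfl

@[simp] theorem walkEnd_cons (a : α) (p : κ × α) (l : List (κ × α)) :
    walkEnd a (p :: l) = walkEnd p.2 l := rfl

@[simp] theorem walkSteps_nil (a : α) : walkSteps a ([] : List (κ × α)) = [] := rfl

@[simp] theorem walkSteps_cons (a : α) (p : κ × α) (l : List (κ × α)) :
    walkSteps a (p :: l) = (a, p.1, p.2) :: walkSteps p.2 l := rfl

theorem walkEnd_append (l l' : List (κ × α)) :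
    ∀ a : α, walkEnd a (l ++ l') = walkEnd (walkEnd a l) l' := by
  induction l with
  | nil => intro a; rfl
  | cons p l ih => intro a; exact ih _

theorem walkSteps_append (l l' : List (κ × α)) :
    ∀ a : α, walkSteps a (l ++ l') = walkSteps a l ++ walkSteps (walkEnd a l) l' := by
  induction l with
  | nil => intro a; rfl
  | cons p l ih => intro a; simp [ih]

theorem walkEnd_map {κ' : Type*} (q : κ → κ') (f : α → γ) (l : List (κ × α)) :
    ∀ a : α, walkEnd (f a) (l.map (Prod.map q f)) = f (walkEnd a l) := by
  induction l with
  | nil => intro a; rfl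
  | cons p l ih => intro a; exact ih _

theorem walkSteps_map {κ' : Type*} (q : κ → κ') (f : α → γ) (l : List (κ × α)) :
    ∀ a : α, walkSteps (f a) (l.map (Prod.map q f)) =
      (walkSteps a l).map (Prod.map f (Prod.map q f)) := by
  induction l with
  | nil => intro a; rfl
  | cons p l ih => intro a; simp [ih, Prod.map]

theorem exists_mem_walkSteps {p : κ × α} {l : List (κ × α)} (hp : p ∈ l) :
    ∀ a : α, ∃ e ∈ walkSteps a l, e.2.2 = p.2 := by
  induction l with
  | nil => simp at hp
  | cons q l ih =>
    intro a
    rcases List.mem_cons.1 hp with rfl | hp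
    · exact ⟨_, List.mem_cons_self, rfl⟩
    · obtain ⟨e, he, h⟩ := ih hp q.2
      exact ⟨e, List.mem_cons_of_mem _ he, h⟩

theorem length_walkSteps (l : List (κ × α)) : ∀ a : α, (walkSteps a l).length = l.length := by
  induction l with
  | nil => intro a; rfl
  | cons p l ih => intro a; simp [ih]

/-- A vertex `v` separates a list of coloured steps if, once the steps of the two colours are
detached from each other at `v`, no path joins the two copies of `v`: the other vertices can be
coloured by `g` accordingly. -/
def IsSeparating (col : κ → Side) (v : α) (L : List (α × κ × α)) : Prop :=
  ∃ g : α → Side, ∀ e ∈ L,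
    (e.1 ≠ v → e.2.2 ≠ v → g e.1 = g e.2.2) ∧
    (e.1 = v → e.2.2 ≠ v → g e.2.2 = col e.2.1) ∧
    (e.1 ≠ v → e.2.2 = v → g e.1 = col e.2.1)

theorem IsSeparating.mono {col : κ → Side} {v : α} {L L' : List (α × κ × α)}
    (h : IsSeparating col v L) (hL : ∀ e ∈ L', e ∈ L) : IsSeparating col v L' := by
  obtain ⟨g, hg⟩ := h
  exact ⟨g, fun e he => hg e (hL e he)⟩

/-- Separation is transported by injective relabellings. -/
theorem IsSeparating.map {κ' : Type*} {col : κ → Side} {col' : κ' → Side} {f : α → γ}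
    {q : κ → κ'} (hf : Function.Injective f) (hq : ∀ k, col' (q k) = col k)
    {L : List (α × κ × α)} (h : ∀ v, IsSeparating col v L) (u : γ) :
    IsSeparating col' u (L.map (Prod.map f (Prod.map q f))) := by
  by_cases hu : ∃ v, f v = u
  · obtain ⟨v, rfl⟩ := hu
    obtain ⟨g, hg⟩ := h v
    refine ⟨Function.extend f g fun _ => Side.a, fun e he => ?_⟩
    obtain ⟨e', he', rfl⟩ := List.mem_map.1 he
    simpa [hf.extend_apply, hf.eq_iff, hq] using hg e' he'
  · refine ⟨fun _ => Side.a, fun e he => ?_⟩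
    obtain ⟨e, he, rfl⟩ := List.mem_map.1 he
    push Not at hu
    simp [hu]

end Walks

namespace Vertex

variable {N : ℕ} {x : Fin N}

theorem move_last (s : Side) (v : Vertex x) : move s v (last v) = v := child_base_last s v

theorem base_move (s : Side) (v : Vertex x) (k : Fin N) : base s (move s v k) = base s v :=
  base_child_base s v k

theorem move_congr {s : Side} {v w : Vertex x} (h : base s v = base s w) (k : Fin N) :
    move s v k = move s w k := by
  unfold move; rw [h]

theorem move_move (s : Side) (v : Vertex x) (k j : Fin N) :
    move s (move s v k) j = move s v j := move_congr (base_move s v k) j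

/-- The lift of a coloured walk on the labels to the vertex set of the free sum. -/
def lift (v : Vertex x) (l : List (Side × Fin N)) : Vertex x :=
  l.foldl (fun v p => move p.1 v p.2) v

@[simp] theorem lift_nil (v : Vertex x) : lift v [] = v := rfl

@[simp] theorem lift_cons (v : Vertex x) (p : Side × Fin N) (l : List (Side × Fin N)) :
    lift v (p :: l) = lift (move p.1 v p.2) l := rfl

theorem lift_append (v : Vertex x) (l l' : List (Side × Fin N)) :
    lift v (l ++ l') = lift (lift v l) l' := List.foldl_append

theorem last_lift (l : List (Side × Fin N)) :
    ∀ v : Vertex x, last (lift v l) = walkEnd (last v) l := by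
  induction l with
  | nil => intro v; rfl
  | cons p l ih => intro v; simp [ih]

/-- On a stretch of the walk that never meets `x0` only the first clause of separation applies, so
the colour `g` cannot change there. -/
theorem eq_of_avoid {κ α : Type*} {x0 : α} {g : α → Side} :
    ∀ (l : List (κ × α)) (k : α), k ≠ x0 →
    (∀ l₁, l₁ <+: l → walkEnd k l₁ ≠ x0) →
    (∀ e ∈ walkSteps k l, (e.1 ≠ x0 → e.2.2 ≠ x0 → g e.1 = g e.2.2)) →
    g k = g (walkEnd k l) := by
  intro l
  induction l with
  | nil => intros; rfl
  | cons p l ih =>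
    intro k hk hl hg
    have hp : p.2 ≠ x0 := by
      have := hl [p] (by simp)
      simpa using this
    have h1 : g k = g p.2 := hg (k, p.1, p.2) (by simp) hk hp
    rw [h1]
    refine ih p.2 hp (fun l₁ h₁ => ?_) (fun e he => hg e (by simp [he]))
    have := hl (p :: l₁) (by simpa using h₁)
    simpa using this

/-- A closed walk all of whose vertices are separating lifts to a closed walk. -/
theorem lift_eq_self_of_isSeparating (n : ℕ) :
    ∀ (l : List (Side × Fin N)) (v : Vertex x), l.length = n →
      walkEnd (last v) l = last v →
      (∀ u, IsSeparating id u (walkSteps (last v) l)) → lift v l = v := by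
  induction n using Nat.strong_induction_on with
  | _ n ih =>
  intro l v hn hend hsep
  -- If the walk returns to its starting label midway, the two shorter closed walks lift to closed
  -- walks separately, since separation passes to sublists of steps.
  by_cases hret : ∃ l₁ l₂, l = l₁ ++ l₂ ∧ l₁ ≠ [] ∧ l₂ ≠ [] ∧ walkEnd (last v) l₁ = last v
  · obtain ⟨l₁, l₂, rfl, h₁, h₂, hr⟩ := hret
    have e₁ := List.length_pos_iff.2 h₁
    have e₂ := List.length_pos_iff.2 h₂
    rw [List.length_append] at hn
    rw [walkEnd_append, hr] at hend
    simp only [walkSteps_append, hr] at hsep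
    have k₁ := ih l₁.length (by omega) l₁ v rfl hr
      fun u => (hsep u).mono fun e he => List.mem_append_left _ he
    have k₂ := ih l₂.length (by omega) l₂ v rfl hend
      fun u => (hsep u).mono fun e he => List.mem_append_right _ he
    rw [lift_append, k₁, k₂]
  push Not at hret
  rcases l with _ | ⟨⟨s, k⟩, l⟩
  · rfl
  rcases List.eq_nil_or_concat l with rfl | ⟨mid, ⟨t, j⟩, rfl⟩
  · have : k = last v := by simpa using hend
    subst this
    simp [move_last]
  rw [List.concat_eq_append] at *
  have hj : j = last v := by
    rw [walkEnd_cons, walkEnd_append] at hend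
    simpa using hend
  subst hj
  have hpre : ∀ l₁, l₁ <+: mid → walkEnd k l₁ ≠ last v := by
    rintro l₁ ⟨l₂, rfl⟩
    exact hret ((s, k) :: l₁) (l₂ ++ [(t, last v)]) (by simp) (by simp) (by simp)
  have hk : k ≠ last v := by simpa using hpre [] (by simp)
  have hm : walkEnd k mid ≠ last v := hpre mid (by simp)
  -- Between its first and last steps the walk avoids its start, which is separating, so it leaves
  -- and comes back in the same colour.
  have hst : s = t := by
    obtain ⟨g, hg⟩ := hsep (last v)
    have h1 : g k = s := (hg (last v, s, k) (by simp)).2.1 rfl hk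
    have h2 : g (walkEnd k mid) = t :=
      (hg (walkEnd k mid, t, last v) (by simp [walkSteps_append])).2.2 hm rfl
    have h3 := eq_of_avoid (g := g) mid k hk hpre
      (fun e he => (hg e (by simp [walkSteps_append, he])).1)
    rw [← h1, ← h2, h3]
  subst hst
  -- The first and last steps have the same colour, so they merge into one step of colour `s` from
  -- the end of `mid` to `k`. This gives a closed walk one step shorter, based at `move s v k`. It
  -- no longer visits `last v`, which separates it trivially. Any other vertex still separates, as
  -- the merged step inherits its constraints from the two old ones through `last v`.
  have key := ih (mid ++ [(s, k)]).length (by subst hn; simp) (mid ++ [(s, k)])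
    (move s v k) rfl (by simp [walkEnd_append]) (by
      intro u
      rw [last_move]
      obtain ⟨g, hg⟩ := hsep u
      have h1 := hg (last v, s, k) (by simp)
      have h2 := hg (walkEnd k mid, s, last v) (by simp [walkSteps_append])
      by_cases hu : u = last v
      · exact ⟨fun _ => g k, by
          subst hu
          intro e he
          rw [walkSteps_append, List.mem_append] at he
          have hne : e.1 ≠ last v ∧ e.2.2 ≠ last v := by
            rcases he with he | he
            · have : ∀ (m : List (Side × Fin N)) (k' : Fin N), k' ≠ last v →
                  (∀ l₁, l₁ <+: m → walkEnd k' l₁ ≠ last v) →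
                  ∀ e ∈ walkSteps k' m, e.1 ≠ last v ∧ e.2.2 ≠ last v := by
                intro m
                induction m with
                | nil => intro k' _ _ e he; simp at he
                | cons p m ihm =>
                  intro k' hk' hp' e he
                  have hp : p.2 ≠ last v := by simpa using hp' [p] (by simp)
                  rcases List.mem_cons.1 he with rfl | he
                  · exact ⟨hk', hp⟩
                  · refine ihm p.2 hp (fun l₁ h₁ => ?_) e he
                    simpa using hp' (p :: l₁) (by simpa using h₁)
              exact this mid k hk hpre e he
            · simp only [walkSteps_cons, walkSteps_nil, List.mem_singleton] at he
              subst he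
              exact ⟨hm, hk⟩
          exact ⟨fun _ _ => rfl, fun h => absurd h hne.1, fun _ h => absurd h hne.2⟩⟩
      · refine ⟨g, fun e he => ?_⟩
        rw [walkSteps_append, List.mem_append] at he
        rcases he with he | he
        · exact hg e (by simp [walkSteps_append, he])
        · simp only [walkSteps_cons, walkSteps_nil, List.mem_singleton] at he
          subst he
          refine ⟨fun a b => ?_, fun a b => ?_, fun a b => ?_⟩
          · exact (h2.1 a (Ne.symm hu)).trans (h1.1 (Ne.symm hu) b)
          · exact (h1.1 (Ne.symm hu) b).symm.trans (h2.2.1 a (Ne.symm hu))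
          · exact (h2.1 a (Ne.symm hu)).trans (h1.2.2 (Ne.symm hu) b))
  rw [lift_cons, lift_append, lift_cons, lift_nil]
  rw [lift_append, lift_cons, lift_nil] at key
  -- Closure of the shortened walk says that the lift of `mid` ends in the component of colour `s`
  -- containing `v`. The step to `last v` in that component ends at `v`.
  have hb := congrArg (base s) key
  rw [base_move, base_move] at hb
  exact (move_congr hb (last v)).trans (move_last s v)

/-! #### Covering maps -/

variable {x' : Fin N}

/-- The covering map over the relabelling `σ` that sends the root to `u`, on words. -/
def coverWord (σ : Fin N → Fin N) (u : Vertex x') : List (Fin N) → Side → Vertex x'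
  | [], _ => u
  | j :: l, s => move s (coverWord σ u l s.other) (σ j)

/-- The covering map over the relabelling `σ` that sends the root to `u`. -/
def cover (σ : Fin N → Fin N) (u : Vertex x') : Vertex x → Vertex x'
  | none => u
  | some p => coverWord σ u p.1.1 p.1.2

theorem last_cover {σ : Fin N → Fin N} {u : Vertex x'} (hu : last u = σ x) :
    ∀ v : Vertex x, last (cover σ u v) = σ (last v)
  | none => by simpa [cover, last, word] using hu
  | some ⟨(l, s), hl, hc⟩ => by
    cases l with
    | nil => simp at hl
    | cons j l => exact last_move _ _ _

/-- The cover is built from `move` rather than `child`, so nothing is asked of `σ`: the image of a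
child may fall back on the image of its parent. -/
theorem cover_child {σ : Fin N → Fin N} {u : Vertex x'} (hu : last u = σ x) (s : Side)
    {v : Vertex x} (hv : base s v = v) (k : Fin N) :
    cover σ u (child s v k) = move s (cover σ u v) (σ k) := by
  unfold child
  split_ifs with hk
  · rw [hk, ← last_cover hu v, move_last]
  · rcases v with _ | ⟨⟨l, t⟩, hl, hc⟩
    · simp [mk, cover, coverWord, word]
    · have ht : t = s.other := by
        by_cases ht : t = s
        · exfalso
          subst ht
          by_cases hl' : l.tail = []
          · simp [base, mk, hl'] at hv
          · cases t <;> simp [base, mk, hl', Side.other] at hv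
        · cases s <;> cases t <;> simp_all [Side.other]
      subst ht
      simp [mk, cover, coverWord, word]

theorem base_base (s : Side) (v : Vertex x) : base s (base s v) = base s v := by
  rcases v with _ | ⟨⟨l, t⟩, hl, h⟩
  · rfl
  · by_cases ht : t = s
    · subst ht
      by_cases hl' : l.tail = []
      · simp [base, mk, hl']
      · cases t <;> simp [base, mk, hl', Side.other]
    · simp [base, ht]

/-- The vertices of a component are all children of one base vertex, so by `cover_child` the cover
maps the component into a single component of the same colour. -/
theorem cover_move {σ : Fin N → Fin N} {u : Vertex x'} (hu : last u = σ x) (s : Side)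
    (v : Vertex x) (k : Fin N) :
    cover σ u (move s v k) = move s (cover σ u v) (σ k) := by
  unfold move
  rw [cover_child hu s (base_base s v), ← move]
  refine move_congr ?_ _
  conv_rhs => rw [← child_base_last s v, cover_child hu s (base_base s v), base_move]

theorem cover_lift {σ : Fin N → Fin N} {u : Vertex x'} (hu : last u = σ x)
    (l : List (Side × Fin N)) : ∀ v : Vertex x,
    cover σ u (lift v l) = lift (cover σ u v) (l.map (Prod.map id σ)) := by
  induction l with
  | nil => intro v; rfl
  | cons p l ih => intro v; simp [ih, cover_move hu]

/-- Two lifts that start over the same label with different starting points coincide up to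
the covering map; every step can be undone. -/
theorem exists_lift_to (v : Vertex x) : ∃ l : List (Side × Fin N),
    ∃ l' : List (Side × Fin N), lift none l = v ∧
      walkEnd (last v) l' = x ∧ ∀ {y : Fin N} (σ : Fin N → Fin N) (w : Vertex y), last w = σ (last v) →
        lift (lift w (l'.map (Prod.map id σ))) (l.map (Prod.map id σ)) = w := by
  suffices h : ∀ (l : List (Fin N)) (s : Side) (hl : l ≠ []) (hc : (l ++ [x]).IsChain (· ≠ ·)),
      ∃ p p' : List (Side × Fin N), lift none p = (some ⟨(l, s), hl, hc⟩ : Vertex x) ∧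
      walkEnd (l.head hl) p' = x ∧ ∀ {y : Fin N} (σ : Fin N → Fin N) (w : Vertex y),
        last w = σ (l.head hl) →
        lift (lift w (p'.map (Prod.map id σ))) (p.map (Prod.map id σ)) = w by
    rcases v with _ | ⟨⟨l, s⟩, hl, hc⟩
    · exact ⟨[], [], rfl, by simp [last, word], fun _ _ _ => rfl⟩
    · obtain ⟨p, p', h1, h2, h3⟩ := h l s hl hc
      have e : last (some ⟨(l, s), hl, hc⟩ : Vertex x) = l.head hl := by
        simp [last, word, List.head_append_of_ne_nil, hl]
      refine ⟨p, p', h1, e ▸ h2, fun σ w hw => h3 σ w (e ▸ hw)⟩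
  intro l
  induction l with
  | nil => intro s hl; simp at hl
  | cons j l ih =>
    intro s _ hc
    by_cases hl : l = []
    · subst hl
      have hj : j ≠ x := by simpa using hc
      refine ⟨[(s, j)], [(s, x)], ?_, rfl, fun σ w hw => ?_⟩
      · simp [move, base, child, mk, last, word, hj]
      · simp only [List.head_cons] at hw
        simp [move_move, ← hw, move_last]
    · have hc' : (l ++ [x]).IsChain (· ≠ ·) := hc.tail
      obtain ⟨p, p', h1, h2, h3⟩ := ih s.other hl hc'
      have hjl : j ≠ l.head hl := by
        cases l with
        | nil => simp at hl
        | cons i l => simp at hc; simpa using hc.1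
      refine ⟨p ++ [(s, j)], (s, l.head hl) :: p', ?_, by simpa using h2, fun σ w hw => ?_⟩
      · rw [lift_append, h1]
        have : s.other ≠ s := by cases s <;> simp [Side.other]
        simp [move, base, child, mk, last, word, List.head_append_of_ne_nil, hl, hjl, this]
      · simp only [List.head_cons] at hw
        have := h3 σ (move s w (σ (l.head hl))) (by simp)
        simp only [List.map_cons, List.map_append, Prod.map_apply, id, lift_cons, lift_append,
          List.map_nil, lift_nil]
        rw [this, move_move, ← hw, move_last]

/-- Whether the lift of a walk is closed only depends on the walk up to a relabelling. -/
theorem lift_eq_self_of_relabel {σ : Fin N → Fin N} {v : Vertex x} {v' : Vertex x'}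
    (hv : last v' = σ (last v)) {l : List (Side × Fin N)} (h : lift v l = v) :
    lift v' (l.map (Prod.map id σ)) = v' := by
  obtain ⟨p, p', h1, h2, h3⟩ := exists_lift_to v
  -- The image `u` of the root is found by walking back from `v'` along the relabelled path from `v`
  -- to the root. The resulting cover sends `v` to `v'` and carries the closed lift at `v` to the
  -- lift at `v'`.
  set u : Vertex x' := lift v' (p'.map (Prod.map id σ)) with hu
  have hlu : last u = σ x := by
    rw [hu, last_lift, hv, walkEnd_map, h2]
  have hcv : cover σ u v = v' := by
    conv_lhs => rw [← h1, cover_lift hlu]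
    exact h3 σ v' hv
  have := cover_lift hlu l v
  rw [h, hcv] at this
  exact this.symm

end Vertex

end DiagFreeSum

namespace DiagFreeSum

/-! ### Sums over the labellings of a trail -/

section Trails

variable {N : ℕ}

/-- A matrix whose bilinear form is bounded by `1`, that is, of operator norm at most `1`. -/
def IsContraction (X : Matrix (Fin N) (Fin N) ℂ) : Prop :=
  ∀ g f : Fin N → ℂ, ‖∑ i, ∑ j, g i * X i j * f j‖ ^ 2 ≤ (∑ i, ‖g i‖ ^ 2) * ∑ j, ‖f j‖ ^ 2

theorem IsContraction.transpose {X : Matrix (Fin N) (Fin N) ℂ} (h : IsContraction X) :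
    IsContraction Xᵀ := by
  intro g f
  rw [Finset.sum_comm, mul_comm]
  refine le_trans (le_of_eq ?_) (h f g)
  simp only [Matrix.transpose_apply]
  congr 2
  exact Finset.sum_congr rfl fun i _ => Finset.sum_congr rfl fun j _ => by ring

theorem IsContraction.conj {X : Matrix (Fin N) (Fin N) ℂ} (h : IsContraction X) :
    IsContraction (X.map star) := by
  intro g f
  have := h (fun i => star (g i)) (fun i => star (f i))
  rw [← norm_star] at this
  simpa [star_sum] using this

theorem IsContraction.submatrix {X : Matrix (Fin N) (Fin N) ℂ} (h : IsContraction X)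
    (σ τ : Fin N ≃ Fin N) : IsContraction (X.submatrix σ τ) := by
  intro g f
  have := h (g ∘ σ.symm) (f ∘ τ.symm)
  rw [← Equiv.sum_comp σ, ← Equiv.sum_comp σ (fun i => ‖(g ∘ σ.symm) i‖ ^ 2),
    ← Equiv.sum_comp τ (fun i => ‖(f ∘ τ.symm) i‖ ^ 2)] at this
  simp only [Function.comp, Equiv.symm_apply_apply] at this
  refine le_trans (le_of_eq ?_) this
  congr 2
  refine Finset.sum_congr rfl fun i _ => ?_
  rw [← Equiv.sum_comp τ (fun j => g i * X (σ i) j * f (τ.symm j))]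
  simp

/-- Duality: the bilinear form is tested against the conjugate of the vector whose norm is wanted.
-/
theorem IsContraction.sum_vecMul_le {X : Matrix (Fin N) (Fin N) ℂ} (h : IsContraction X)
    (u : Fin N → ℂ) : ∑ j, ‖∑ i, u i * X i j‖ ^ 2 ≤ ∑ i, ‖u i‖ ^ 2 := by
  set S := ∑ j, ‖∑ i, u i * X i j‖ ^ 2 with hS
  have h1 := h u (fun j => star (∑ i, u i * X i j))
  have e : ∑ i, ∑ j, u i * X i j * star (∑ i, u i * X i j) = (S : ℂ) := by
    rw [Finset.sum_comm, hS, Complex.ofReal_sum]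
    refine Finset.sum_congr rfl fun j _ => ?_
    rw [← Finset.sum_mul, Complex.star_def, Complex.mul_conj, Complex.normSq_eq_norm_sq]
  rw [e] at h1
  have hS0 : 0 ≤ S := Finset.sum_nonneg fun _ _ => by positivity
  simp only [norm_star, Complex.norm_real, Real.norm_of_nonneg hS0, ← hS] at h1
  rcases hS0.eq_or_lt with h0 | h0
  · rw [← h0]; exact Finset.sum_nonneg fun _ _ => by positivity
  · exact le_of_mul_le_mul_right (by nlinarith) h0

/-- Each step applies a contraction and then a diagonal matrix of norm at most 1 to the vector `u`.
The factor `N` is the Cauchy–Schwarz cost of summing the entries of the last vector. -/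
theorem chain_sum_le (n : ℕ) : ∀ (u : Fin N → ℂ) (μ : Fin n → Fin N → ℂ)
    (_ : ∀ t a, ‖μ t a‖ ≤ 1) (X : Fin n → Matrix (Fin N) (Fin N) ℂ)
    (_ : ∀ t, IsContraction (X t)),
    ‖∑ i : Fin (n + 1) → Fin N, u (i 0) * ∏ t : Fin n,
      (X t (i t.castSucc) (i t.succ) * μ t (i t.succ))‖ ^ 2 ≤ N * ∑ a, ‖u a‖ ^ 2 := by
  induction n with
  | zero =>
    intro u μ _ X _
    have e : ∑ i : Fin (0 + 1) → Fin N, u (i 0) * ∏ t : Fin 0,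
        (X t (i t.castSucc) (i t.succ) * μ t (i t.succ)) = ∑ a, u a := by
      rw [← Equiv.sum_comp (Equiv.funUnique (Fin 1) (Fin N)).symm]
      simp
    rw [e]
    calc ‖∑ a, u a‖ ^ 2 ≤ (∑ a, ‖u a‖) ^ 2 := by gcongr; exact norm_sum_le _ _
      _ ≤ N * ∑ a, ‖u a‖ ^ 2 := by
        have := sq_sum_le_card_mul_sum_sq (s := Finset.univ) (f := fun a => ‖u a‖)
        simpa using this
  | succ n ih =>
    intro u μ hμ X hX
    set u' : Fin N → ℂ := fun j => (∑ i, u i * X 0 i j) * μ 0 j with hu'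
    have e : ∑ i : Fin (n + 1 + 1) → Fin N, u (i 0) * ∏ t : Fin (n + 1),
        (X t (i t.castSucc) (i t.succ) * μ t (i t.succ)) =
        ∑ i : Fin (n + 1) → Fin N, u' (i 0) * ∏ t : Fin n,
        (X t.succ (i t.castSucc) (i t.succ) * μ t.succ (i t.succ)) := by
      rw [← Equiv.sum_comp (Fin.consEquiv fun _ => Fin N), Fintype.sum_prod_type,
        Finset.sum_comm]
      refine Finset.sum_congr rfl fun i _ => ?_
      simp only [hu']
      rw [Finset.sum_mul, Finset.sum_mul]
      refine Finset.sum_congr rfl fun a _ => ?_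
      simp only [Fin.consEquiv_apply, Fin.cons_zero, Fin.prod_univ_succ, Fin.castSucc_zero,
        Fin.cons_succ, ← Fin.succ_castSucc]
      ring
    rw [e]
    refine (ih u' (fun t => μ t.succ) (fun t => hμ _) (fun t => X t.succ)
      (fun t => hX _)).trans ?_
    refine mul_le_mul_of_nonneg_left ?_ (Nat.cast_nonneg N)
    refine le_trans (Finset.sum_le_sum fun j _ => ?_) ((hX 0).sum_vecMul_le u)
    rw [hu', norm_mul, mul_pow]
    have h1 : ‖μ 0 j‖ ^ 2 ≤ 1 := pow_le_one₀ (norm_nonneg _) (hμ _ _)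
    exact mul_le_of_le_one_right (by positivity) h1

/-- Orthogonality of the additive characters of Z/N. It writes the condition `a = b` as an average
of products of a unimodular function of `a` and one of `b`, which lets coincidences of labels be
decoupled. -/
theorem exists_phases (N : ℕ) [NeZero N] : ∃ e : ZMod N → Fin N → ℂ, (∀ k a, ‖e k a‖ = 1) ∧
    ∀ a b, ∑ k, e k a * star (e k b) = if a = b then (N : ℂ) else 0 := by
  refine ⟨fun k a => ZMod.stdAddChar (k * ((a : ℕ) : ZMod N)), fun k a => ?_, fun a b => ?_⟩
  · exact AddChar.norm_apply _ _
  · have h := AddChar.sum_mulShift (ψ := ZMod.stdAddChar (N := N))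
      (((a : ℕ) : ZMod N) - ((b : ℕ) : ZMod N)) (ZMod.isPrimitive_stdAddChar N)
    rw [ZMod.card] at h
    have hab : (((a : ℕ) : ZMod N) - ((b : ℕ) : ZMod N) = 0) ↔ a = b := by
      rw [sub_eq_zero, ZMod.natCast_eq_natCast_iff', Nat.mod_eq_of_lt a.2, Nat.mod_eq_of_lt b.2,
        Fin.ext_iff]
    simp only [hab, Nat.cast_ite, Nat.cast_zero] at h
    rw [← h]
    refine Finset.sum_congr rfl fun k _ => ?_
    rw [mul_sub, AddChar.map_sub_eq_div, div_eq_mul_inv, Complex.star_def, ← Complex.inv_eq_conj]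
    exact AddChar.norm_apply _ _

/-- The sum over all labellings of a graph that consists of a single trail, with contractions on
the edges and bounded weights on the vertices, is at most `N`. -/
theorem trail_sum_le [NeZero N] {U : Type*} [Fintype U] [DecidableEq U] {n : ℕ}
    (y : Fin (n + 1) → U) (hy : Function.Surjective y) (X : Fin n → Matrix (Fin N) (Fin N) ℂ)
    (hX : ∀ t, IsContraction (X t)) (ω : U → Fin N → ℂ) (hω : ∀ u a, ‖ω u a‖ ≤ 1) :
    ‖∑ ψ : U → Fin N, (∏ u, ω u (ψ u)) *
      ∏ t : Fin n, X t (ψ (y t.castSucc)) (ψ (y t.succ))‖ ≤ N := by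
  obtain ⟨e, he1, he2⟩ := exists_phases N
  obtain ⟨r, hr⟩ := hy.hasRightInverse
  -- The trail is unrolled into a path whose n + 1 positions carry independent labels. The section
  -- `r` picks one visit of each vertex, where its weight is placed.
  set H : (Fin (n + 1) → Fin N) → ℂ := fun i =>
    (∏ u, ω u (i (r u))) * ∏ t : Fin n, X t (i t.castSucc) (i t.succ) with hH
  have hNpos : (0 : ℝ) < N := by exact_mod_cast Nat.pos_of_ne_zero (NeZero.ne N)
  have h1 : ∑ ψ : U → Fin N, (∏ u, ω u (ψ u)) *
      ∏ t : Fin n, X t (ψ (y t.castSucc)) (ψ (y t.succ)) = ∑ ψ : U → Fin N, H (ψ ∘ y) := by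
    refine Finset.sum_congr rfl fun ψ _ => ?_
    simp [hH, hr _]
  -- Averaging over the phases forces the label at each position to equal the label at the chosen
  -- visit of the same vertex. The labellings that survive are exactly those of the form `ψ ∘ y`.
  have h2 : ∑ k : Fin (n + 1) → ZMod N, ∑ i : Fin (n + 1) → Fin N,
      (∏ t, (e (k t) (i t) * star (e (k t) (i (r (y t)))))) * H i =
      (N : ℂ) ^ (n + 1) * ∑ ψ : U → Fin N, H (ψ ∘ y) := by
    rw [Finset.sum_comm]
    have : ∀ i : Fin (n + 1) → Fin N, ∑ k : Fin (n + 1) → ZMod N,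
        (∏ t, (e (k t) (i t) * star (e (k t) (i (r (y t)))))) * H i =
        if ∀ t, i t = i (r (y t)) then (N : ℂ) ^ (n + 1) * H i else 0 := by
      intro i
      rw [← Finset.sum_mul]
      have := Finset.prod_univ_sum (fun _ : Fin (n + 1) => (Finset.univ : Finset (ZMod N)))
        (fun t k => e k (i t) * star (e k (i (r (y t)))))
      rw [Fintype.piFinset_univ] at this
      rw [← this]
      simp only [he2]
      rw [Finset.prod_ite_zero]
      simp
    simp only [this]
    rw [← Finset.sum_filter, Finset.mul_sum]
    symm
    refine Finset.sum_nbij' (fun ψ => ψ ∘ y) (fun i => i ∘ r) ?_ ?_ ?_ ?_ ?_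
    · intro ψ _; simp [hr _]
    · intro i _; simp
    · intro ψ _; ext u; simp [hr _]
    · intro i hi; ext t; simpa using congrArg Fin.val ((Finset.mem_filter.1 hi).2 t).symm
    · intro ψ _; rfl
  have h3 : ∀ k : Fin (n + 1) → ZMod N, ‖∑ i : Fin (n + 1) → Fin N,
      (∏ t, (e (k t) (i t) * star (e (k t) (i (r (y t)))))) * H i‖ ≤ N := by
    intro k
    -- For fixed phases every factor depends on the label at one position only. The factors at
    -- position `t` are gathered into one weight of modulus at most 1, and the sum becomes a chain.
    set μ : Fin (n + 1) → Fin N → ℂ := fun t a => e (k t) a *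
      (∏ t' with r (y t') = t, star (e (k t') a)) * ∏ u with r u = t, ω u a with hμ
    have hμ1 : ∀ t a, ‖μ t a‖ ≤ 1 := by
      intro t a
      rw [hμ]
      simp only [norm_mul, he1, one_mul, norm_prod, norm_star, Finset.prod_const_one]
      exact Finset.prod_le_one (fun _ _ => norm_nonneg _) fun _ _ => hω _ _
    have e1 : ∀ i : Fin (n + 1) → Fin N,
        (∏ t, (e (k t) (i t) * star (e (k t) (i (r (y t)))))) * H i =
        μ 0 (i 0) * ∏ t : Fin n, (X t (i t.castSucc) (i t.succ) * μ t.succ (i t.succ)) := by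
      intro i
      have ea : ∏ t, μ t (i t) = (∏ t, (e (k t) (i t) * star (e (k t) (i (r (y t)))))) *
          ∏ u, ω u (i (r u)) := by
        rw [hμ]
        simp only [Finset.prod_mul_distrib]
        congr 1
        · congr 1
          rw [← Finset.prod_fiberwise (s := Finset.univ) (g := fun t => r (y t))
            (f := fun t => star (e (k t) (i (r (y t)))))]
          refine Finset.prod_congr rfl fun t _ => Finset.prod_congr rfl fun t' ht' => ?_
          rw [(Finset.mem_filter.1 ht').2]
        · rw [← Finset.prod_fiberwise (s := Finset.univ) (g := r)
            (f := fun u => ω u (i (r u)))]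
          refine Finset.prod_congr rfl fun t _ => Finset.prod_congr rfl fun u hu => ?_
          rw [(Finset.mem_filter.1 hu).2]
      rw [hH]
      simp only
      rw [← mul_assoc, ← ea, Fin.prod_univ_succ, Finset.prod_mul_distrib (f := fun t => X t _ _)]
      ring
    simp only [e1]
    have := chain_sum_le n (μ 0) (fun t => μ t.succ) (fun t a => hμ1 _ _) X hX
    have hb : ∑ a, ‖μ 0 a‖ ^ 2 ≤ N := by
      calc ∑ a, ‖μ 0 a‖ ^ 2 ≤ ∑ _a : Fin N, (1 : ℝ) :=
            Finset.sum_le_sum fun a _ => pow_le_one₀ (norm_nonneg _) (hμ1 _ _)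
        _ = N := by simp
    refine abs_le_of_sq_le_sq' ?_ hNpos.le |>.2
    calc _ ≤ _ := this
      _ ≤ (N : ℝ) * N := by gcongr
      _ = (N : ℝ) ^ 2 := by ring
  rw [h1]
  have h4 : ‖(N : ℂ) ^ (n + 1) * ∑ ψ : U → Fin N, H (ψ ∘ y)‖ ≤ (N : ℝ) ^ (n + 1) * N := by
    rw [← h2]
    refine (norm_sum_le _ _).trans ((Finset.sum_le_sum fun k _ => h3 k).trans ?_)
    simp [ZMod.card]
  rw [norm_mul, norm_pow, Complex.norm_natCast] at h4
  exact le_of_mul_le_mul_left h4 (by positivity)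

end Trails

end DiagFreeSum

namespace DiagFreeSum

/-! ### Assembling a single trail -/

section Assembly

variable {U E : Type*} (s t : E → U)

/-- The source of an oriented edge, the flag `true` reversing the edge. -/
def orientedSrc (d : E × Bool) : U := if d.2 then t d.1 else s d.1

/-- The target of an oriented edge. -/
def orientedTar (d : E × Bool) : U := if d.2 then s d.1 else t d.1

/-- The oriented edges `l` form a trail from `p` to `q`. -/
def IsTrail : U → U → List (E × Bool) → Prop
  | p, q, [] => p = q
  | p, q, d :: l => orientedSrc s t d = p ∧ IsTrail (orientedTar s t d) q l

/-- The vertex `u` is the base `p` or an endpoint of an edge of `L`. -/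
def Touches (p : U) (L : List E) (u : U) : Prop := u = p ∨ ∃ e ∈ L, s e = u ∨ t e = u

variable {s t}

theorem Touches.mono {p u : U} {L L' : List E} (h : Touches s t p L u) (hL : ∀ e ∈ L, e ∈ L')
    {p' : U} (hp : Touches s t p' L' p) : Touches s t p' L' u := by
  rcases h with rfl | ⟨e, he, h⟩
  · exact hp
  · exact Or.inr ⟨e, hL e he, h⟩

theorem touches_base (p : U) (L : List E) : Touches s t p L p := Or.inl rfl

theorem IsTrail.append {p q r : U} {l l' : List (E × Bool)} (h : IsTrail s t p q l)
    (h' : IsTrail s t q r l') : IsTrail s t p r (l ++ l') := by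
  induction l generalizing p with
  | nil => cases h; exact h'
  | cons d l ih => exact ⟨h.1, ih h.2⟩

theorem IsTrail.exists_reverse {p q : U} {l : List (E × Bool)} (h : IsTrail s t p q l) :
    ∃ l' : List (E × Bool), IsTrail s t q p l' ∧ (l'.map Prod.fst).Perm (l.map Prod.fst) := by
  induction l generalizing p with
  | nil => cases h; exact ⟨[], rfl, List.Perm.refl _⟩
  | cons d l ih =>
    obtain ⟨l', h1, h2⟩ := ih h.2
    refine ⟨l' ++ [(d.1, !d.2)], h1.append ⟨?_, ?_⟩, ?_⟩
    · cases hd : d.2 <;> simp [orientedSrc, orientedTar, hd]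
    · rw [← h.1]
      cases hd : d.2 <;> simp [orientedSrc, orientedTar, hd, IsTrail]
    · simp only [List.map_append, List.map_cons, List.map_nil]
      exact (List.perm_append_singleton _ _).trans (h2.cons _)

theorem IsTrail.exists_split {p q u : U} {l : List (E × Bool)} (h : IsTrail s t p q l)
    (hu : Touches s t p (l.map Prod.fst) u) :
    ∃ l₁ l₂, l = l₁ ++ l₂ ∧ IsTrail s t p u l₁ ∧ IsTrail s t u q l₂ := by
  induction l generalizing p with
  | nil =>
    rcases hu with rfl | ⟨e, he, _⟩
    · exact ⟨[], [], rfl, rfl, h⟩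
    · simp at he
  | cons d l ih =>
    by_cases hup : u = p
    · subst hup; exact ⟨[], d :: l, rfl, rfl, h⟩
    · have hu' : Touches s t (orientedTar s t d) (l.map Prod.fst) u := by
        rcases hu with rfl | ⟨e, he, h'⟩
        · exact absurd rfl hup
        · rcases List.mem_cons.1 he with rfl | he
          · left
            have h1 := h.1
            cases hd : d.2 <;> simp_all [orientedSrc, orientedTar] <;> aesop
          · exact Or.inr ⟨e, he, h'⟩
      obtain ⟨l₁, l₂, rfl, h1, h2⟩ := ih h.2 hu'
      exact ⟨d :: l₁, l₂, rfl, ⟨h.1, h1⟩, h2⟩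

theorem IsTrail.touches_end {p q : U} {l : List (E × Bool)} (h : IsTrail s t p q l) :
    Touches s t p (l.map Prod.fst) q := by
  induction l generalizing p with
  | nil => exact Or.inl (Eq.symm h)
  | cons d l ih =>
    refine (ih h.2).mono (by simp +contextual) (Or.inr ⟨d.1, by simp, ?_⟩)
    cases hd : d.2 <;> simp [orientedTar, hd]

variable (s t)

/-- The edges `L` form a single trail between the vertices `vA`, `vB` that visits both. -/
def OneTrail (vA vB : U) (L : List E) : Prop :=
  ∃ p q d, (p = vA ∨ p = vB) ∧ (q = vA ∨ q = vB) ∧ IsTrail s t p q d ∧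
    (d.map Prod.fst).Perm L ∧ Touches s t p L vA ∧ Touches s t p L vB

/-- The edges `L` form two closed trails, at `vA` and at `vB`. -/
def TwoTrails (vA vB : U) (L : List E) : Prop :=
  ∃ d d', IsTrail s t vA vA d ∧ IsTrail s t vB vB d' ∧
    (d.map Prod.fst ++ d'.map Prod.fst).Perm L

variable {s t} {vA vB : U}

theorem OneTrail.perm {L L' : List E} (h : OneTrail s t vA vB L) (hL : L.Perm L') :
    OneTrail s t vA vB L' := by
  obtain ⟨p, q, d, hp, hq, hd, hdL, hA, hB⟩ := h
  exact ⟨p, q, d, hp, hq, hd, hdL.trans hL, hA.mono (fun e => hL.mem_iff.1) (touches_base _ _),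
    hB.mono (fun e => hL.mem_iff.1) (touches_base _ _)⟩

theorem TwoTrails.perm {L L' : List E} (h : TwoTrails s t vA vB L) (hL : L.Perm L') :
    TwoTrails s t vA vB L' := by
  obtain ⟨d, d', h1, h2, h3⟩ := h
  exact ⟨d, d', h1, h2, h3.trans hL⟩

/-- Two trails that share a vertex, one of them closed, form a single trail. -/
theorem OneTrail.of_split {p q u : U} {d c : List (E × Bool)} (hp : p = vA ∨ p = vB)
    (hq : q = vA ∨ q = vB) (hd : IsTrail s t p q d) (hu : Touches s t p (d.map Prod.fst) u)
    (hc : IsTrail s t u u c)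
    (hA : Touches s t p (d.map Prod.fst ++ c.map Prod.fst) vA)
    (hB : Touches s t p (d.map Prod.fst ++ c.map Prod.fst) vB) :
    OneTrail s t vA vB (d.map Prod.fst ++ c.map Prod.fst) := by
  obtain ⟨d₁, d₂, rfl, h1, h2⟩ := hd.exists_split hu
  refine ⟨p, q, d₁ ++ (c ++ d₂), hp, hq, h1.append (hc.append h2), ?_, hA, hB⟩
  simp only [List.map_append, List.append_assoc]
  exact List.Perm.append_left _ List.perm_append_comm

/-- A closed trail is inserted at a visit of its base point, which exists because both poles are
visited. A trail between distinct poles has an endpoint at the end `q` of the given one, and is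
appended there, reversed if necessary. -/
theorem OneTrail.absorb {L : List E} (h : OneTrail s t vA vB L) {x y : U} {c : List (E × Bool)}
    (hc : IsTrail s t x y c) (hx : x = vA ∨ x = vB) (hy : y = vA ∨ y = vB) :
    OneTrail s t vA vB (L ++ c.map Prod.fst) := by
  obtain ⟨p, q, d, hp, hq, hd, hdL, hA, hB⟩ := h
  have hAd : Touches s t p (d.map Prod.fst) vA :=
    hA.mono (fun e => hdL.mem_iff.2) (touches_base _ _)
  have hBd : Touches s t p (d.map Prod.fst) vB :=
    hB.mono (fun e => hdL.mem_iff.2) (touches_base _ _)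
  have up : ∀ {c' : List (E × Bool)} {u : U}, Touches s t p (d.map Prod.fst) u →
      Touches s t p (d.map Prod.fst ++ c'.map Prod.fst) u := fun h =>
    h.mono (fun e he => List.mem_append_left _ he) (touches_base _ _)
  by_cases hxy : x = y
  · subst hxy
    refine (OneTrail.of_split hp hq hd ?_ hc (up hAd) (up hBd)).perm (hdL.append_right _)
    rcases hx with rfl | rfl
    · exact hAd
    · exact hBd
  · have hqxy : q = x ∨ q = y := by
      rcases hx with hx | hx <;> rcases hy with hy | hy <;> rcases hq with hq | hq <;>
        simp_all
    rcases hqxy with rfl | rfl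
    · refine OneTrail.perm ⟨p, y, d ++ c, hp, hy, hd.append hc, List.Perm.refl _, ?_, ?_⟩
        (L := (d ++ c).map Prod.fst) (by simpa using hdL.append_right _)
      · simpa using up (c' := c) hAd
      · simpa using up (c' := c) hBd
    · obtain ⟨c', hc', hcc⟩ := hc.exists_reverse
      refine OneTrail.perm ⟨p, x, d ++ c', hp, hx, hd.append hc', List.Perm.refl _, ?_, ?_⟩
        (L := (d ++ c').map Prod.fst) (by simpa using hdL.append hcc)
      · simpa using up (c' := c') hAd
      · simpa using up (c' := c') hBd

/-- A closed trail joins the one at its pole. A trail between the two poles links both closed trails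
into one. -/
theorem TwoTrails.absorb {L : List E} (h : TwoTrails s t vA vB L) {x y : U}
    {c : List (E × Bool)} (hc : IsTrail s t x y c) (hx : x = vA ∨ x = vB)
    (hy : y = vA ∨ y = vB) :
    OneTrail s t vA vB (L ++ c.map Prod.fst) ∨ TwoTrails s t vA vB (L ++ c.map Prod.fst) := by
  obtain ⟨d, d', hd, hd', hL⟩ := h
  have main : ∀ {c : List (E × Bool)}, IsTrail s t vA vB c →
      OneTrail s t vA vB (L ++ c.map Prod.fst) := by
    intro c hc
    have ht := hd.append (hc.append hd')
    refine OneTrail.perm ⟨vA, vB, d ++ (c ++ d'), Or.inl rfl, Or.inr rfl, ht, List.Perm.refl _,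
      touches_base _ _, ht.touches_end⟩ ?_
    simp only [List.map_append]
    refine List.Perm.trans ?_ (hL.append_right _)
    rw [List.append_assoc]
    exact List.Perm.append_left _ List.perm_append_comm
  rcases hx with rfl | rfl <;> rcases hy with rfl | rfl
  · right
    refine ⟨d ++ c, d', hd.append hc, hd', ?_⟩
    refine List.Perm.trans ?_ (hL.append_right _)
    simp only [List.map_append, List.append_assoc]
    exact List.Perm.append_left _ List.perm_append_comm
  · exact Or.inl (main hc)
  · obtain ⟨c', hc', hcc⟩ := hc.exists_reverse
    exact Or.inl ((main hc').perm (hcc.append_left _))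
  · right
    refine ⟨d, d' ++ c, hd, hd'.append hc, ?_⟩
    refine List.Perm.trans ?_ (hL.append_right _)
    simp only [List.map_append, List.append_assoc]
    exact List.Perm.refl _

/-- If the two closed trails meet, the second, rotated to start at a common vertex, is inserted into
the first. Otherwise they are disjoint, which is where separation will come from. -/
theorem TwoTrails.oneTrail_or_disjoint {L : List E} (h : TwoTrails s t vA vB L) :
    OneTrail s t vA vB L ∨ ∃ L₁ L₂ : List E, (L₁ ++ L₂).Perm L ∧
      ∀ u, Touches s t vA L₁ u → ¬ Touches s t vB L₂ u := by
  obtain ⟨d, d', hd, hd', hL⟩ := h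
  by_cases hu : ∃ u, Touches s t vA (d.map Prod.fst) u ∧ Touches s t vB (d'.map Prod.fst) u
  · left
    obtain ⟨u, hu, hu'⟩ := hu
    obtain ⟨d₁, d₂, rfl, h1, h2⟩ := hd'.exists_split hu'
    refine OneTrail.perm (OneTrail.of_split (c := d₂ ++ d₁) (Or.inl rfl) (Or.inl rfl) hd hu
      (h2.append h1) (touches_base _ _) ?_) ?_
    · refine (h2.touches_end).mono (fun e he => ?_) (hu.mono (fun e he => ?_) (touches_base _ _))
      · simp only [List.map_append, List.mem_append]
        exact Or.inr (Or.inl he)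
      · simp [he]
    · refine List.Perm.trans (List.Perm.append_left _ ?_) hL
      simp only [List.map_append]
      exact List.perm_append_comm
  · right
    push Not at hu
    exact ⟨_, _, hL, hu⟩

end Assembly

/-! ### Sums over labellings of a graph given as a trail of oriented edges -/

section TrailSum

variable {N : ℕ} {U E : Type*} {s t : E → U}

theorem IsTrail.getElem_cons_map_orientedTar {p q : U} {d : List (E × Bool)}
    (h : IsTrail s t p q d) (i : ℕ) (hi : i < d.length) :
    (p :: d.map (orientedTar s t))[i]'(by simp; omega) = orientedSrc s t d[i] := by
  induction d generalizing p i with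
  | nil => simp at hi
  | cons a d ih =>
    cases i with
    | zero => exact h.1.symm
    | succ i => exact ih h.2 i (by simpa using hi)

theorem IsTrail.sum_le [NeZero N] [Fintype U] [DecidableEq U] {p q : U} {d : List (E × Bool)}
    (h : IsTrail s t p q d) (X : E → Matrix (Fin N) (Fin N) ℂ) (hX : ∀ e, IsContraction (X e))
    (hU : ∀ u, Touches s t p (d.map Prod.fst) u)
    (ω : U → Fin N → ℂ) (hω : ∀ u a, ‖ω u a‖ ≤ 1) :
    ‖∑ ψ : U → Fin N, (∏ u, ω u (ψ u)) *
      ((d.map Prod.fst).map fun e => X e (ψ (s e)) (ψ (t e))).prod‖ ≤ N := by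
  set y : Fin (d.length + 1) → U := fun i =>
    (p :: d.map (orientedTar s t))[(i : ℕ)]'(by simp; omega) with hy
  have hy1 : ∀ i : Fin d.length, y i.castSucc = orientedSrc s t d[(i : ℕ)] := fun i =>
    h.getElem_cons_map_orientedTar i i.2
  have hy2 : ∀ i : Fin d.length, y i.succ = orientedTar s t d[(i : ℕ)] := fun i => by simp [hy]
  have hsurj : Function.Surjective y := by
    intro u
    rcases hU u with rfl | ⟨e, he, hu⟩
    · exact ⟨0, rfl⟩
    · obtain ⟨⟨e, b⟩, he', rfl⟩ := List.mem_map.1 he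
      obtain ⟨i, hi, hie⟩ := List.mem_iff_getElem.1 he'
      have h1 := hy1 ⟨i, hi⟩
      have h2 := hy2 ⟨i, hi⟩
      simp only [hie, orientedSrc, orientedTar] at h1 h2
      cases b <;> rcases hu with rfl | rfl
      · exact ⟨_, h1⟩
      · exact ⟨_, h2⟩
      · exact ⟨_, h2⟩
      · exact ⟨_, h1⟩
  -- An edge that the trail runs through backwards contributes the transposed matrix.
  have key := trail_sum_le y hsurj (fun i => if d[(i : ℕ)].2 then (X d[(i : ℕ)].1)ᵀ
    else X d[(i : ℕ)].1) (fun i => by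
      split_ifs
      · exact (hX _).transpose
      · exact hX _) ω hω
  refine le_trans (le_of_eq ?_) key
  congr 1
  refine Finset.sum_congr rfl fun ψ _ => ?_
  congr 1
  rw [List.map_map, ← Fin.prod_univ_fun_getElem]
  refine Finset.prod_congr rfl fun i _ => ?_
  rw [hy1, hy2]
  cases hb : (d[(i : ℕ)]).2 <;> simp [orientedSrc, orientedTar, hb]

end TrailSum

/-! ### Splitting a closed walk at a vertex -/

section Split

variable {V κ : Type*} [DecidableEq V] (col : κ → Side) (v : V)

/-- The vertex `x` as seen by the edges of colour `c`, after the vertex `v` has been split. -/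
def splitVertex (c : Side) (x : V) : Option V := if x = v ∧ c = Side.b then none else some x

/-- The source of a step after the vertex `v` has been split. -/
def splitSrc (e : V × κ × V) : Option V := splitVertex v (col e.2.1) e.1

/-- The target of a step after the vertex `v` has been split. -/
def splitTar (e : V × κ × V) : Option V := splitVertex v (col e.2.1) e.2.2

variable {col v}

theorem splitVertex_of_ne {c : Side} {x : V} (h : x ≠ v) : splitVertex v c x = some x := by
  simp [splitVertex, h]

theorem splitVertex_self (c : Side) : splitVertex v c v = some v ∨ splitVertex v c v = none := by
  cases c <;> simp [splitVertex]

/-- Either the trails of the split graph have been assembled to one trail, or to two. -/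
def Assembled (col : κ → Side) (v : V) (L : List (V × κ × V)) : Prop :=
  OneTrail (splitSrc col v) (splitTar col v) (some v) none L ∨
    TwoTrails (splitSrc col v) (splitTar col v) (some v) none L

theorem Assembled.absorb {L : List (V × κ × V)} (h : Assembled col v L) {x y : Option V}
    {c : List ((V × κ × V) × Bool)} (hc : IsTrail (splitSrc col v) (splitTar col v) x y c)
    (hx : x = some v ∨ x = none) (hy : y = some v ∨ y = none) {L' : List (V × κ × V)}
    (hL : (c.map Prod.fst ++ L).Perm L') :
    Assembled col v L' := by
  have hL' := List.perm_append_comm.trans hL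
  rcases h with h | h
  · exact Or.inl ((h.absorb hc hx hy).perm hL')
  · rcases h.absorb hc hx hy with h | h
    · exact Or.inl (h.perm hL')
    · exact Or.inr (h.perm hL')

/-- Splitting `v` cuts the walk at its visits of `v` into excursions, each a trail between the poles
`some v` and `none`, which are absorbed one by one starting from the last. When the walk starts off
`v`, the list `R` is the unfinished excursion up to the next visit. It is kept apart until a step
out of `v` completes it. -/
theorem assembled_walkSteps (l : List (κ × V)) : ∀ p : V, walkEnd p l = v →
    (p = v → Assembled col v (walkSteps p l)) ∧
    (p ≠ v → ∃ R x, (x = some v ∨ x = none) ∧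
      IsTrail (splitSrc col v) (splitTar col v) (some p) x R ∧
      ∃ L, Assembled col v L ∧ (R.map Prod.fst ++ L).Perm (walkSteps p l)) := by
  induction l with
  | nil =>
    intro p hp
    exact ⟨fun _ => Or.inr ⟨[], [], rfl, rfl, List.Perm.refl _⟩, fun h => absurd hp h⟩
  | cons e l ih =>
    obtain ⟨k, y⟩ := e
    intro p hp
    rw [walkEnd_cons] at hp
    obtain ⟨ih1, ih2⟩ := ih y hp
    rw [walkSteps_cons]
    simp only at hp ih1 ih2 ⊢
    by_cases hy : y = v
    · have hA := ih1 hy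
      have ht : IsTrail (splitSrc col v) (splitTar col v) (splitVertex v (col k) p)
          (splitVertex v (col k) y) [((p, k, y), false)] := ⟨rfl, rfl⟩
      have hyv : splitVertex v (col k) y = some v ∨ splitVertex v (col k) y = none :=
        hy ▸ splitVertex_self _
      refine ⟨fun h => hA.absorb ht (by rw [h]; exact splitVertex_self _) hyv (List.Perm.refl _),
        fun h => ⟨[((p, k, y), false)], _, hyv, ?_, _, hA, List.Perm.refl _⟩⟩
      rwa [splitVertex_of_ne h] at ht
    · obtain ⟨R, x, hx, hR, L, hA, hL⟩ := ih2 hy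
      have ht : IsTrail (splitSrc col v) (splitTar col v) (splitVertex v (col k) p) x
          (((p, k, y), false) :: R) := ⟨rfl, by
        simpa [orientedTar, splitTar, splitVertex_of_ne hy] using hR⟩
      refine ⟨fun h => hA.absorb ht (by rw [h]; exact splitVertex_self _) hx (hL.cons _),
        fun h => ⟨((p, k, y), false) :: R, x, hx, ?_, _, hA, hL.cons _⟩⟩
      rwa [splitVertex_of_ne h] at ht

theorem exists_walk_split {a u : V} (l : List (κ × V)) (h : u = a ∨ ∃ e ∈ walkSteps a l,
    e.1 = u ∨ e.2.2 = u) : ∃ l₁ l₂, l = l₁ ++ l₂ ∧ walkEnd a l₁ = u := by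
  induction l generalizing a with
  | nil => exact ⟨[], [], rfl, by simpa [eq_comm] using h⟩
  | cons p l ih =>
    by_cases hu : u = a
    · exact ⟨[], p :: l, rfl, hu.symm⟩
    · obtain ⟨l₁, l₂, rfl, h1⟩ := ih (a := p.2) (by
        rcases h with h | ⟨e, he, h⟩
        · exact absurd h hu
        · rcases List.mem_cons.1 he with rfl | he
          · rcases h with h | h
            · exact absurd h.symm hu
            · exact Or.inl h.symm
          · exact Or.inr ⟨e, he, h⟩)
      exact ⟨p :: l₁, l₂, rfl, h1⟩

/-- A closed walk that is not separated by `v` is a single trail after `v` has been split. -/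
theorem oneTrail_of_not_isSeparating {a : V} {l : List (κ × V)} (hl : walkEnd a l = a)
    (hv : ¬ IsSeparating col v (walkSteps a l)) :
    OneTrail (splitSrc col v) (splitTar col v) (some v) none (walkSteps a l) := by
  have hvis : ∃ e ∈ walkSteps a l, e.1 = v ∨ e.2.2 = v := by
    by_contra h
    push Not at h
    exact hv ⟨fun _ => Side.a, fun e he => ⟨fun _ _ => rfl, fun h' => absurd h' (h e he).1,
      fun _ h' => absurd h' (h e he).2⟩⟩
  -- A closed walk can be rotated to start at `v`, which only permutes its steps.
  obtain ⟨l₁, l₂, rfl, h1⟩ := exists_walk_split l (Or.inr hvis)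
  have hperm : (walkSteps v (l₂ ++ l₁)).Perm (walkSteps a (l₁ ++ l₂)) := by
    rw [walkEnd_append, h1] at hl
    rw [walkSteps_append, walkSteps_append, hl, h1]
    exact List.perm_append_comm
  have hend : walkEnd v (l₂ ++ l₁) = v := by
    rw [walkEnd_append, h1] at hl
    rw [walkEnd_append, hl, h1]
  rcases (assembled_walkSteps (col := col) (l₂ ++ l₁) v hend).1 rfl with h | h
  · exact h.perm hperm
  rcases (h.perm hperm).oneTrail_or_disjoint with h | ⟨L₁, L₂, hL, hdis⟩
  · exact h
  exfalso
  apply hv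
  classical
  -- With two disjoint trails, the vertices met by the trail at the a-copy of `v` get colour `a` and
  -- the others colour `b`. A step of the first trail that touches `v` has colour `a`, since the
  -- trail never meets the b-copy; likewise for the second with the colours exchanged.
  refine ⟨fun x => if Touches (splitSrc col v) (splitTar col v) (some v) L₁ (some x)
    then Side.a else Side.b, fun e he => ?_⟩
  have hA : ∀ u, Touches (splitSrc col v) (splitTar col v) (some v) L₁ u → u ≠ none := by
    rintro u hu rfl
    exact hdis _ hu (touches_base _ _)
  have hB : ∀ u, Touches (splitSrc col v) (splitTar col v) none L₂ u → u ≠ some v := by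
    rintro u hu rfl
    exact hdis _ (touches_base _ _) hu
  rcases List.mem_append.1 (hL.mem_iff.2 he) with he | he
  · have hs : Touches (splitSrc col v) (splitTar col v) (some v) L₁ (splitSrc col v e) :=
      Or.inr ⟨e, he, Or.inl rfl⟩
    have ht : Touches (splitSrc col v) (splitTar col v) (some v) L₁ (splitTar col v e) :=
      Or.inr ⟨e, he, Or.inr rfl⟩
    have hc : ∀ x, x = v → splitVertex v (col e.2.1) x ≠ none → col e.2.1 = Side.a := by
      rintro x rfl h
      cases hc : col e.2.1 <;> simp_all [splitVertex]
    refine ⟨fun h1 h2 => ?_, fun h1 h2 => ?_, fun h1 h2 => ?_⟩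
    · rw [splitSrc, splitVertex_of_ne h1] at hs
      rw [splitTar, splitVertex_of_ne h2] at ht
      simp [hs, ht]
    · rw [splitTar, splitVertex_of_ne h2] at ht
      simp [ht, hc _ h1 (hA _ hs)]
    · rw [splitSrc, splitVertex_of_ne h1] at hs
      simp [hs, hc _ h2 (hA _ ht)]
  · have hs : Touches (splitSrc col v) (splitTar col v) none L₂ (splitSrc col v e) :=
      Or.inr ⟨e, he, Or.inl rfl⟩
    have ht : Touches (splitSrc col v) (splitTar col v) none L₂ (splitTar col v e) :=
      Or.inr ⟨e, he, Or.inr rfl⟩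
    have hc : ∀ x, x = v → splitVertex v (col e.2.1) x ≠ some v → col e.2.1 = Side.b := by
      rintro x rfl h
      cases hc : col e.2.1 <;> simp_all [splitVertex]
    have hg : ∀ x, Touches (splitSrc col v) (splitTar col v) none L₂ (some x) →
        ¬ Touches (splitSrc col v) (splitTar col v) (some v) L₁ (some x) :=
      fun x h h' => hdis _ h' h
    refine ⟨fun h1 h2 => ?_, fun h1 h2 => ?_, fun h1 h2 => ?_⟩
    · rw [splitSrc, splitVertex_of_ne h1] at hs
      rw [splitTar, splitVertex_of_ne h2] at ht
      simp [hg _ hs, hg _ ht]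
    · rw [splitTar, splitVertex_of_ne h2] at ht
      simp [hg _ ht, hc _ h1 (hB _ hs)]
    · rw [splitSrc, splitVertex_of_ne h1] at hs
      simp [hg _ hs, hc _ h2 (hB _ ht)]

/-- The sum over the labellings of a closed walk split at a non-separating vertex. -/
theorem split_sum_le {N : ℕ} [NeZero N] [Fintype V] {a : V} {l : List (κ × V)}
    (hl : walkEnd a l = a) (hvis : ∀ u, u = a ∨ ∃ e ∈ walkSteps a l, e.1 = u ∨ e.2.2 = u)
    (hv : ¬ IsSeparating col v (walkSteps a l))
    (X : V × κ × V → Matrix (Fin N) (Fin N) ℂ) (hX : ∀ e, IsContraction (X e))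
    (ω : Option V → Fin N → ℂ) (hω : ∀ u a, ‖ω u a‖ ≤ 1) :
    ‖∑ ψ : Option V → Fin N, (∏ u, ω u (ψ u)) *
      ((walkSteps a l).map fun e =>
        X e (ψ (splitSrc col v e)) (ψ (splitTar col v e))).prod‖ ≤ N := by
  obtain ⟨p, q, d, hp, hq, hd, hdL, hA, hB⟩ := oneTrail_of_not_isSeparating hl hv
  have hne : walkSteps a l ≠ [] := by
    intro h
    rw [h] at hv
    exact hv ⟨fun _ => Side.a, by simp⟩
  have key := hd.sum_le X hX (fun u => ?_) ω hω
  · refine le_trans (le_of_eq ?_) key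
    congr 1
    refine Finset.sum_congr rfl fun ψ _ => ?_
    congr 1
    exact ((hdL.map _).prod_eq).symm
  · have hT : Touches (splitSrc col v) (splitTar col v) p (walkSteps a l) u := by
      rcases u with _ | u
      · exact hB
      · by_cases hu : u = v
        · exact hu ▸ hA
        · have : ∃ e ∈ walkSteps a l, e.1 = u ∨ e.2.2 = u := by
            rcases hvis u with rfl | h
            · cases l with
              | nil => simp at hne
              | cons e l => exact ⟨_, List.mem_cons_self, Or.inl rfl⟩
            · exact h
          obtain ⟨e, he, h⟩ := this
          refine Or.inr ⟨e, he, h.imp (fun h => ?_) fun h => ?_⟩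
          · rw [splitSrc, h, splitVertex_of_ne hu]
          · rw [splitTar, h, splitVertex_of_ne hu]
    exact hT.mono (fun e => hdL.mem_iff.2) (touches_base _ _)

end Split

end DiagFreeSum

namespace DiagFreeSum

/-! ### Injective sums over the labellings of a closed walk -/

/-- The product over the steps of colour `c`. -/
noncomputable def sideProd {N : ℕ} {V κ : Type*} (col : κ → Side)
    (X : κ → Matrix (Fin N) (Fin N) ℂ) (c : Side) (L : List (V × κ × V)) (φ : V → Fin N) : ℂ :=
  (L.map fun e => if col e.2.1 = c then X e.2.1 (φ e.1) (φ e.2.2) else 1).prod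

section InjectiveSums

variable {N : ℕ} {V κ : Type*} [Fintype V] [DecidableEq V]

theorem sum_embedding_eq (G : (V → Fin N) → ℂ) :
    ∑ φ : V ↪ Fin N, G φ = ∑ ψ : V → Fin N, if Function.Injective ψ then G ψ else 0 := by
  classical
  rw [← Finset.sum_filter, ← Equiv.sum_comp (Equiv.subtypeInjectiveEquivEmbedding V (Fin N)),
    ← Finset.sum_subtype_eq_sum_filter]
  simp only [Finset.subtype_univ]
  rfl

/-- A compatible colouring is forced on the range of `ψ` and free elsewhere, which leaves m^(N-m) of
them. Multiplying by m^m avoids the subtraction. -/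
theorem card_pow_mul_card_colourings {ψ : V → Fin N} (hψ : Function.Injective ψ) :
    Fintype.card V ^ Fintype.card V *
      (Finset.univ.filter fun χ : Fin N → V => ∀ u, χ (ψ u) = u).card = Fintype.card V ^ N := by
  classical
  set m := Fintype.card V
  have h1 : (Finset.univ.filter fun χ : Fin N → V => ∀ u, χ (ψ u) = u) =
      Fintype.piFinset fun x => Finset.univ.filter fun c : V => ∀ u, ψ u = x → c = u := by
    ext χ
    simp only [Finset.mem_filter, Finset.mem_univ, true_and, Fintype.mem_piFinset]
    exact ⟨fun h x u hx => hx ▸ h u, fun h u => h _ u rfl⟩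
  have h2 : ∀ x : Fin N, (Finset.univ.filter fun c : V => ∀ u, ψ u = x → c = u).card =
      if x ∈ Finset.univ.image ψ then 1 else m := by
    intro x
    split_ifs with hx
    · obtain ⟨u, -, rfl⟩ := Finset.mem_image.1 hx
      rw [Finset.card_eq_one]
      refine ⟨u, ?_⟩
      ext c
      simp only [Finset.mem_filter, Finset.mem_univ, true_and, Finset.mem_singleton]
      exact ⟨fun h => h u rfl, fun h u' hu' => h.trans (hψ hu').symm⟩
    · have : ∀ u, ψ u ≠ x := fun u h => hx (Finset.mem_image.2 ⟨u, Finset.mem_univ _, h⟩)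
      simp [this, m]
  have h3 : m ^ m = ∏ x : Fin N, if x ∈ Finset.univ.image ψ then m else 1 := by
    rw [Finset.prod_ite_mem, Finset.univ_inter, Finset.prod_const,
      Finset.card_image_of_injective _ hψ, Finset.card_univ]
  rw [h1, Fintype.card_piFinset]
  simp only [h2]
  rw [h3, ← Finset.prod_mul_distrib]
  have : ∀ x : Fin N, ((if x ∈ Finset.univ.image ψ then m else 1) *
      if x ∈ Finset.univ.image ψ then 1 else m) = m := by
    intro x; split_ifs <;> simp
  rw [Finset.prod_congr rfl fun x _ => this x]
  simp

/-- A random colouring of the labels replaces an injective sum by sums over all maps. -/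
theorem norm_sum_embedding_le [Nonempty V] (G : (V → Fin N) → ℂ) (K : ℝ)
    (hG : ∀ ω : V → Fin N → ℂ, (∀ u a, ‖ω u a‖ ≤ 1) →
      ‖∑ ψ : V → Fin N, (∏ u, ω u (ψ u)) * G ψ‖ ≤ K) :
    ‖∑ φ : V ↪ Fin N, G φ‖ ≤ (Fintype.card V : ℝ) ^ Fintype.card V * K := by
  classical
  set m := Fintype.card V with hm
  have hmpos : 0 < m := Fintype.card_pos
  have h1 : ∑ χ : Fin N → V, ∑ ψ : V → Fin N,
      (∏ u, if χ (ψ u) = u then (1 : ℂ) else 0) * G ψ =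
      ∑ ψ : V → Fin N, ((Finset.univ.filter fun χ : Fin N → V =>
        ∀ u, χ (ψ u) = u).card : ℂ) * G ψ := by
    rw [Finset.sum_comm]
    refine Finset.sum_congr rfl fun ψ _ => ?_
    rw [← Finset.sum_mul]
    congr 1
    simp only [Finset.prod_ite_zero]
    simp
  have h2 : (m : ℂ) ^ m * ∑ χ : Fin N → V, ∑ ψ : V → Fin N,
      (∏ u, if χ (ψ u) = u then (1 : ℂ) else 0) * G ψ = (m : ℂ) ^ N * ∑ φ : V ↪ Fin N, G φ := by
    rw [h1, sum_embedding_eq, Finset.mul_sum, Finset.mul_sum]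
    refine Finset.sum_congr rfl fun ψ _ => ?_
    by_cases hψ : Function.Injective ψ
    · rw [if_pos hψ, ← mul_assoc]
      congr 1
      exact_mod_cast card_pow_mul_card_colourings hψ
    -- A labelling with a compatible colouring has a left inverse, so the colourings discard
    -- precisely the non-injective maps.
    · have : (Finset.univ.filter fun χ : Fin N → V => ∀ u, χ (ψ u) = u) = ∅ := by
        rw [Finset.filter_eq_empty_iff]
        intro χ _ h
        exact hψ fun a b hab => by rw [← h a, ← h b, hab]
      simp [this, hψ]
  have h3 : ‖∑ χ : Fin N → V, ∑ ψ : V → Fin N,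
      (∏ u, if χ (ψ u) = u then (1 : ℂ) else 0) * G ψ‖ ≤ (m : ℝ) ^ N * K := by
    refine (norm_sum_le _ _).trans ((Finset.sum_le_sum fun χ _ => hG
      (fun u a => if χ a = u then 1 else 0) fun u a => by split_ifs <;> simp).trans ?_)
    simp [hm]
  have h4 : (m : ℝ) ^ N * ‖∑ φ : V ↪ Fin N, G φ‖ ≤ (m : ℝ) ^ N * ((m : ℝ) ^ m * K) := by
    have := congrArg norm h2
    rw [norm_mul, norm_mul, norm_pow, norm_pow, Complex.norm_natCast] at this
    rw [← this]
    calc (m : ℝ) ^ m * _ ≤ (m : ℝ) ^ m * ((m : ℝ) ^ N * K) := by gcongr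
      _ = _ := by ring
  exact le_of_mul_le_mul_left h4 (by positivity)

/-- The pairs of labellings, parametrized by their difference away from `v` and a labelling of the
graph in which `v` has been split. -/
def splitEquiv [NeZero N] (v : V) : ({u : V // u ≠ v} → Fin N) × (Option V → Fin N) ≃
    (V → Fin N) × (V → Fin N) where
  toFun p := (fun u => p.2 (some u),
    fun u => if h : u = v then p.2 none else p.1 ⟨u, h⟩ + p.2 (some u))
  invFun q := (fun u => q.2 u - q.1 u, fun o => o.elim (q.2 v) q.1)
  left_inv p := by
    ext1
    · funext u
      simp [u.2]
    · funext o
      cases o <;> simp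
  right_inv q := by
    ext1
    · rfl
    · funext u
      by_cases h : u = v
      · subst h; simp
      · simp [h]

/-- For fixed differences between the B-labels and the A-labels away from `v`, the product of the
two sums is a single sum over labellings of the split walk, bounded by `N` because `v` does not
separate. There are N^(|V|-1) choices of differences. -/
theorem norm_weighted_sums_le [NeZero N] {col : κ → Side} {a v : V} {l : List (κ × V)}
    (hl : walkEnd a l = a) (hvis : ∀ u, u = a ∨ ∃ e ∈ walkSteps a l, e.1 = u ∨ e.2.2 = u)
    (hv : ¬ IsSeparating col v (walkSteps a l))
    {X : κ → Matrix (Fin N) (Fin N) ℂ} (hX : ∀ k, IsContraction (X k))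
    (ω ω' : V → Fin N → ℂ) (hω : ∀ u i, ‖ω u i‖ ≤ 1) (hω' : ∀ u i, ‖ω' u i‖ ≤ 1) :
    ‖(∑ ψ : V → Fin N, (∏ u, ω u (ψ u)) * sideProd col X Side.a (walkSteps a l) ψ) *
      ∑ φ : V → Fin N, (∏ u, ω' u (φ u)) * sideProd col X Side.b (walkSteps a l) φ‖ ≤
      (N : ℝ) ^ Fintype.card V := by
  rw [Finset.sum_mul_sum, ← Finset.sum_product', Finset.univ_product_univ,
    ← Equiv.sum_comp (splitEquiv v), Fintype.sum_prod_type]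
  have key : ∀ R : {u : V // u ≠ v} → Fin N, ‖∑ Ψ : Option V → Fin N,
      ((∏ u, ω u ((splitEquiv v (R, Ψ)).1 u)) *
        sideProd col X Side.a (walkSteps a l) (splitEquiv v (R, Ψ)).1) *
      ((∏ u, ω' u ((splitEquiv v (R, Ψ)).2 u)) *
        sideProd col X Side.b (walkSteps a l) (splitEquiv v (R, Ψ)).2)‖ ≤ N := by
    intro R
    -- At `v` no shift is needed: the B-label there is the label of the separate vertex `none`.
    set R' : V → Fin N := fun u => if h : u = v then 0 else R ⟨u, h⟩ with hR'
    set Ω : Option V → Fin N → ℂ := fun o i => o.elim (ω' v i)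
      (fun u => ω u i * if u = v then 1 else ω' u (R' u + i)) with hΩ
    have hΩ1 : ∀ o i, ‖Ω o i‖ ≤ 1 := by
      intro o i
      cases o with
      | none => exact hω' _ _
      | some u =>
        simp only [hΩ, Option.elim_some, norm_mul]
        refine mul_le_one₀ (hω _ _) (norm_nonneg _) ?_
        split_ifs
        · simp
        · exact hω' _ _
    -- Shifting the labels of a B-step permutes rows and columns, which keeps the matrix a
    -- contraction.
    have hX' : ∀ e : V × κ × V, IsContraction (if col e.2.1 = Side.a then X e.2.1 else
        (X e.2.1).submatrix (Equiv.addLeft (R' e.1)) (Equiv.addLeft (R' e.2.2))) := by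
      intro e
      split_ifs
      · exact hX _
      · exact (hX _).submatrix _ _
    refine le_trans (le_of_eq ?_) (split_sum_le hl hvis hv _ hX' Ω hΩ1)
    congr 1
    refine Finset.sum_congr rfl fun Ψ _ => ?_
    have e1 : ∀ x, (splitEquiv v (R, Ψ)).1 x = Ψ (splitVertex v Side.a x) := by
      intro x; simp [splitEquiv, splitVertex]
    have e2 : ∀ x, (splitEquiv v (R, Ψ)).2 x = R' x + Ψ (splitVertex v Side.b x) := by
      intro x
      by_cases h : x = v
      · subst h; simp [splitEquiv, splitVertex, hR']
      · simp [splitEquiv, splitVertex, hR', h]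
    have e3 : ∏ o, Ω o (Ψ o) = (∏ u, ω u ((splitEquiv v (R, Ψ)).1 u)) *
        ∏ u, ω' u ((splitEquiv v (R, Ψ)).2 u) := by
      have : ∀ u, ω' u ((splitEquiv v (R, Ψ)).2 u) = (if u = v then ω' v (Ψ none) else 1) *
          if u = v then 1 else ω' u (R' u + Ψ (some u)) := by
        intro u
        rw [e2]
        by_cases h : u = v
        · subst h; simp [splitVertex, hR']
        · simp [splitVertex, h]
      simp only [this, Finset.prod_mul_distrib, Fintype.prod_option, hΩ, Option.elim_none,
        Option.elim_some, Finset.prod_ite_eq', Finset.mem_univ, if_true, e1, splitVertex]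
      simp
      ring
    rw [e3]
    have e4 : ((walkSteps a l).map fun e =>
        (if col e.2.1 = Side.a then X e.2.1 else (X e.2.1).submatrix (Equiv.addLeft (R' e.1))
          (Equiv.addLeft (R' e.2.2))) (Ψ (splitSrc col v e)) (Ψ (splitTar col v e))).prod =
        sideProd col X Side.a (walkSteps a l) (splitEquiv v (R, Ψ)).1 *
        sideProd col X Side.b (walkSteps a l) (splitEquiv v (R, Ψ)).2 := by
      rw [sideProd, sideProd, ← List.prod_map_mul]
      congr 1
      refine List.map_congr_left fun e _ => ?_
      simp only [e1, e2, splitSrc, splitTar]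
      cases hc : col e.2.1 <;> simp
    rw [e4]
    ring
  refine (norm_sum_le _ _).trans ((Finset.sum_le_sum fun R _ => key R).trans ?_)
  have : Fintype.card V = Fintype.card {u : V // u ≠ v} + 1 := by
    rw [Fintype.card_subtype_compl, Fintype.card_subtype_eq]
    have : 0 < Fintype.card V := Fintype.card_pos_iff.2 ⟨v⟩
    omega
  rw [this, pow_succ]
  simp

/-- The injective sums of the two colours of a closed walk with a non-separating vertex. -/
theorem norm_injective_sums_le [NeZero N] {col : κ → Side} {a v : V} {l : List (κ × V)}
    (hl : walkEnd a l = a) (hvis : ∀ u, u = a ∨ ∃ e ∈ walkSteps a l, e.1 = u ∨ e.2.2 = u)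
    (hv : ¬ IsSeparating col v (walkSteps a l))
    {X : κ → Matrix (Fin N) (Fin N) ℂ} (hX : ∀ k, IsContraction (X k)) :
    ‖∑ φ : V ↪ Fin N, sideProd col X Side.a (walkSteps a l) φ‖ *
      ‖∑ φ : V ↪ Fin N, sideProd col X Side.b (walkSteps a l) φ‖ ≤
      (Fintype.card V : ℝ) ^ (2 * Fintype.card V) * (N : ℝ) ^ Fintype.card V := by
  have : Nonempty V := ⟨v⟩
  rw [← norm_mul, two_mul, pow_add, mul_assoc, Finset.sum_mul]
  -- The colouring argument is applied to each of the two factors in turn, at a cost of m^m each.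
  refine norm_sum_embedding_le (G := fun ψ => sideProd col X Side.a (walkSteps a l) ψ *
    ∑ φ : V ↪ Fin N, sideProd col X Side.b (walkSteps a l) φ) _ fun ω hω => ?_
  simp only [← mul_assoc]
  rw [← Finset.sum_mul, Finset.mul_sum]
  refine norm_sum_embedding_le (G := fun φ => (∑ ψ : V → Fin N, (∏ u, ω u (ψ u)) *
    sideProd col X Side.a (walkSteps a l) ψ) * sideProd col X Side.b (walkSteps a l) φ) _
    fun ω' hω' => ?_
  simp only [mul_left_comm (∏ u, ω' u _)]
  rw [← Finset.mul_sum]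
  exact norm_weighted_sums_le hl hvis hv hX ω ω' hω hω'

end InjectiveSums

end DiagFreeSum

namespace DiagFreeSum

/-! ### Decomposition of sums over maps according to their kernels -/

section Patterns

variable {ι : Type*} [Fintype ι] [DecidableEq ι] {N : ℕ}

/-- The factorizations of a map through `Fin m` correspond to the enumerations of its range. -/
noncomputable def factorizationEquiv (J : ι → Fin N) (m : ℕ) :
    {p : (ι → Fin m) × (Fin m ↪ Fin N) // Function.Surjective p.1 ∧ p.2 ∘ p.1 = J} ≃
      (Fin m ≃ Set.range J) where
  toFun p := Equiv.ofBijective (fun i => ⟨p.1.2 i, by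
      obtain ⟨t, rfl⟩ := p.2.1 i
      exact ⟨t, (congrFun p.2.2 t).symm⟩⟩)
    ⟨fun i j h => p.1.2.injective (congrArg Subtype.val h), by
      rintro ⟨_, t, rfl⟩
      exact ⟨p.1.1 t, Subtype.ext (congrFun p.2.2 t)⟩⟩
  invFun e := ⟨(fun t => e.symm ⟨J t, t, rfl⟩,
      ⟨fun i => (e i : Fin N), fun i j h => e.injective (Subtype.ext h)⟩), by
    refine ⟨fun i => ?_, ?_⟩
    · obtain ⟨t, ht⟩ := (e i).2
      exact ⟨t, by rw [Equiv.symm_apply_eq]; exact Subtype.ext ht⟩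
    · funext t
      exact congrArg Subtype.val (e.apply_symm_apply _)⟩
  left_inv p := by
    apply Subtype.ext
    ext1
    · funext t
      simp only [Equiv.symm_apply_eq]
      exact Subtype.ext (congrFun p.2.2 t).symm
    · ext i; rfl
  right_inv e := by
    ext i; rfl

/-- Every map factors as a surjection onto some `Fin m` followed by an injection, with m the size of
its range, and there are m! such factorizations. The weight 1/m! is essential later, where it
cancels a factor m^m up to an exponential. -/
theorem sum_eq_sum_patterns (f : (ι → Fin N) → ℂ) :
    ∑ J, f J = ∑ m ∈ Finset.range (Fintype.card ι + 1), (m.factorial : ℂ)⁻¹ *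
      ∑ β : ι → Fin m, if Function.Surjective β then ∑ φ : Fin m ↪ Fin N, f (φ ∘ β) else 0 := by
  classical
  have h1 : ∀ m, (∑ β : ι → Fin m, if Function.Surjective β then
      ∑ φ : Fin m ↪ Fin N, f (φ ∘ β) else 0) =
      ∑ J, f J * (Fintype.card (Fin m ≃ Set.range J) : ℂ) := by
    intro m
    have e1 : ∀ J : ι → Fin N, (Fintype.card (Fin m ≃ Set.range J) : ℂ) =
        ∑ p : (ι → Fin m) × (Fin m ↪ Fin N),
          if Function.Surjective p.1 ∧ p.2 ∘ p.1 = J then 1 else 0 := by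
      intro J
      rw [← Fintype.card_congr (factorizationEquiv J m), Fintype.card_subtype]
      simp
    simp only [e1, Finset.mul_sum]
    rw [Finset.sum_comm, Fintype.sum_prod_type]
    refine Finset.sum_congr rfl fun β _ => ?_
    split_ifs with hβ
    · refine Finset.sum_congr rfl fun φ _ => ?_
      simp [hβ]
    · simp [hβ]
  simp only [h1, Finset.mul_sum]
  rw [Finset.sum_comm]
  refine Finset.sum_congr rfl fun J _ => ?_
  have h2 : ∀ m, (Fintype.card (Fin m ≃ Set.range J) : ℂ) =
      if m = Fintype.card (Set.range J) then (m.factorial : ℂ) else 0 := by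
    intro m
    split_ifs with hm
    · rw [Fintype.card_equiv (Fintype.equivOfCardEq (by simpa using hm)), Fintype.card_fin]
    · rw [Nat.cast_eq_zero, Fintype.card_eq_zero_iff]
      exact ⟨fun e => hm (by simpa using Fintype.card_congr e)⟩
  simp only [h2, mul_ite, mul_zero, Finset.sum_ite_eq', Finset.mem_range]
  have h3 : Fintype.card (Set.range J) < Fintype.card ι + 1 :=
    Nat.lt_succ_of_le (Fintype.card_range_le J)
  rw [if_pos h3]
  have : ((Fintype.card (Set.range J)).factorial : ℂ) ≠ 0 :=
    Nat.cast_ne_zero.2 (Nat.factorial_ne_zero _)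
  field_simp

end Patterns

end DiagFreeSum

namespace DiagFreeSum

/-! ### Expansion of moments over walks -/

instance Side.instFintype : Fintype Side := ⟨{Side.a, Side.b}, fun s => by cases s <;> simp⟩

theorem Side.sum_univ (f : Side → ℂ) : ∑ s, f s = f Side.a + f Side.b := by
  have : (Finset.univ : Finset Side) = {Side.a, Side.b} := rfl
  rw [this, Finset.sum_pair (by simp)]

theorem Side.card : Fintype.card Side = 2 := rfl

section Expansion

variable {N : ℕ} {κ : Type*}

/-- The matrix of each colour. -/
def sideMat (A B : Matrix (Fin N) (Fin N) ℂ) : Side → Matrix (Fin N) (Fin N) ℂ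
  | .a => A
  | .b => B

/-- The product of the matrix entries along a walk. -/
noncomputable def walkWeight (X : κ → Matrix (Fin N) (Fin N) ℂ) (i : Fin N)
    (l : List (κ × Fin N)) : ℂ :=
  ((walkSteps i l).map fun e => X e.2.1 e.1 e.2.2).prod

@[simp] theorem walkWeight_nil (X : κ → Matrix (Fin N) (Fin N) ℂ) (i : Fin N) :
    walkWeight X i [] = 1 := rfl

@[simp] theorem walkWeight_cons (X : κ → Matrix (Fin N) (Fin N) ℂ) (i : Fin N) (p : κ × Fin N)
    (l : List (κ × Fin N)) : walkWeight X i (p :: l) = X p.1 i p.2 * walkWeight X p.2 l := by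
  simp [walkWeight]

theorem walkWeight_append (X : κ → Matrix (Fin N) (Fin N) ℂ) (i : Fin N)
    (l l' : List (κ × Fin N)) :
    walkWeight X i (l ++ l') = walkWeight X i l * walkWeight X (walkEnd i l) l' := by
  simp [walkWeight, walkSteps_append]

/-- The walk with colours `w` and labels `J`. -/
def pairs {n : ℕ} {α : Type*} (w : Fin n → κ) (J : Fin n → α) : List (κ × α) :=
  List.ofFn fun t => (w t, J t)

theorem sum_pairs_succ {n : ℕ} (F : List (Side × Fin N) → ℂ) :
    ∑ w : Fin (n + 1) → Side, ∑ J : Fin (n + 1) → Fin N, F (pairs w J) =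
      ∑ s, ∑ k, ∑ w : Fin n → Side, ∑ J : Fin n → Fin N, F ((s, k) :: pairs w J) := by
  rw [← Equiv.sum_comp (Fin.consEquiv fun _ => Side), Fintype.sum_prod_type]
  refine Finset.sum_congr rfl fun s _ => ?_
  rw [Finset.sum_comm (s := (Finset.univ : Finset (Fin N)))]
  refine Finset.sum_congr rfl fun w _ => ?_
  rw [← Equiv.sum_comp (Fin.consEquiv fun _ => Fin N), Fintype.sum_prod_type]
  refine Finset.sum_congr rfl fun k _ => Finset.sum_congr rfl fun J _ => ?_
  simp [pairs, List.ofFn_succ, Fin.consEquiv]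

theorem pow_apply_eq_sum_walks (A B : Matrix (Fin N) (Fin N) ℂ) (n : ℕ) : ∀ i j : Fin N,
    ((A + B) ^ n) i j = ∑ w : Fin n → Side, ∑ J : Fin n → Fin N,
      if walkEnd i (pairs w J) = j then walkWeight (sideMat A B) i (pairs w J) else 0 := by
  induction n with
  | zero => intro i j; simp [pairs, Matrix.one_apply]
  | succ n ih =>
    intro i j
    rw [sum_pairs_succ (fun l => if walkEnd i l = j then walkWeight (sideMat A B) i l else 0),
      pow_succ', Matrix.mul_apply, Side.sum_univ, ← Finset.sum_add_distrib]
    refine Finset.sum_congr rfl fun k _ => ?_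
    rw [Matrix.add_apply, add_mul, ih k j]
    simp only [walkEnd_cons, walkWeight_cons, sideMat, Finset.mul_sum, mul_ite, mul_zero]

theorem freeSum_pow_apply {x : Fin N} (A B : Matrix (Fin N) (Fin N) ℂ) (n : ℕ) (f : H x) :
    ∀ v : Vertex x, ((freeSum x A B ^ n) f) v = ∑ w : Fin n → Side, ∑ J : Fin n → Fin N,
      walkWeight (sideMat A B) (Vertex.last v) (pairs w J) * f (Vertex.lift v (pairs w J)) := by
  induction n with
  | zero => intro v; simp [pairs]
  | succ n ih =>
    intro v
    rw [sum_pairs_succ (fun l => walkWeight (sideMat A B) (Vertex.last v) l *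
      f (Vertex.lift v l)), pow_succ', mul_apply_eq_comp, freeSum,
      add_apply, lp.coeFn_add, Pi.add_apply, compOp_apply, compOp_apply,
      Side.sum_univ]
    rw [← freeSum]
    simp only [ih, walkWeight_cons, Vertex.lift_cons, sideMat, Vertex.last_move, Finset.mul_sum,
      mul_assoc]

/-- The vertex with last index `i` in the component of colour `a` of the root. -/
noncomputable abbrev diagVertex (x i : Fin N) : Vertex x := Vertex.child Side.a none i

/-- The error of the `n`-th diagonal moments. -/
noncomputable def momentError (x : Fin N) (A B : Matrix (Fin N) (Fin N) ℂ) (n : ℕ)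
    (i : Fin N) : ℂ :=
  ((A + B) ^ n) i i -
    inner ℂ (delta (diagVertex x i)) ((freeSum x A B ^ n) (delta (diagVertex x i)))

/-- The walk is closed, but its lift is not. -/
def HasOpenLift (x i : Fin N) (l : List (Side × Fin N)) : Prop :=
  walkEnd i l = i ∧ Vertex.lift (diagVertex x i) l ≠ diagVertex x i

theorem inner_delta_left {x : Fin N} (v : Vertex x) (f : H x) : inner ℂ (delta v) f = f v := by
  rw [delta, lp.inner_single_left]
  simp

-- The walks have the same weight in both expansions, since lifting preserves labels. A closed lift
-- projects to a closed walk, so the difference keeps the walks closed below and open above.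
open Classical in
theorem momentError_eq_sum (x : Fin N) (A B : Matrix (Fin N) (Fin N) ℂ) (n : ℕ) (i : Fin N) :
    momentError x A B n i = ∑ w : Fin n → Side, ∑ J : Fin n → Fin N,
      if HasOpenLift x i (pairs w J) then walkWeight (sideMat A B) i (pairs w J) else 0 := by
  rw [momentError, pow_apply_eq_sum_walks, inner_delta_left, freeSum_pow_apply,
    ← Finset.sum_sub_distrib]
  refine Finset.sum_congr rfl fun w _ => ?_
  rw [← Finset.sum_sub_distrib]
  refine Finset.sum_congr rfl fun J _ => ?_
  rw [Vertex.last_child]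
  have hd : (delta (diagVertex x i) : H x) (Vertex.lift (diagVertex x i) (pairs w J)) =
      if Vertex.lift (diagVertex x i) (pairs w J) = diagVertex x i then 1 else 0 := by
    simp [delta, lp.single_apply, Pi.single_apply]
  rw [hd]
  by_cases h : Vertex.lift (diagVertex x i) (pairs w J) = diagVertex x i
  · have h2 : walkEnd i (pairs w J) = i := by
      have := Vertex.last_lift (pairs w J) (diagVertex x i)
      rw [h, Vertex.last_child] at this
      exact this.symm
    simp [HasOpenLift, h, h2]
  · simp [HasOpenLift, h]

end Expansion

/-! ### Pairs of walks for the squared error -/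

section Pairing

variable {N n : ℕ}

/-- The matrix of each colour, conjugated if the flag is `true`. -/
def pairMat (A B : Matrix (Fin N) (Fin N) ℂ) (k : Side × Bool) : Matrix (Fin N) (Fin N) ℂ :=
  if k.2 then (sideMat A B k.1).map star else sideMat A B k.1

/-- The first walk followed by the conjugate of the second, on their positions; the position
`none` is the common starting point. -/
def pairedWalk (w w' : Fin n → Side) : List ((Side × Bool) × Option (Fin n ⊕ Fin n)) :=
  pairs (fun t => (w t, false)) (fun t => some (Sum.inl t)) ++
    pairs (fun t => (w' t, true)) (fun t => some (Sum.inr t))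

/-- The steps of `pairedWalk`. -/
def pairedSteps (w w' : Fin n → Side) :
    List (Option (Fin n ⊕ Fin n) × (Side × Bool) × Option (Fin n ⊕ Fin n)) :=
  walkSteps none (pairedWalk w w')

theorem sideProd_map {V V' κ : Type*} (col : κ → Side) (X : κ → Matrix (Fin N) (Fin N) ℂ)
    (c : Side) (L : List (V × κ × V)) (β : V → V') (φ : V' → Fin N) :
    sideProd col X c (L.map (Prod.map β (Prod.map id β))) φ = sideProd col X c L (φ ∘ β) := by
  simp [sideProd, List.map_map, Function.comp_def]

theorem sideProd_mul_sideProd {V κ : Type*} (col : κ → Side) (X : κ → Matrix (Fin N) (Fin N) ℂ)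
    (L : List (V × κ × V)) (φ : V → Fin N) :
    sideProd col X Side.a L φ * sideProd col X Side.b L φ =
      (L.map fun e => X e.2.1 (φ e.1) (φ e.2.2)).prod := by
  rw [sideProd, sideProd, ← List.prod_map_mul]
  congr 1
  refine List.map_congr_left fun e _ => ?_
  cases h : col e.2.1 <;> simp

theorem pairs_map {κ α γ : Type*} (w : Fin n → κ) (J : Fin n → α) (f : α → γ) :
    (pairs w J).map (Prod.map id f) = pairs w (f ∘ J) := by
  simp [pairs, List.map_ofFn, Function.comp_def]

theorem walkEnd_pairs_congr {κ κ' α : Type*} (w : Fin n → κ) (w' : Fin n → κ') (J : Fin n → α)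
    (i : α) : walkEnd i (pairs w J) = walkEnd i (pairs w' J) := by
  induction n generalizing i with
  | zero => rfl
  | succ n ih =>
    simp only [pairs, List.ofFn_succ, walkEnd_cons]
    exact ih (fun t => w t.succ) (fun t => w' t.succ) (fun t => J t.succ) (J 0)

theorem walkWeight_pairs_flag (A B : Matrix (Fin N) (Fin N) ℂ) (w : Fin n → Side)
    (J : Fin n → Fin N) (i : Fin N) (b : Bool) :
    walkWeight (pairMat A B) i (pairs (fun t => (w t, b)) J) =
      if b then star (walkWeight (sideMat A B) i (pairs w J)) else
        walkWeight (sideMat A B) i (pairs w J) := by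
  induction n generalizing i with
  | zero => cases b <;> simp [pairs]
  | succ n ih =>
    have := ih (fun t => w t.succ) (fun t => J t.succ) (J 0)
    simp only [pairs] at this
    simp only [pairs, List.ofFn_succ, walkWeight_cons, this]
    cases b <;> simp [pairMat]

/-- The hypothesis says that the first walk closes up, so that in the concatenation the second one
starts at the common base point. -/
theorem sideProd_pairedSteps (A B : Matrix (Fin N) (Fin N) ℂ) (w w' : Fin n → Side)
    (J : Option (Fin n ⊕ Fin n) → Fin N)
    (h : walkEnd (J none) (pairs w fun t => J (some (Sum.inl t))) = J none) :
    sideProd Prod.fst (pairMat A B) Side.a (pairedSteps w w') J *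
      sideProd Prod.fst (pairMat A B) Side.b (pairedSteps w w') J =
    walkWeight (sideMat A B) (J none) (pairs w fun t => J (some (Sum.inl t))) *
      star (walkWeight (sideMat A B) (J none) (pairs w' fun t => J (some (Sum.inr t)))) := by
  rw [sideProd_mul_sideProd]
  have e1 : ((pairedSteps w w').map fun e => pairMat A B e.2.1 (J e.1) (J e.2.2)).prod =
      walkWeight (pairMat A B) (J none) ((pairedWalk w w').map (Prod.map id J)) := by
    rw [walkWeight, walkSteps_map, List.map_map]
    rfl
  rw [e1, pairedWalk, List.map_append, walkWeight_append, pairs_map, pairs_map,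
    walkEnd_pairs_congr _ w]
  have e2 : (J ∘ fun t : Fin n => some (Sum.inl t)) = fun t => J (some (Sum.inl t)) := rfl
  have e3 : (J ∘ fun t : Fin n => some (Sum.inr t)) = fun t => J (some (Sum.inr t)) := rfl
  rw [e2, e3, h, walkWeight_pairs_flag, walkWeight_pairs_flag]
  simp

/-- Both walks are closed, and neither of their lifts is. -/
def BothOpen (x : Fin N) (w w' : Fin n → Side) (J : Option (Fin n ⊕ Fin n) → Fin N) : Prop :=
  HasOpenLift x (J none) (pairs w fun t => J (some (Sum.inl t))) ∧
    HasOpenLift x (J none) (pairs w' fun t => J (some (Sum.inr t)))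

/-- A labelling of the positions consists of a starting point and two sequences. -/
def positionsEquiv (α : Type*) (n : ℕ) :
    (α × (Fin n → α)) × (Fin n → α) ≃ (Option (Fin n ⊕ Fin n) → α) where
  toFun p o := o.elim p.1.1 (Sum.elim p.1.2 p.2)
  invFun J := ((J none, fun t => J (some (Sum.inl t))), fun t => J (some (Sum.inr t)))
  left_inv p := rfl
  right_inv J := by
    funext o
    rcases o with _ | (t | t) <;> rfl

open Classical in
theorem sum_norm_momentError_sq (x : Fin N) (A B : Matrix (Fin N) (Fin N) ℂ) (n : ℕ) :
    ((∑ i, ‖momentError x A B n i‖ ^ 2 : ℝ) : ℂ) =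
      ∑ w : Fin n → Side, ∑ w' : Fin n → Side, ∑ J : Option (Fin n ⊕ Fin n) → Fin N,
        if BothOpen x w w' J then
          sideProd Prod.fst (pairMat A B) Side.a (pairedSteps w w') J *
            sideProd Prod.fst (pairMat A B) Side.b (pairedSteps w w') J
        else 0 := by
  have h1 : ∀ (w w' : Fin n → Side), (∑ J : Option (Fin n ⊕ Fin n) → Fin N,
      if BothOpen x w w' J then
          sideProd Prod.fst (pairMat A B) Side.a (pairedSteps w w') J *
            sideProd Prod.fst (pairMat A B) Side.b (pairedSteps w w') J
        else 0) = ∑ i, (∑ J : Fin n → Fin N, if HasOpenLift x i (pairs w J) then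
          walkWeight (sideMat A B) i (pairs w J) else 0) *
        star (∑ J : Fin n → Fin N, if HasOpenLift x i (pairs w' J) then
          walkWeight (sideMat A B) i (pairs w' J) else 0) := by
    intro w w'
    rw [← Equiv.sum_comp (positionsEquiv (Fin N) n), Fintype.sum_prod_type,
      Fintype.sum_prod_type]
    refine Finset.sum_congr rfl fun i _ => ?_
    rw [star_sum, Finset.sum_mul_sum]
    refine Finset.sum_congr rfl fun J _ => Finset.sum_congr rfl fun J' _ => ?_
    by_cases hw : HasOpenLift x i (pairs w J)
    · have e := sideProd_pairedSteps A B w w' (positionsEquiv (Fin N) n ((i, J), J')) hw.1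
      by_cases hw' : HasOpenLift x i (pairs w' J')
      · have : BothOpen x w w' (positionsEquiv (Fin N) n ((i, J), J')) := ⟨hw, hw'⟩
        rw [if_pos this, if_pos hw, if_pos hw', e]
        rfl
      · have : ¬ BothOpen x w w' (positionsEquiv (Fin N) n ((i, J), J')) := fun h => hw' h.2
        rw [if_neg this, if_neg hw']
        simp
    · have : ¬ BothOpen x w w' (positionsEquiv (Fin N) n ((i, J), J')) := fun h => hw h.1
      rw [if_neg this, if_neg hw]
      simp
  simp only [h1]
  have h2 : ∀ i, ((‖momentError x A B n i‖ ^ 2 : ℝ) : ℂ) =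
      momentError x A B n i * star (momentError x A B n i) := by
    intro i
    rw [Complex.star_def, Complex.mul_conj, Complex.normSq_eq_norm_sq]
  rw [Complex.ofReal_sum]
  simp only [h2]
  rw [Finset.sum_congr rfl fun w _ => Finset.sum_comm, Finset.sum_comm]
  refine Finset.sum_congr rfl fun i _ => ?_
  rw [momentError_eq_sum, star_sum, Finset.sum_mul_sum]

end Pairing

end DiagFreeSum

namespace DiagFreeSum

/-! ### Expectations of pairs of walks with open lifts -/

section OpenLifts

variable {N n : ℕ} {x : Fin N}

/-- If the relabelled lift were closed, relabelling back by the inverse permutation would close the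
original one. -/
theorem HasOpenLift.relabel {i : Fin N} {l : List (Side × Fin N)} (h : HasOpenLift x i l)
    (σ : Equiv.Perm (Fin N)) : HasOpenLift x (σ i) (l.map (Prod.map id σ)) := by
  refine ⟨by rw [walkEnd_map, h.1], fun h' => h.2 ?_⟩
  have h2 := Vertex.lift_eq_self_of_relabel (σ := σ.symm) (v := diagVertex x (σ i))
    (v' := diagVertex x i) (by simp) h'
  rw [List.map_map] at h2
  have e : (Prod.map id ⇑σ.symm ∘ Prod.map id ⇑σ : Side × Fin N → Side × Fin N) = id := by
    funext ⟨s, k⟩; simp [Prod.map]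
  rwa [e, List.map_id] at h2

theorem BothOpen.relabel {w w' : Fin n → Side} {J : Option (Fin n ⊕ Fin n) → Fin N}
    (h : BothOpen x w w' J) (σ : Equiv.Perm (Fin N)) : BothOpen x w w' (σ ∘ J) := by
  have h1 := h.1.relabel σ
  have h2 := h.2.relabel σ
  rw [pairs_map] at h1 h2
  exact ⟨h1, h2⟩

variable {V : Type*} {w w' : Fin n → Side} {β : Option (Fin n ⊕ Fin n) → V} {φ : V → Fin N}

theorem walkSteps_pairedWalk_map (w w' : Fin n → Side) (β : Option (Fin n ⊕ Fin n) → V) :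
    walkSteps (β none) ((pairedWalk w w').map (Prod.map id β)) =
      (pairedSteps w w').map (Prod.map β (Prod.map id β)) :=
  walkSteps_map id β _ none

theorem BothOpen.walkEnd_eq (h : BothOpen x w w' (φ ∘ β)) (hφ : Function.Injective φ) :
    walkEnd (β none) ((pairedWalk w w').map (Prod.map id β)) = β none := by
  have key : ∀ (b : Bool) (u : Fin n → Side) (f : Fin n → Option (Fin n ⊕ Fin n)),
      walkEnd (φ (β none)) (pairs u fun t => φ (β (f t))) = φ (β none) →
      walkEnd (β none) ((pairs (fun t => (u t, b)) f).map (Prod.map id β)) = β none := by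
    intro b u f hu
    apply hφ
    rw [← walkEnd_map Prod.fst φ, List.map_map]
    have : (pairs (fun t => (u t, b)) f).map
        (Prod.map Prod.fst φ ∘ Prod.map (id : Side × Bool → Side × Bool) β) =
        pairs u fun t => φ (β (f t)) := by
      simp [pairs, List.map_ofFn, Function.comp_def]
    rw [this, hu]
  rw [pairedWalk, List.map_append, walkEnd_append, key _ _ _ h.1.1, key _ _ _ h.2.1]

/-- If every vertex separated the paired walk, every label would separate the first walk, whose
steps are among those of the pair, and its lift would be closed. -/
theorem BothOpen.exists_not_isSeparating (h : BothOpen x w w' (φ ∘ β))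
    (hφ : Function.Injective φ) : ∃ v, ¬ IsSeparating Prod.fst v
      (walkSteps (β none) ((pairedWalk w w').map (Prod.map id β))) := by
  by_contra hsep
  push Not at hsep
  refine h.1.2 (Vertex.lift_eq_self_of_isSeparating _ _ _ rfl ?_ fun u => ?_)
  · rw [Vertex.last_child]; exact h.1.1
  · rw [Vertex.last_child]
    refine (IsSeparating.map (q := Prod.fst) (col' := id) hφ (fun _ => rfl) hsep u).mono
      fun e he => ?_
    rw [← walkSteps_map, List.map_map, pairedWalk, List.map_append, walkSteps_append,
      List.mem_append]
    left
    have : (pairs (fun t => (w t, false)) fun t => (some (Sum.inl t) : Option (Fin n ⊕ Fin n))).map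
        (Prod.map Prod.fst φ ∘ Prod.map (id : Side × Bool → Side × Bool) β) =
        pairs w fun t => (φ ∘ β) (some (Sum.inl t)) := by
      simp [pairs, List.map_ofFn, Function.comp_def]
    rw [this]
    exact he

theorem exists_mem_walkSteps_pairedWalk (hβ : Function.Surjective β) (u : V) :
    u = β none ∨ ∃ e ∈ walkSteps (β none) ((pairedWalk w w').map (Prod.map id β)),
      e.1 = u ∨ e.2.2 = u := by
  obtain ⟨o, rfl⟩ := hβ u
  rcases o with _ | (t | t)
  · exact Or.inl rfl
  · obtain ⟨e, he, h⟩ := exists_mem_walkSteps (List.mem_map_of_mem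
      (f := Prod.map (id : Side × Bool → Side × Bool) β) (List.mem_append_left _
        (List.mem_ofFn.2 ⟨t, rfl⟩) : ((w t, false), some (Sum.inl t)) ∈ pairedWalk w w')) (β none)
    exact Or.inr ⟨e, he, Or.inr h⟩
  · obtain ⟨e, he, h⟩ := exists_mem_walkSteps (List.mem_map_of_mem
      (f := Prod.map (id : Side × Bool → Side × Bool) β) (List.mem_append_right _
        (List.mem_ofFn.2 ⟨t, rfl⟩) : ((w' t, true), some (Sum.inr t)) ∈ pairedWalk w w')) (β none)
    exact Or.inr ⟨e, he, Or.inr h⟩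

end OpenLifts

/-! ### Matrices scaled to contractions, and measurability of the products -/

section Scaling

variable {N : ℕ} {V : Type*}

/-- The number of steps of colour `c`. -/
def stepCount (c : Side) (L : List (V × (Side × Bool) × V)) : ℕ :=
  L.countP fun e => decide (e.2.1.1 = c)

theorem stepCount_add_stepCount (L : List (V × (Side × Bool) × V)) :
    stepCount Side.a L + stepCount Side.b L = L.length := by
  induction L with
  | nil => rfl
  | cons e L ih =>
    simp only [stepCount, List.countP_cons, List.length_cons] at ih ⊢
    rw [← ih]
    cases e.2.1.1 <;> simp <;> omega

theorem sideProd_smul (A : Matrix (Fin N) (Fin N) ℂ) (r : ℝ) (c : Side)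
    (L : List (V × (Side × Bool) × V)) (φ : V → Fin N) :
    sideProd Prod.fst (pairMat ((r : ℂ) • A) ((r : ℂ) • A)) c L φ =
      (r : ℂ) ^ stepCount c L * sideProd Prod.fst (pairMat A A) c L φ := by
  induction L with
  | nil => simp [sideProd, stepCount]
  | cons e L ih =>
    obtain ⟨u, ⟨s, b⟩, v⟩ := e
    simp only [sideProd, stepCount, List.map_cons, List.prod_cons, List.countP_cons] at ih ⊢
    rw [ih]
    by_cases hs : s = c
    · cases s <;> cases b <;> simp [pairMat, sideMat, hs] <;> ring
    · simp [hs]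

theorem sideProd_a_eq (A B : Matrix (Fin N) (Fin N) ℂ) (L : List (V × (Side × Bool) × V))
    (φ : V → Fin N) : sideProd Prod.fst (pairMat A B) Side.a L φ =
      sideProd Prod.fst (pairMat A A) Side.a L φ := by
  rw [sideProd, sideProd]
  congr 1
  refine List.map_congr_left fun e _ => ?_
  split_ifs with h
  · simp [pairMat, sideMat, h]
  · rfl

theorem sideProd_b_eq (A B : Matrix (Fin N) (Fin N) ℂ) (L : List (V × (Side × Bool) × V))
    (φ : V → Fin N) : sideProd Prod.fst (pairMat A B) Side.b L φ =
      sideProd Prod.fst (pairMat B B) Side.b L φ := by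
  rw [sideProd, sideProd]
  congr 1
  refine List.map_congr_left fun e _ => ?_
  split_ifs with h
  · simp [pairMat, sideMat, h]
  · rfl

theorem sideProd_submatrix (A : Matrix (Fin N) (Fin N) ℂ) (c : Side) (σ : Fin N → Fin N)
    (L : List (V × (Side × Bool) × V)) (φ : V → Fin N) :
    sideProd Prod.fst (pairMat A A) c L (σ ∘ φ) =
      sideProd Prod.fst (pairMat (A.submatrix σ σ) (A.submatrix σ σ)) c L φ := by
  rw [sideProd, sideProd]
  congr 1
  refine List.map_congr_left fun e _ => ?_
  obtain ⟨u, ⟨s, b⟩, v⟩ := e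
  cases s <;> cases b <;> simp [pairMat, sideMat]

theorem measurable_sideProd (c : Side) (L : List (V × (Side × Bool) × V)) (φ : V → Fin N) :
    Measurable fun A : Matrix (Fin N) (Fin N) ℂ =>
      sideProd Prod.fst (pairMat A A) c L φ := by
  have hentry : ∀ i j, Measurable fun A : Matrix (Fin N) (Fin N) ℂ => A i j := fun i j =>
    (measurable_pi_apply j).comp (measurable_pi_apply (X := fun _ : Fin N => Fin N → ℂ) i)
  induction L with
  | nil => simp [sideProd]
  | cons e L ih =>
    simp only [sideProd, List.map_cons, List.prod_cons] at ih ⊢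
    refine Measurable.mul ?_ ih
    obtain ⟨u, ⟨s, b⟩, v⟩ := e
    split_ifs with h
    · cases s <;> cases b <;> simp only [pairMat, sideMat, Matrix.map_apply, if_true,
        Bool.false_eq_true, if_false]
      · exact hentry _ _
      · exact Complex.continuous_conj.measurable.comp (hentry _ _)
      · exact hentry _ _
      · exact Complex.continuous_conj.measurable.comp (hentry _ _)
    · exact measurable_const

theorem IsContraction.norm_apply_le {X : Matrix (Fin N) (Fin N) ℂ} (h : IsContraction X)
    (i j : Fin N) : ‖X i j‖ ≤ 1 := by
  have := h (Pi.single i 1) (Pi.single j 1)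
  have e : ∀ k : Fin N, ∑ l, ‖(Pi.single k (1 : ℂ) : Fin N → ℂ) l‖ ^ 2 = 1 := by
    intro k
    rw [Finset.sum_eq_single k] <;> simp +contextual
  rw [e, e] at this
  have e2 : ∑ i', ∑ j', (Pi.single i (1 : ℂ) : Fin N → ℂ) i' * X i' j' *
      (Pi.single j (1 : ℂ) : Fin N → ℂ) j' = X i j := by
    simp [Pi.single_apply]
  rw [e2] at this
  nlinarith [norm_nonneg (X i j)]

theorem IsContraction.pairMat {A B : Matrix (Fin N) (Fin N) ℂ} (hA : IsContraction A)
    (hB : IsContraction B) (k : Side × Bool) : IsContraction (pairMat A B k) := by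
  obtain ⟨s, b⟩ := k
  cases s <;> cases b
  · exact hA
  · exact hA.conj
  · exact hB
  · exact hB.conj

theorem norm_sideProd_le {A : Matrix (Fin N) (Fin N) ℂ} {a : ℝ} (ha : 0 < a)
    (hA : IsContraction (((a⁻¹ : ℝ) : ℂ) • A)) (c : Side) (L : List (V × (Side × Bool) × V))
    (φ : V → Fin N) : ‖sideProd Prod.fst (pairMat A A) c L φ‖ ≤ a ^ stepCount c L := by
  have h1 := sideProd_smul A a⁻¹ c L φ
  have h2 : ‖sideProd Prod.fst (DiagFreeSum.pairMat (((a⁻¹ : ℝ) : ℂ) • A)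
      (((a⁻¹ : ℝ) : ℂ) • A)) c L φ‖ ≤ 1 := by
    rw [sideProd]
    generalize hX : DiagFreeSum.pairMat (((a⁻¹ : ℝ) : ℂ) • A) (((a⁻¹ : ℝ) : ℂ) • A) = X
    have hXc : ∀ k, IsContraction (X k) := fun k => hX ▸ hA.pairMat hA k
    induction L with
    | nil => simp
    | cons e L ih =>
      rw [List.map_cons, List.prod_cons, norm_mul]
      refine mul_le_one₀ ?_ (norm_nonneg _) (ih (sideProd_smul A a⁻¹ c L φ))
      split_ifs
      · exact (hXc _).norm_apply_le _ _
      · simp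
  rw [h1, norm_mul, norm_pow, Complex.norm_real, Real.norm_of_nonneg (by positivity),
    inv_pow, ← div_eq_inv_mul, div_le_one (by positivity)] at h2
  exact h2

/-- The bound on the injective sums, for matrices of operator norms at most `a`, `b`. -/
theorem norm_injective_sums_le_mul [NeZero N] [Fintype V] [DecidableEq V]
    {A B : Matrix (Fin N) (Fin N) ℂ} {a b : ℝ} (ha : 0 < a) (hb : 0 < b)
    (hA : IsContraction (((a⁻¹ : ℝ) : ℂ) • A)) (hB : IsContraction (((b⁻¹ : ℝ) : ℂ) • B))
    {p v : V} {l : List ((Side × Bool) × V)} (hl : walkEnd p l = p)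
    (hvis : ∀ u, u = p ∨ ∃ e ∈ walkSteps p l, e.1 = u ∨ e.2.2 = u)
    (hv : ¬ IsSeparating Prod.fst v (walkSteps p l)) :
    ‖∑ φ : V ↪ Fin N, sideProd Prod.fst (pairMat A A) Side.a (walkSteps p l) φ‖ *
      ‖∑ φ : V ↪ Fin N, sideProd Prod.fst (pairMat B B) Side.b (walkSteps p l) φ‖ ≤
      (Fintype.card V : ℝ) ^ (2 * Fintype.card V) * (N : ℝ) ^ Fintype.card V *
        (a ^ stepCount Side.a (walkSteps p l) * b ^ stepCount Side.b (walkSteps p l)) := by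
  have key := norm_injective_sums_le hl hvis hv (hA.pairMat hB)
  simp only [sideProd_a_eq (((a⁻¹ : ℝ) : ℂ) • A), sideProd_b_eq (((a⁻¹ : ℝ) : ℂ) • A),
    sideProd_smul, ← Finset.mul_sum, norm_mul, norm_pow, Complex.norm_real] at key
  rw [Real.norm_of_nonneg (by positivity), Real.norm_of_nonneg (by positivity), inv_pow,
    inv_pow] at key
  have hpa : 0 < a ^ stepCount Side.a (walkSteps p l) := by positivity
  have hpb : 0 < b ^ stepCount Side.b (walkSteps p l) := by positivity
  have h2 := mul_le_mul_of_nonneg_right key (mul_pos hpa hpb).le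
  refine le_trans (le_of_eq ?_) h2
  field_simp

end Scaling

end DiagFreeSum

namespace DiagFreeSum

/-! ### The mean square error of the moments -/

section Expectation

variable {Ω : Type*} [MeasurableSpace Ω] {μ : Measure Ω}

/-- The product of the two integrals is a double integral over separate sample points, so the
pointwise bound is required for all pairs `ω`, `ω'`. -/
theorem integral_mul_integral_le {f g u v : Ω → ℝ} (hg : Integrable g μ) (hf : Integrable f μ)
    (hu : Integrable u μ) (hv : Integrable v μ)
    {K : ℝ} (h : ∀ ω ω', f ω * g ω' ≤ K * (u ω * v ω')) :
    (∫ ω, f ω ∂μ) * ∫ ω, g ω ∂μ ≤ K * ((∫ ω, u ω ∂μ) * ∫ ω, v ω ∂μ) := by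
  have h1 : ∀ ω, f ω * ∫ ω', g ω' ∂μ ≤ K * (u ω * ∫ ω', v ω' ∂μ) := by
    intro ω
    rw [← integral_const_mul, ← integral_const_mul, ← integral_const_mul]
    exact integral_mono (hg.const_mul _) ((hv.const_mul _).const_mul _) fun ω' => h ω ω'
  rw [← integral_mul_const, ← integral_mul_const, ← integral_const_mul]
  exact integral_mono (hf.mul_const _) ((hu.mul_const _).const_mul _) h1

/-- When one of the two expectations does not depend on the index, the sum of products times the
number of indices equals the product of the two sums. This turns a correlated sum into two separate
ones. -/
theorem norm_sum_integral_mul_integral_le {ι : Type*} [Fintype ι] [Nonempty ι] {F G : ι → Ω → ℂ}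
    (hF : ∀ φ, Integrable (F φ) μ) (hG : ∀ φ, Integrable (G φ) μ)
    (hconst : (∀ φ φ', ∫ ω, F φ ω ∂μ = ∫ ω, F φ' ω ∂μ) ∨
      ∀ φ φ', ∫ ω, G φ ω ∂μ = ∫ ω, G φ' ω ∂μ)
    {u v : Ω → ℝ} (hu : Integrable u μ) (hv : Integrable v μ) {K : ℝ}
    (h : ∀ ω ω', ‖∑ φ, F φ ω‖ * ‖∑ φ, G φ ω'‖ ≤ K * (u ω * v ω')) :
    Fintype.card ι * ‖∑ φ, (∫ ω, F φ ω ∂μ) * ∫ ω, G φ ω ∂μ‖ ≤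
      K * ((∫ ω, u ω ∂μ) * ∫ ω, v ω ∂μ) := by
  obtain ⟨φ₀⟩ := ‹Nonempty ι›
  have h1 : (Fintype.card ι : ℂ) * ∑ φ, (∫ ω, F φ ω ∂μ) * ∫ ω, G φ ω ∂μ =
      (∫ ω, ∑ φ, F φ ω ∂μ) * ∫ ω, ∑ φ, G φ ω ∂μ := by
    rw [integral_finsetSum _ fun φ _ => hF φ, integral_finsetSum _ fun φ _ => hG φ]
    rcases hconst with hc | hc
    · rw [Finset.sum_congr rfl fun φ _ => by rw [hc φ φ₀], ← Finset.mul_sum,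
        Finset.sum_congr rfl fun φ _ => hc φ φ₀]
      simp [mul_assoc]
    · rw [Finset.sum_congr rfl fun φ _ => by rw [hc φ φ₀], ← Finset.sum_mul,
        Finset.sum_congr rfl fun φ _ => hc φ φ₀]
      simp only [Finset.sum_const, Finset.card_univ, nsmul_eq_mul]
      ring
  have h2 := congrArg norm h1
  rw [norm_mul, norm_mul, Complex.norm_natCast] at h2
  rw [h2]
  refine le_trans ?_ (integral_mul_integral_le (integrable_finsetSum _ fun φ _ => hG φ).norm
    (integrable_finsetSum _ fun φ _ => hF φ).norm hu hv h)
  gcongr <;> exact norm_integral_le_integral_norm _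

variable {N n : ℕ}

theorem permMatrix_conj (σ : Equiv.Perm (Fin N)) (X : Matrix (Fin N) (Fin N) ℂ) :
    σ.permMatrix ℂ * X * (σ.permMatrix ℂ)⁻¹ = X.submatrix σ σ := by
  have h : (σ.permMatrix ℂ)⁻¹ = (σ⁻¹).permMatrix ℂ := by
    apply Matrix.inv_eq_right_inv
    rw [← Matrix.permMatrix_mul]
    simp
  rw [h, Equiv.Perm.permMatrix, Equiv.Perm.permMatrix, PEquiv.toMatrix_toPEquiv_mul,
    PEquiv.mul_toMatrix_toPEquiv]
  rfl

theorem measurable_conj_permMatrix (σ : Equiv.Perm (Fin N)) :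
    Measurable fun X : Matrix (Fin N) (Fin N) ℂ => σ.permMatrix ℂ * X * (σ.permMatrix ℂ)⁻¹ := by
  simp only [permMatrix_conj]
  refine measurable_pi_lambda (X := fun _ : Fin N => Fin N → ℂ) _ fun i =>
    measurable_pi_lambda _ fun j => ?_
  exact (measurable_pi_apply (σ j)).comp
    (measurable_pi_apply (X := fun _ : Fin N => Fin N → ℂ) (σ i))

/-- Two injective labellings differ by a permutation of the labels, which the law does not see. -/
theorem PermInvariant.integral_sideProd_eq {X : Ω → Matrix (Fin N) (Fin N) ℂ}
    (h : PermInvariant μ X) (hX : Measurable X) {V : Type*} [Finite V] (c : Side)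
    (L : List (V × (Side × Bool) × V)) (φ φ' : V ↪ Fin N) :
    ∫ ω, sideProd Prod.fst (pairMat (X ω) (X ω)) c L φ ∂μ =
      ∫ ω, sideProd Prod.fst (pairMat (X ω) (X ω)) c L φ' ∂μ := by
  obtain ⟨σ, hσ⟩ := Equiv.Perm.exists_extending_pair φ φ' φ.injective φ'.injective
  have h1 : (φ' : V → Fin N) = σ ∘ φ := funext fun i => (hσ i).symm
  have hm := measurable_sideProd (N := N) c L φ
  rw [← integral_map (φ := X) (f := fun X => sideProd Prod.fst (pairMat X X) c L φ)
    hX.aemeasurable hm.aestronglyMeasurable, ← h σ,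
    integral_map (φ := fun ω => σ.permMatrix ℂ * X ω * (σ.permMatrix ℂ)⁻¹)
      ((measurable_conj_permMatrix σ).comp hX).aemeasurable hm.aestronglyMeasurable, h1]
  simp only [sideProd_submatrix, permMatrix_conj]

theorem pow_le_two_pow_mul_descFactorial {m : ℕ} (h : 2 * m ≤ N) :
    N ^ m ≤ 2 ^ m * N.descFactorial m := by
  calc N ^ m ≤ (2 * (N + 1 - m)) ^ m := by gcongr; omega
    _ = 2 ^ m * (N + 1 - m) ^ m := mul_pow _ _ _
    _ ≤ _ := by gcongr; exact Nat.pow_sub_le_descFactorial N m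

theorem length_pairedSteps (w w' : Fin n → Side) : (pairedSteps w w').length = 2 * n := by
  simp [pairedSteps, length_walkSteps, pairedWalk, pairs, two_mul]

variable {A B : Ω → Matrix (Fin N) (Fin N) ℂ} {a b : Ω → ℝ}

theorem integrable_sideProd (hA : Measurable A) (ha : ∀ ω, 0 < a ω)
    (hAa : ∀ ω, IsContraction ((((a ω)⁻¹ : ℝ) : ℂ) • A ω)) {V : Type*} (c : Side)
    (L : List (V × (Side × Bool) × V)) (φ : V → Fin N)
    (hint : Integrable (fun ω => a ω ^ stepCount c L) μ) :
    Integrable (fun ω => sideProd Prod.fst (pairMat (A ω) (A ω)) c L φ) μ :=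
  hint.mono' ((measurable_sideProd c L φ).comp hA).aestronglyMeasurable
    (Eventually.of_forall fun ω => norm_sideProd_le (ha ω) (hAa ω) c L φ)

variable (hA : Measurable A) (hB : Measurable B) (hind : IndepFun A B μ)
  (hperm : PermInvariant μ A ∨ PermInvariant μ B)
  (ha : ∀ ω, 0 < a ω) (hb : ∀ ω, 0 < b ω)
  (hAa : ∀ ω, IsContraction ((((a ω)⁻¹ : ℝ) : ℂ) • A ω))
  (hBb : ∀ ω, IsContraction ((((b ω)⁻¹ : ℝ) : ℂ) • B ω))
  (hai : ∀ e ≤ 2 * n, Integrable (fun ω => a ω ^ e) μ)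
  (hbi : ∀ e ≤ 2 * n, Integrable (fun ω => b ω ^ e) μ)

include hA hB hind ha hb hAa hBb hai hbi

theorem integrable_sideProd_mul_sideProd {V : Type*} (L : List (V × (Side × Bool) × V))
    (hL : L.length = 2 * n) (φ : V → Fin N) :
    Integrable (fun ω => sideProd Prod.fst (pairMat (A ω) (A ω)) Side.a L φ *
      sideProd Prod.fst (pairMat (B ω) (B ω)) Side.b L φ) μ ∧
    ∫ ω, sideProd Prod.fst (pairMat (A ω) (A ω)) Side.a L φ *
      sideProd Prod.fst (pairMat (B ω) (B ω)) Side.b L φ ∂μ =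
    (∫ ω, sideProd Prod.fst (pairMat (A ω) (A ω)) Side.a L φ ∂μ) *
      ∫ ω, sideProd Prod.fst (pairMat (B ω) (B ω)) Side.b L φ ∂μ := by
  have hs := stepCount_add_stepCount L
  have h1 := integrable_sideProd hA ha hAa Side.a L φ (hai _ (by omega))
  have h2 := integrable_sideProd hB hb hBb Side.b L φ (hbi _ (by omega))
  have h3 := hind.comp (measurable_sideProd Side.a L φ) (measurable_sideProd Side.b L φ)
  exact ⟨h3.integrable_mul h1 h2, h3.integral_fun_mul_eq_mul_integral
    h1.aestronglyMeasurable h2.aestronglyMeasurable⟩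

-- Averaging over embeddings divides by the falling factorial of `N`, which for 2m ≤ N is at least
-- N^m / 2^m. It cancels the N^m in the bound on the two injective sums, so that a pattern
-- contributes no power of `N` beyond those hidden in `Q`.
include hperm in
theorem norm_sum_integral_sideProd_le {Q : ℝ}
    (hQ : ∀ e e', e + e' = 2 * n → (∫ ω, a ω ^ e ∂μ) * ∫ ω, b ω ^ e' ∂μ ≤ Q)
    {m : ℕ} (hm : 2 * m ≤ N) {p v : Fin m} {l : List ((Side × Bool) × Fin m)}
    (hlen : l.length = 2 * n) (hl : walkEnd p l = p)
    (hvis : ∀ u, u = p ∨ ∃ e ∈ walkSteps p l, e.1 = u ∨ e.2.2 = u)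
    (hv : ¬ IsSeparating Prod.fst v (walkSteps p l)) :
    ‖∑ φ : Fin m ↪ Fin N, ∫ ω, sideProd Prod.fst (pairMat (A ω) (A ω)) Side.a (walkSteps p l) φ *
      sideProd Prod.fst (pairMat (B ω) (B ω)) Side.b (walkSteps p l) φ ∂μ‖ ≤
      (m : ℝ) ^ (2 * m) * 2 ^ m * Q := by
  have hlen' : (walkSteps p l).length = 2 * n := by rw [length_walkSteps, hlen]
  have hs := stepCount_add_stepCount (walkSteps p l)
  have : NeZero N := ⟨by have := p.2; omega⟩
  have : Nonempty (Fin m ↪ Fin N) := ⟨Fin.castLEEmb (by omega)⟩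
  simp only [(integrable_sideProd_mul_sideProd hA hB hind ha hb hAa hBb hai hbi _ hlen' _).2]
  have key := norm_sum_integral_mul_integral_le (μ := μ)
    (F := fun (φ : Fin m ↪ Fin N) ω =>
      sideProd Prod.fst (pairMat (A ω) (A ω)) Side.a (walkSteps p l) φ)
    (G := fun (φ : Fin m ↪ Fin N) ω =>
      sideProd Prod.fst (pairMat (B ω) (B ω)) Side.b (walkSteps p l) φ)
    (fun φ => integrable_sideProd hA ha hAa _ _ φ (hai _ (by omega)))
    (fun φ => integrable_sideProd hB hb hBb _ _ φ (hbi _ (by omega)))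
    (hperm.imp (fun h => h.integral_sideProd_eq hA _ _) fun h => h.integral_sideProd_eq hB _ _)
    (hai (stepCount Side.a (walkSteps p l)) (by omega))
    (hbi (stepCount Side.b (walkSteps p l)) (by omega))
    (fun ω ω' => norm_injective_sums_le_mul (ha ω) (hb ω') (hAa ω) (hBb ω') hl hvis hv)
  rw [Fintype.card_embedding_eq, Fintype.card_fin, Fintype.card_fin] at key
  have hQ' := hQ _ _ (hs.trans hlen')
  have hd : (N : ℝ) ^ m ≤ 2 ^ m * (N.descFactorial m : ℝ) := by
    exact_mod_cast pow_le_two_pow_mul_descFactorial hm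
  have hd0 : (0 : ℝ) < N.descFactorial m := by
    exact_mod_cast Nat.descFactorial_pos.2 (by omega)
  have hQ0 : 0 ≤ Q := le_trans (mul_nonneg (integral_nonneg fun ω => by have := ha ω; positivity)
    (integral_nonneg fun ω => by have := hb ω; positivity)) hQ'
  refine le_of_mul_le_mul_left (key.trans ?_) hd0
  have h0 : 0 ≤ (∫ ω, a ω ^ stepCount Side.a (walkSteps p l) ∂μ) *
      ∫ ω, b ω ^ stepCount Side.b (walkSteps p l) ∂μ :=
    mul_nonneg (integral_nonneg fun ω => pow_nonneg (ha ω).le _)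
      (integral_nonneg fun ω => pow_nonneg (hb ω).le _)
  calc _ ≤ (m : ℝ) ^ (2 * m) * (2 ^ m * (N.descFactorial m : ℝ)) * Q := by gcongr
    _ = _ := by ring

-- For a given pattern either all injective labellings have open lifts or none does, by invariance
-- under permutations. Hence the indicator is constant and the full injective sum can be estimated.
include hperm in
open Classical in
theorem norm_sum_integral_bothOpen_le {Q : ℝ} (hn : 2 * (2 * n + 1) ≤ N)
    (hQ : ∀ e e', e + e' = 2 * n → (∫ ω, a ω ^ e ∂μ) * ∫ ω, b ω ^ e' ∂μ ≤ Q) (x : Fin N)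
    (w w' : Fin n → Side) {m : ℕ} {β : Option (Fin n ⊕ Fin n) → Fin m}
    (hβ : Function.Surjective β) :
    ‖∑ φ : Fin m ↪ Fin N, ∫ ω, (if BothOpen x w w' (φ ∘ β) then
          sideProd Prod.fst (pairMat (A ω) (B ω)) Side.a (pairedSteps w w') (φ ∘ β) *
            sideProd Prod.fst (pairMat (A ω) (B ω)) Side.b (pairedSteps w w') (φ ∘ β)
        else 0) ∂μ‖ ≤ (m : ℝ) ^ (2 * m) * 2 ^ m * Q := by
  have hQ0 : 0 ≤ Q := le_trans (mul_nonneg (integral_nonneg fun ω => by have := ha ω; positivity)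
    (integral_nonneg fun ω => by have := hb ω; positivity)) (hQ 0 (2 * n) (by omega))
  have hm : m ≤ 2 * n + 1 := by
    have := Fintype.card_le_of_surjective β hβ
    simp at this
    omega
  by_cases hex : ∃ φ₀ : Fin m ↪ Fin N, BothOpen x w w' (φ₀ ∘ β)
  · obtain ⟨φ₀, h₀⟩ := hex
    have hall : ∀ φ : Fin m ↪ Fin N, BothOpen x w w' (φ ∘ β) := by
      intro φ
      obtain ⟨σ, hσ⟩ := Equiv.Perm.exists_extending_pair φ₀ φ φ₀.injective φ.injective
      have : (φ : Fin m → Fin N) = σ ∘ φ₀ := funext fun i => (hσ i).symm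
      rw [this, Function.comp_assoc]
      exact h₀.relabel σ
    obtain ⟨v, hv⟩ := h₀.exists_not_isSeparating φ₀.injective
    have hl := h₀.walkEnd_eq φ₀.injective
    have := norm_sum_integral_sideProd_le hA hB hind hperm ha hb hAa hBb hai hbi hQ
      (by omega : 2 * m ≤ N) (by simp [pairedWalk, pairs, two_mul]) hl
      (exists_mem_walkSteps_pairedWalk hβ) hv
    refine le_trans (le_of_eq ?_) this
    congr 1
    refine Finset.sum_congr rfl fun φ _ => ?_
    congr 1
    funext ω
    rw [if_pos (hall φ), walkSteps_pairedWalk_map, sideProd_map, sideProd_map,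
      sideProd_a_eq (A ω) (B ω), sideProd_b_eq (A ω) (B ω)]
  · push Not at hex
    simp only [hex, if_false, integral_zero, Finset.sum_const_zero, norm_zero]
    positivity

include hperm in
/-- The mean square error of the `n`-th diagonal moments, summed over the diagonal. -/
theorem integral_sum_momentError_le {Q : ℝ} (hn : 2 * (2 * n + 1) ≤ N)
    (hQ : ∀ e e', e + e' = 2 * n → (∫ ω, a ω ^ e ∂μ) * ∫ ω, b ω ^ e' ∂μ ≤ Q) (x : Fin N) :
    Integrable (fun ω => ∑ i, ‖momentError x (A ω) (B ω) n i‖ ^ 2) μ ∧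
    ∫ ω, ∑ i, ‖momentError x (A ω) (B ω) n i‖ ^ 2 ∂μ ≤
      4 ^ n * (∑ m ∈ Finset.range (2 * n + 2),
        (m.factorial : ℝ)⁻¹ * (m ^ (2 * n + 1) * (m ^ (2 * m) * 2 ^ m))) * Q := by
  classical
  set F : (Fin n → Side) → (Fin n → Side) → (Option (Fin n ⊕ Fin n) → Fin N) → Ω → ℂ :=
    fun w w' J ω => if BothOpen x w w' J then
          sideProd Prod.fst (pairMat (A ω) (B ω)) Side.a (pairedSteps w w') J *
            sideProd Prod.fst (pairMat (A ω) (B ω)) Side.b (pairedSteps w w') J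
        else 0 with hF
  have hint : ∀ w w' J, Integrable (F w w' J) μ := by
    intro w w' J
    simp only [hF]
    split_ifs
    · have := (integrable_sideProd_mul_sideProd hA hB hind ha hb hAa hBb hai hbi
        (pairedSteps w w') (length_pairedSteps w w') J).1
      refine this.congr (Eventually.of_forall fun ω => ?_)
      simp only
      rw [sideProd_a_eq (A ω) (B ω), sideProd_b_eq (A ω) (B ω)]
    · exact integrable_zero _ _ _
  have heq : (fun ω => ((∑ i, ‖momentError x (A ω) (B ω) n i‖ ^ 2 : ℝ) : ℂ)) =
      fun ω => ∑ w, ∑ w', ∑ J, F w w' J ω := by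
    funext ω
    rw [sum_norm_momentError_sq]
  have hI : Integrable (fun ω => ∑ w, ∑ w', ∑ J, F w w' J ω) μ :=
    integrable_finsetSum _ fun w _ => integrable_finsetSum _ fun w' _ =>
      integrable_finsetSum _ fun J _ => hint w w' J
  have hQ0 : 0 ≤ Q := le_trans (mul_nonneg (integral_nonneg fun ω => by have := ha ω; positivity)
    (integral_nonneg fun ω => by have := hb ω; positivity)) (hQ 0 (2 * n) (by omega))
  refine ⟨?_, ?_⟩
  · have := (heq ▸ hI).re
    simpa only [RCLike.re_eq_complex_re, Complex.ofReal_re] using this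
  -- The two walks have 2n + 1 positions including the common start, hence at most m^(2n+1) patterns
  -- onto m vertices.
  have hpat : ∀ w w', ‖∑ J, ∫ ω, F w w' J ω ∂μ‖ ≤ ∑ m ∈ Finset.range (2 * n + 2),
        (m.factorial : ℝ)⁻¹ * (m ^ (2 * n + 1) * (m ^ (2 * m) * 2 ^ m * Q)) := by
    intro w w'
    rw [sum_eq_sum_patterns]
    have hc : Fintype.card (Option (Fin n ⊕ Fin n)) + 1 = 2 * n + 2 := by simp; omega
    rw [hc]
    refine (norm_sum_le _ _).trans (Finset.sum_le_sum fun m _ => ?_)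
    rw [norm_mul, norm_inv, Complex.norm_natCast]
    gcongr
    have hb1 : ∀ β : Option (Fin n ⊕ Fin n) → Fin m, ‖if Function.Surjective β then
        ∑ φ : Fin m ↪ Fin N, ∫ ω, F w w' (φ ∘ β) ω ∂μ else 0‖ ≤
          (m : ℝ) ^ (2 * m) * 2 ^ m * Q := by
      intro β
      split_ifs with h
      · exact norm_sum_integral_bothOpen_le hA hB hind hperm ha hb hAa hBb hai hbi hn hQ x w w' h
      · rw [norm_zero]; positivity
    refine (norm_sum_le _ _).trans ((Finset.sum_le_sum fun β _ => hb1 β).trans_eq ?_)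
    have hc' : Fintype.card (Option (Fin n ⊕ Fin n)) = 2 * n + 1 := by simp; omega
    simp [hc', -Fintype.card_option]
  have hval : ((∫ ω, ∑ i, ‖momentError x (A ω) (B ω) n i‖ ^ 2 ∂μ : ℝ) : ℂ) =
      ∑ w, ∑ w', ∑ J, ∫ ω, F w w' J ω ∂μ := by
    rw [← integral_complex_ofReal, heq, integral_finsetSum _ fun w _ => integrable_finsetSum _
      fun w' _ => integrable_finsetSum _ fun J _ => hint w w' J]
    refine Finset.sum_congr rfl fun w _ => ?_
    rw [integral_finsetSum _ fun w' _ => integrable_finsetSum _ fun J _ => hint w w' J]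
    refine Finset.sum_congr rfl fun w' _ => ?_
    rw [integral_finsetSum _ fun J _ => hint w w' J]
  refine (le_abs_self _).trans ?_
  rw [← Real.norm_eq_abs, ← Complex.norm_real, hval]
  refine (norm_sum_le _ _).trans ((Finset.sum_le_sum fun w _ => (norm_sum_le _ _).trans
    (Finset.sum_le_sum fun w' _ => hpat w w')).trans (le_of_eq ?_))
  simp only [Finset.sum_const, Finset.card_univ, Fintype.card_fun, Side.card, Fintype.card_fin,
    nsmul_eq_mul, Finset.mul_sum, Finset.sum_mul]
  refine Finset.sum_congr rfl fun m _ => ?_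
  have : (4 : ℝ) = 2 * 2 := by norm_num
  rw [this, mul_pow]
  push_cast
  ring

end Expectation

end DiagFreeSum

namespace DiagFreeSum

/-! ### Resolvents of self-adjoint operators -/

section Resolvent

variable {E : Type*} [NormedAddCommGroup E] [InnerProductSpace ℂ E] [CompleteSpace E]

theorem isUnit_sub_of_isSelfAdjoint {T : E →L[ℂ] E} (hT : IsSelfAdjoint T) {z : ℂ}
    (hz : 0 < z.im) : IsUnit (algebraMap ℂ (E →L[ℂ] E) z - T) := by
  by_contra h
  have h1 : z ∈ spectrum ℂ T := h
  have h2 := congrArg Complex.im (hT.mem_spectrum_eq_re h1)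
  simp at h2
  exact hz.ne' h2

theorem inner_apply_eq_of_isSelfAdjoint {T : E →L[ℂ] E} (hT : IsSelfAdjoint T) (f g : E) :
    inner ℂ (T f) g = inner ℂ f (T g) := by
  have := ContinuousLinearMap.adjoint_inner_left T g f
  rwa [hT.adjoint_eq] at this

/-- For self-adjoint `T` the imaginary part of ⟨g, (z - T)g⟩ is Im z ‖g‖²; Cauchy–Schwarz does the
rest. -/
theorem im_mul_norm_le {T : E →L[ℂ] E} (hT : IsSelfAdjoint T) (z : ℂ) (g : E) :
    z.im * ‖g‖ ≤ ‖(algebraMap ℂ (E →L[ℂ] E) z - T) g‖ := by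
  rcases eq_or_ne g 0 with rfl | hg
  · simp
  have h0 : 0 < ‖g‖ := norm_pos_iff.2 hg
  have him : (inner ℂ g (T g)).im = 0 := by
    have h1 := inner_apply_eq_of_isSelfAdjoint hT g g
    have h2 := inner_conj_symm (𝕜 := ℂ) g (T g)
    rw [h1] at h2
    exact Complex.conj_eq_iff_im.1 h2
  have h1 : (inner ℂ g ((algebraMap ℂ (E →L[ℂ] E) z - T) g)).im = z.im * ‖g‖ ^ 2 := by
    rw [sub_apply, inner_sub_right, Complex.sub_im, him,
      ContinuousLinearMap.algebraMap_apply, inner_smul_right, inner_self_eq_norm_sq_to_K]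
    norm_cast
    rw [Complex.mul_im]
    change z.re * ((‖g‖ ^ 2 : ℝ) : ℂ).im + z.im * ((‖g‖ ^ 2 : ℝ) : ℂ).re - 0 = _
    rw [Complex.ofReal_re, Complex.ofReal_im]
    ring
  have h2 := (Complex.abs_im_le_norm _).trans
    (norm_inner_le_norm (𝕜 := ℂ) g ((algebraMap ℂ (E →L[ℂ] E) z - T) g))
  rw [h1] at h2
  have h3 := (le_abs_self _).trans h2
  refine le_of_mul_le_mul_left (le_trans (le_of_eq ?_) h3) h0
  ring

theorem norm_resolvent_apply_le {T : E →L[ℂ] E} (hT : IsSelfAdjoint T) {z : ℂ}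
    (hz : 0 < z.im) (g : E) : ‖resolvent T z g‖ ≤ ‖g‖ / z.im := by
  rw [le_div_iff₀ hz, mul_comm]
  refine (im_mul_norm_le hT z _).trans (le_of_eq ?_)
  rw [← mul_apply_eq_comp, resolvent,
    Ring.mul_inverse_cancel _ (isUnit_sub_of_isSelfAdjoint hT hz)]
  rfl

theorem resolvent_eq_sum_add {T : E →L[ℂ] E} (hT : IsSelfAdjoint T) {z : ℂ}
    (hz : 0 < z.im) (n : ℕ) : resolvent T z =
      ∑ k ∈ Finset.range n, (z ^ (k + 1))⁻¹ • T ^ k + (z ^ n)⁻¹ • (T ^ n * resolvent T z) := by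
  have hz0 : z ≠ 0 := by rintro rfl; simp at hz
  have h1 : T * resolvent T z = z • resolvent T z - 1 := by
    have := Ring.mul_inverse_cancel _ (isUnit_sub_of_isSelfAdjoint hT hz)
    rw [sub_mul, sub_eq_iff_eq_add, Algebra.algebraMap_eq_smul_one, smul_mul_assoc, one_mul] at this
    rw [resolvent, Algebra.algebraMap_eq_smul_one, this]
    abel
  induction n with
  | zero => simp
  | succ n ih =>
    rw [Finset.sum_range_succ, pow_succ T, mul_assoc, h1, mul_sub, mul_one, mul_smul_comm,
      smul_sub, smul_smul]
    nth_rewrite 1 [ih]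
    have : (z ^ (n + 1))⁻¹ * z = (z ^ n)⁻¹ := by rw [pow_succ]; field_simp
    rw [this]
    abel

/-- At an even order the power in the remainder can be shared between both sides of the inner
product, leaving the resolvent between two copies of T^p ξ. The resolvent bound 1/Im z then gives
‖T^p ξ‖² / Im z, and ‖T^p ξ‖² is itself the moment of order 2p. -/
theorem norm_inner_resolvent_sub_le {T : E →L[ℂ] E} (hT : IsSelfAdjoint T) {z : ℂ}
    (hz : 0 < z.im) (p : ℕ) (ξ : E) :
    ‖inner ℂ ξ (resolvent T z ξ) -
        ∑ k ∈ Finset.range (p + p), inner ℂ ξ ((T ^ k) ξ) / z ^ (k + 1)‖ ≤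
      (inner ℂ ξ ((T ^ (p + p)) ξ)).re / (‖z‖ ^ (p + p) * z.im) := by
  have hz0 : z ≠ 0 := by rintro rfl; simp at hz
  have hTp : IsSelfAdjoint (T ^ p) := hT.pow p
  have hcomm : Commute (T ^ p) (resolvent T z) := by
    refine Commute.pow_left ?_ p
    obtain ⟨u, hu⟩ := isUnit_sub_of_isSelfAdjoint hT hz
    rw [resolvent, ← hu, Ring.inverse_unit]
    refine Commute.units_inv_right ?_
    rw [hu]
    exact Commute.sub_right (Algebra.commutes z T).symm (Commute.refl T)
  have h1 := congrArg (fun R : E →L[ℂ] E => inner ℂ ξ (R ξ)) (resolvent_eq_sum_add hT hz (p + p))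
  simp only [add_apply, sum_apply, smul_apply,
    inner_add_right, inner_sum, inner_smul_right] at h1
  have h2 : inner ℂ ξ (resolvent T z ξ) -
      ∑ k ∈ Finset.range (p + p), inner ℂ ξ ((T ^ k) ξ) / z ^ (k + 1) =
      (z ^ (p + p))⁻¹ * inner ℂ ((T ^ p) ξ) (resolvent T z ((T ^ p) ξ)) := by
    rw [inner_apply_eq_of_isSelfAdjoint hTp, h1]
    have : (T ^ p) (resolvent T z ((T ^ p) ξ)) = (T ^ (p + p) * resolvent T z) ξ := by
      rw [pow_add, mul_assoc, hcomm.eq]; rfl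
    rw [this]
    simp only [div_eq_inv_mul]
    ring
  have h3 : (inner ℂ ξ ((T ^ (p + p)) ξ)).re = ‖(T ^ p) ξ‖ ^ 2 := by
    rw [pow_add, mul_apply_eq_comp, ← inner_apply_eq_of_isSelfAdjoint hTp]
    exact inner_self_eq_norm_sq (𝕜 := ℂ) _
  rw [h2, h3, norm_mul, norm_inv, norm_pow]
  have h4 := (norm_inner_le_norm (𝕜 := ℂ) ((T ^ p) ξ) (resolvent T z ((T ^ p) ξ))).trans
    (mul_le_mul_of_nonneg_left (norm_resolvent_apply_le hT hz ((T ^ p) ξ)) (norm_nonneg _))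
  have hzp : 0 < ‖z‖ ^ (p + p) := by positivity
  calc _ ≤ (‖z‖ ^ (p + p))⁻¹ * (‖(T ^ p) ξ‖ * (‖(T ^ p) ξ‖ / z.im)) := by gcongr
    _ = _ := by field_simp

theorem norm_inner_resolvent_le {T : E →L[ℂ] E} (hT : IsSelfAdjoint T) {z : ℂ}
    (hz : 0 < z.im) (ξ : E) : ‖inner ℂ ξ (resolvent T z ξ)‖ ≤ ‖ξ‖ ^ 2 / z.im := by
  refine (norm_inner_le_norm _ _).trans ((mul_le_mul_of_nonneg_left
    (norm_resolvent_apply_le hT hz ξ) (norm_nonneg _)).trans_eq ?_)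
  ring

end Resolvent

/-! ### Measurability of the resolvent entries -/

section Measurability

variable {E : Type*} [NormedAddCommGroup E] [InnerProductSpace ℂ E] [CompleteSpace E] {N : ℕ}

instance matrixBorelSpace (N : ℕ) : BorelSpace (Matrix (Fin N) (Fin N) ℂ) :=
  inferInstanceAs (BorelSpace (Fin N → Fin N → ℂ))

instance matrixSecondCountable (N : ℕ) : SecondCountableTopology (Matrix (Fin N) (Fin N) ℂ) :=
  inferInstanceAs (SecondCountableTopology (Fin N → Fin N → ℂ))

theorem measurable_inner_resolvent {Ω : Type*} [MeasurableSpace Ω]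
    {A B : Ω → Matrix (Fin N) (Fin N) ℂ} (hA : Measurable A) (hB : Measurable B)
    (hAh : ∀ ω, (A ω).IsHermitian) (hBh : ∀ ω, (B ω).IsHermitian)
    (L L' : Matrix (Fin N) (Fin N) ℂ →ₗ[ℂ] (E →L[ℂ] E))
    (hL : ∀ X, X.IsHermitian → IsSelfAdjoint (L X))
    (hL' : ∀ X, X.IsHermitian → IsSelfAdjoint (L' X)) {z : ℂ} (hz : 0 < z.im) (ξ : E) :
    Measurable fun ω => inner ℂ ξ (resolvent (L (A ω) + L' (B ω)) z ξ) := by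
  -- Passing to Hermitian parts gives a map that is continuous on all pairs of matrices, the inverse
  -- being taken only where it exists. It agrees with the resolvent on the Hermitian matrices at
  -- hand.
  let S : Matrix (Fin N) (Fin N) ℂ → Matrix (Fin N) (Fin N) ℂ := fun X => (2⁻¹ : ℂ) • (X + Xᴴ)
  have hS : ∀ X, (S X).IsHermitian := by
    intro X
    simp only [S, Matrix.IsHermitian, Matrix.conjTranspose_smul, Matrix.conjTranspose_add,
      Matrix.conjTranspose_conjTranspose]
    rw [add_comm]
    simp
  have hS' : ∀ X, X.IsHermitian → S X = X := by
    intro X hX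
    simp only [S, hX.eq, ← two_smul ℂ X, smul_smul]
    norm_num
  have hSc : Continuous S := by fun_prop
  have hLc := L.continuous_of_finiteDimensional
  have hLc' := L'.continuous_of_finiteDimensional
  have hF : Continuous fun q : Matrix (Fin N) (Fin N) ℂ × Matrix (Fin N) (Fin N) ℂ =>
      inner ℂ ξ (resolvent (L (S q.1) + L' (S q.2)) z ξ) := by
    have h1 : Continuous fun q : Matrix (Fin N) (Fin N) ℂ × Matrix (Fin N) (Fin N) ℂ =>
        resolvent (L (S q.1) + L' (S q.2)) z := by
      rw [continuous_iff_continuousAt]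
      intro q
      have hu := isUnit_sub_of_isSelfAdjoint ((hL _ (hS q.1)).add (hL' _ (hS q.2))) hz
      obtain ⟨u, hu⟩ := hu
      have h2 := NormedRing.inverse_continuousAt u
      rw [hu] at h2
      refine ContinuousAt.comp (f := fun q : Matrix (Fin N) (Fin N) ℂ × Matrix (Fin N) (Fin N) ℂ =>
        algebraMap ℂ (E →L[ℂ] E) z - (L (S q.1) + L' (S q.2))) h2 ?_
      exact (continuous_const.sub ((hLc.comp (hSc.comp continuous_fst)).add
        (hLc'.comp (hSc.comp continuous_snd)))).continuousAt
    exact continuous_const.inner (h1.clm_apply continuous_const)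
  convert hF.measurable.comp (hA.prodMk hB) using 1
  funext ω
  simp only [Function.comp_apply, hS' _ (hAh ω), hS' _ (hBh ω)]

end Measurability

/-! ### The error of the Cauchy transforms in terms of moments -/

section FreeSum

variable {N : ℕ} {x : Fin N}

theorem isSelfAdjoint_compOp (s : Side) {X : Matrix (Fin N) (Fin N) ℂ} (hX : X.IsHermitian) :
    IsSelfAdjoint (compOp (x := x) s X) := by
  rw [ContinuousLinearMap.isSelfAdjoint_iff']
  set T : H x →L[ℂ] H x := compOp s X with hT
  have h1 : ∀ v, ContinuousLinearMap.adjoint T (delta v) = T (delta v) := by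
    intro v
    ext w
    rw [← inner_delta_left w, ← inner_delta_left w, ContinuousLinearMap.adjoint_inner_right,
      ← inner_conj_symm, hT, inner_delta_compOp_delta, inner_delta_compOp_delta, eq_comm]
    split_ifs with h h' h'
    · rw [starRingEnd_apply, ← Matrix.conjTranspose_apply, hX.eq]
    · exact absurd h.symm h'
    · exact absurd h'.symm h
    · simp
  ext f v
  rw [← inner_delta_left v, ← inner_delta_left v, ContinuousLinearMap.adjoint_inner_right, ← h1,
    ContinuousLinearMap.adjoint_inner_left]

/-- `compOp` as a linear map of the matrix. -/
noncomputable def compOpLinear (x : Fin N) (s : Side) :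
    Matrix (Fin N) (Fin N) ℂ →ₗ[ℂ] (H x →L[ℂ] H x) where
  toFun X := compOp s X
  map_add' X Y := by
    ext f v
    simp [compOp_apply, add_mul, Finset.sum_add_distrib]
  map_smul' c X := by
    ext f v
    simp [compOp_apply, mul_assoc, Finset.mul_sum]

theorem isSelfAdjoint_freeSum {A B : Matrix (Fin N) (Fin N) ℂ} (hA : A.IsHermitian)
    (hB : B.IsHermitian) : IsSelfAdjoint (freeSum x A B) :=
  (isSelfAdjoint_compOp _ hA).add (isSelfAdjoint_compOp _ hB)

theorem norm_delta (v : Vertex x) : ‖delta v‖ = 1 := by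
  rw [delta, lp.norm_single (by norm_num)]; simp

/-- A matrix as an operator on Euclidean space. -/
noncomputable abbrev euclOp (X : Matrix (Fin N) (Fin N) ℂ) :
    EuclideanSpace ℂ (Fin N) →L[ℂ] EuclideanSpace ℂ (Fin N) :=
  Matrix.toEuclideanCLM (𝕜 := ℂ) X

theorem isSelfAdjoint_euclOp {X : Matrix (Fin N) (Fin N) ℂ} (hX : X.IsHermitian) :
    IsSelfAdjoint (euclOp X) := by
  rw [isSelfAdjoint_iff, euclOp, ← map_star, Matrix.star_eq_conjTranspose, hX.eq]

theorem inner_euclOp (X : Matrix (Fin N) (Fin N) ℂ) (i : Fin N) :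
    inner ℂ (EuclideanSpace.single i (1 : ℂ)) (euclOp X (EuclideanSpace.single i 1)) = X i i := by
  rw [EuclideanSpace.inner_single_left]
  simp [euclOp]

/-- This places A + B in the same Hilbert space setting as a + b, so that the same expansion serves
both. -/
theorem resolvent_apply_eq {X : Matrix (Fin N) (Fin N) ℂ} (hX : X.IsHermitian) {z : ℂ}
    (hz : 0 < z.im) (i : Fin N) : resolvent X z i i =
      inner ℂ (EuclideanSpace.single i (1 : ℂ))
        (resolvent (euclOp X) z (EuclideanSpace.single i 1)) := by
  rw [← inner_euclOp (resolvent X z) i]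
  congr 2
  have h1 := isUnit_sub_of_isSelfAdjoint (isSelfAdjoint_euclOp hX) hz
  have h2 : euclOp (algebraMap ℂ _ z - X) = algebraMap ℂ _ z - euclOp X := by
    rw [euclOp, map_sub, AlgHomClass.commutes]
  have h3 : IsUnit (algebraMap ℂ (Matrix (Fin N) (Fin N) ℂ) z - X) := by
    rw [← h2] at h1
    exact (MulEquiv.isUnit_map (Matrix.toEuclideanCLM (𝕜 := ℂ) (n := Fin N))).1 h1
  rw [resolvent, resolvent]
  have h4 : euclOp (Ring.inverse (algebraMap ℂ _ z - X)) * (algebraMap ℂ _ z - euclOp X) = 1 := by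
    rw [← h2, euclOp, euclOp, ← map_mul, Ring.inverse_mul_cancel _ h3, map_one]
  calc euclOp (Ring.inverse (algebraMap ℂ _ z - X)) = euclOp (Ring.inverse (algebraMap ℂ _ z - X)) *
        ((algebraMap ℂ _ z - euclOp X) * Ring.inverse (algebraMap ℂ _ z - euclOp X)) := by
        rw [Ring.mul_inverse_cancel _ h1, mul_one]
    _ = _ := by rw [← mul_assoc, h4, one_mul]

theorem frobSq_eq_sum (X : Matrix (Fin N) (Fin N) ℂ) : frobSq X = ∑ i, ∑ j, ‖X i j‖ ^ 2 := by
  simp only [frobSq, Matrix.trace, Matrix.diag, Matrix.mul_apply, Matrix.conjTranspose_apply,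
    Complex.re_sum]
  refine Finset.sum_congr rfl fun i _ => Finset.sum_congr rfl fun j _ => ?_
  rw [Complex.star_def, Complex.mul_conj, Complex.normSq_eq_norm_sq, Complex.ofReal_re]

/-- The difference of the `i`-th diagonal entries of the Cauchy transforms. -/
noncomputable def cauchyError (x : Fin N) (A B : Matrix (Fin N) (Fin N) ℂ) (z : ℂ)
    (i : Fin N) : ℂ :=
  inner ℂ (delta (diagVertex x i)) (resolvent (freeSum x A B) z (delta (diagVertex x i))) -
    resolvent (A + B) z i i

theorem frobSq_cauchy_sub (x : Fin N) (A B : Matrix (Fin N) (Fin N) ℂ) (z : ℂ) :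
    frobSq (cauchyFreeSum x A B z - cauchySum A B z) = ∑ i, ‖cauchyError x A B z i‖ ^ 2 := by
  rw [frobSq_eq_sum]
  refine Finset.sum_congr rfl fun i _ => ?_
  rw [Finset.sum_eq_single i]
  · simp [cauchyFreeSum, cauchySum, diagExp, cauchyError]
  · intro j _ hj
    simp [cauchyFreeSum, cauchySum, diagExp, hj.symm]
  · simp

theorem norm_cauchyError_le {A B : Matrix (Fin N) (Fin N) ℂ} (hA : A.IsHermitian)
    (hB : B.IsHermitian) {z : ℂ} (hz : 0 < z.im) (i : Fin N) :
    ‖cauchyError x A B z i‖ ≤ 2 / z.im := by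
  have h1 := norm_inner_resolvent_le (isSelfAdjoint_freeSum (x := x) hA hB) hz
    (delta (diagVertex x i))
  have h2 := norm_inner_resolvent_le (isSelfAdjoint_euclOp (hA.add hB)) hz
    (EuclideanSpace.single i (1 : ℂ))
  rw [← resolvent_apply_eq (hA.add hB) hz] at h2
  rw [norm_delta, one_pow] at h1
  rw [PiLp.norm_single, norm_one, one_pow] at h2
  refine (norm_sub_le _ _).trans ((add_le_add h1 h2).trans_eq ?_)
  ring

theorem measurable_cauchyError {Ω : Type*} [MeasurableSpace Ω]
    {A B : Ω → Matrix (Fin N) (Fin N) ℂ} (hA : Measurable A) (hB : Measurable B)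
    (hAh : ∀ ω, (A ω).IsHermitian) (hBh : ∀ ω, (B ω).IsHermitian) (x : Fin N) {z : ℂ}
    (hz : 0 < z.im) (i : Fin N) : Measurable fun ω => cauchyError x (A ω) (B ω) z i := by
  refine Measurable.sub ?_ ?_
  · exact measurable_inner_resolvent hA hB hAh hBh (compOpLinear x Side.a) (compOpLinear x Side.b)
      (fun X hX => isSelfAdjoint_compOp _ hX) (fun X hX => isSelfAdjoint_compOp _ hX) hz _
  · have := measurable_inner_resolvent hA hB hAh hBh
      (Matrix.toEuclideanCLM (𝕜 := ℂ) (n := Fin N)).toAlgEquiv.toLinearMap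
      (Matrix.toEuclideanCLM (𝕜 := ℂ) (n := Fin N)).toAlgEquiv.toLinearMap
      (fun X hX => isSelfAdjoint_euclOp hX) (fun X hX => isSelfAdjoint_euclOp hX) hz
      (EuclideanSpace.single i 1)
    convert this using 1
    funext ω
    rw [resolvent_apply_eq ((hAh ω).add (hBh ω)) hz, euclOp, map_add]
    rfl

/-- The error of the Cauchy transforms in terms of the errors of the moments. -/
theorem norm_cauchyError_le_sum {A B : Matrix (Fin N) (Fin N) ℂ} (hA : A.IsHermitian)
    (hB : B.IsHermitian) {z : ℂ} (hz : 0 < z.im) (p : ℕ) (i : Fin N) :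
    ‖cauchyError x A B z i‖ ≤
      ∑ k ∈ Finset.range (p + p), ‖momentError x A B k i‖ / ‖z‖ ^ (k + 1) +
      (2 * ‖((A + B) ^ (p + p)) i i‖ + ‖momentError x A B (p + p) i‖) /
        (‖z‖ ^ (p + p) * z.im) := by
  have hz0 : z ≠ 0 := by rintro rfl; simp at hz
  have h1 := norm_inner_resolvent_sub_le (isSelfAdjoint_freeSum (x := x) hA hB) hz p
    (delta (diagVertex x i))
  have h2 := norm_inner_resolvent_sub_le (isSelfAdjoint_euclOp (hA.add hB)) hz p
    (EuclideanSpace.single i (1 : ℂ))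
  simp only [euclOp, ← map_pow] at h2
  simp only [← euclOp.eq_1] at h2
  simp only [inner_euclOp] at h2
  rw [← resolvent_apply_eq (hA.add hB) hz] at h2
  set F : ℕ → ℂ := fun k => inner ℂ (delta (diagVertex x i))
    ((freeSum x A B ^ k) (delta (diagVertex x i))) with hF
  set S : ℕ → ℂ := fun k => ((A + B) ^ k) i i with hS
  have hm : ∀ k, momentError x A B k i = S k - F k := fun k => rfl
  have h3 : cauchyError x A B z i =
      (inner ℂ (delta (diagVertex x i)) (resolvent (freeSum x A B) z (delta (diagVertex x i))) -
        ∑ k ∈ Finset.range (p + p), F k / z ^ (k + 1)) -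
      (resolvent (A + B) z i i - ∑ k ∈ Finset.range (p + p), S k / z ^ (k + 1)) -
      ∑ k ∈ Finset.range (p + p), momentError x A B k i / z ^ (k + 1) := by
    simp only [hm, sub_div, Finset.sum_sub_distrib, cauchyError]
    ring
  have h4 : ‖∑ k ∈ Finset.range (p + p), momentError x A B k i / z ^ (k + 1)‖ ≤
      ∑ k ∈ Finset.range (p + p), ‖momentError x A B k i‖ / ‖z‖ ^ (k + 1) := by
    refine (norm_sum_le _ _).trans_eq ?_
    simp
  -- The free-sum remainder is traded for a moment of A + B plus one more moment error, so no
  -- separate bound on the free sum is needed.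
  have h5 : (F (p + p)).re ≤ ‖S (p + p)‖ + ‖momentError x A B (p + p) i‖ := by
    have : F (p + p) = S (p + p) - momentError x A B (p + p) i := by rw [hm]; ring
    rw [this]
    exact (Complex.re_le_norm _).trans (norm_sub_le _ _)
  have h6 : (S (p + p)).re ≤ ‖S (p + p)‖ := Complex.re_le_norm _
  have hzp : 0 < ‖z‖ ^ (p + p) * z.im := by positivity
  rw [h3]
  refine (norm_sub_le _ _).trans ?_
  rw [add_comm]
  refine add_le_add h4 ((norm_sub_le _ _).trans ((add_le_add h1 h2).trans ?_))
  rw [← add_div]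
  refine div_le_div_of_nonneg_right ?_ hzp.le
  change (F (p + p)).re + (S (p + p)).re ≤ _
  linarith

end FreeSum

end DiagFreeSum

namespace DiagFreeSum

/-! ### Trace inequalities for Hermitian matrices -/

section Traces

variable {N : ℕ}

theorem exists_diagonalization {X : Matrix (Fin N) (Fin N) ℂ} (hX : X.IsHermitian) :
    ∃ (U : Matrix (Fin N) (Fin N) ℂ) (d : Fin N → ℝ), U * Uᴴ = 1 ∧ Uᴴ * U = 1 ∧
      X = U * Matrix.diagonal (fun j => (d j : ℂ)) * Uᴴ := by
  refine ⟨hX.eigenvectorUnitary, hX.eigenvalues, ?_, ?_, ?_⟩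
  · exact Unitary.coe_mul_star_self _
  · exact Unitary.coe_star_mul_self _
  · have := hX.spectral_theorem
    rwa [Unitary.conjStarAlgAut_apply] at this

variable {U : Matrix (Fin N) (Fin N) ℂ}

theorem pow_conj_diagonal (hU : Uᴴ * U = 1) (d : Fin N → ℝ) (k : ℕ) (hU' : U * Uᴴ = 1) :
    (U * Matrix.diagonal (fun j => (d j : ℂ)) * Uᴴ) ^ k =
      U * Matrix.diagonal (fun j => ((d j ^ k : ℝ) : ℂ)) * Uᴴ := by
  induction k with
  | zero => simp [hU']
  | succ k ih =>
    have : ∀ D D' : Matrix (Fin N) (Fin N) ℂ,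
        U * D * Uᴴ * (U * D' * Uᴴ) = U * (D * (Uᴴ * U) * D') * Uᴴ := by
      intro D D'; simp only [Matrix.mul_assoc]
    rw [pow_succ, ih, this, hU, Matrix.mul_one, Matrix.diagonal_mul_diagonal]
    simp [pow_succ]

theorem frobSq_conj_diagonal (hU : Uᴴ * U = 1) (d : Fin N → ℝ) :
    frobSq (U * Matrix.diagonal (fun j => (d j : ℂ)) * Uᴴ) = ∑ j, d j ^ 2 := by
  set D := Matrix.diagonal (fun j => (d j : ℂ)) with hD
  have h1 : Dᴴ = D := by simp [hD, Matrix.diagonal_conjTranspose, Pi.star_def]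
  have h2 : U * D * Uᴴ * (U * D * Uᴴ)ᴴ = U * (D * (Uᴴ * U) * D * Uᴴ) := by
    simp only [Matrix.conjTranspose_mul, Matrix.conjTranspose_conjTranspose, h1, Matrix.mul_assoc]
  rw [frobSq, h2, Matrix.trace_mul_comm, Matrix.mul_assoc, hU, Matrix.mul_one, Matrix.mul_one, hD,
    Matrix.diagonal_mul_diagonal, Matrix.trace_diagonal, Complex.re_sum]
  refine Finset.sum_congr rfl fun j _ => ?_
  rw [← Complex.ofReal_mul, Complex.ofReal_re, sq]

theorem conj_diagonal_apply_self (Y : Matrix (Fin N) (Fin N) ℂ) (d : Fin N → ℝ) (i : Fin N) :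
    (Y * Matrix.diagonal (fun j => (d j : ℂ)) * Yᴴ) i i =
      ((∑ j, ‖Y i j‖ ^ 2 * d j : ℝ) : ℂ) := by
  rw [Matrix.mul_apply]
  simp only [Matrix.mul_diagonal, Matrix.conjTranspose_apply, Complex.star_def]
  push_cast
  refine Finset.sum_congr rfl fun j _ => ?_
  rw [mul_right_comm, Complex.mul_conj, Complex.normSq_eq_norm_sq]
  push_cast
  ring

theorem sum_norm_sq_row (hU : U * Uᴴ = 1) (i : Fin N) : ∑ j, ‖U i j‖ ^ 2 = 1 := by
  have h1 := conj_diagonal_apply_self U (fun _ => 1) i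
  simp only [Complex.ofReal_one, Matrix.diagonal_one, hU, Matrix.one_apply_eq,
    mul_one] at h1
  exact_mod_cast h1.symm

theorem sum_norm_sq_col (hU : Uᴴ * U = 1) (j : Fin N) : ∑ i, ‖U i j‖ ^ 2 = 1 := by
  have := sum_norm_sq_row (U := Uᴴ) (by simpa using hU) j
  simpa [Matrix.conjTranspose_apply] using this

theorem sum_norm_sq_mulVec (hU : Uᴴ * U = 1) (f : Fin N → ℂ) :
    ∑ i, ‖(U *ᵥ f) i‖ ^ 2 = ∑ i, ‖f i‖ ^ 2 := by
  have h1 : ∀ g : Fin N → ℂ, star g ⬝ᵥ g = ((∑ i, ‖g i‖ ^ 2 : ℝ) : ℂ) := by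
    intro g
    simp only [dotProduct, Pi.star_apply, Complex.star_def, Complex.conj_mul']
    push_cast
    rfl
  have h2 : star (U *ᵥ f) ⬝ᵥ (U *ᵥ f) = star f ⬝ᵥ f := by
    rw [Matrix.star_mulVec, Matrix.dotProduct_mulVec, Matrix.vecMul_vecMul, hU, Matrix.vecMul_one]
  rw [h1, h1] at h2
  exact_mod_cast h2

/-- In the eigenbasis the form is diagonal with coefficients at most 1. The form is bilinear rather
than sesquilinear, so `g` is rotated by the transpose of `U` and `f` by its adjoint. -/
theorem isContraction_smul_of_abs_le (hU : U * Uᴴ = 1) {d : Fin N → ℝ}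
    {a : ℝ} (ha : 0 < a) (hd : ∀ j, |d j| ≤ a) :
    IsContraction (((a⁻¹ : ℝ) : ℂ) • (U * Matrix.diagonal (fun j => (d j : ℂ)) * Uᴴ)) := by
  intro g f
  set D := Matrix.diagonal (fun j => (d j : ℂ)) with hD
  have h1 : ∑ i, ∑ j, g i * (((a⁻¹ : ℝ) : ℂ) • (U * D * Uᴴ)) i j * f j =
      ∑ k, ((a⁻¹ * d k : ℝ) : ℂ) * ((Uᵀ *ᵥ g) k * (Uᴴ *ᵥ f) k) := by
    have e : ∑ i, ∑ j, g i * (((a⁻¹ : ℝ) : ℂ) • (U * D * Uᴴ)) i j * f j =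
        ((a⁻¹ : ℝ) : ℂ) * (g ⬝ᵥ ((U * D * Uᴴ) *ᵥ f)) := by
      simp only [dotProduct, Matrix.mulVec, Finset.mul_sum, Matrix.smul_apply, smul_eq_mul]
      refine Finset.sum_congr rfl fun i _ => Finset.sum_congr rfl fun j _ => ?_
      ring
    rw [e, ← Matrix.mulVec_mulVec, ← Matrix.mulVec_mulVec, Matrix.dotProduct_mulVec,
      ← Matrix.mulVec_transpose, dotProduct, Finset.mul_sum]
    refine Finset.sum_congr rfl fun k _ => ?_
    rw [hD, Matrix.mulVec_diagonal]
    push_cast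
    ring
  have hUt : (Uᵀ)ᴴ * Uᵀ = 1 := by
    have : (Uᵀ)ᴴ = (Uᴴ)ᵀ := rfl
    rw [this, ← Matrix.transpose_mul, hU, Matrix.transpose_one]
  have hUh : (Uᴴ)ᴴ * Uᴴ = 1 := by rw [Matrix.conjTranspose_conjTranspose, hU]
  rw [h1, ← sum_norm_sq_mulVec hUt g, ← sum_norm_sq_mulVec hUh f]
  refine le_trans ?_ (Finset.sum_mul_sq_le_sq_mul_sq _ _ _)
  gcongr
  refine (norm_sum_le _ _).trans (Finset.sum_le_sum fun k _ => ?_)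
  rw [norm_mul, norm_mul, Complex.norm_real, Real.norm_eq_abs, abs_mul, abs_of_pos (inv_pos.2 ha)]
  have : a⁻¹ * |d k| ≤ 1 := by
    rw [inv_mul_le_iff₀ ha]; simpa using hd k
  exact mul_le_of_le_one_left (by positivity) this

/-- The scaled matrix is a contraction if the scale dominates a Schatten norm. -/
theorem isContraction_smul_of_frobSq_le {X : Matrix (Fin N) (Fin N) ℂ} (hX : X.IsHermitian)
    {M : ℕ} (hM : 0 < M) {a : ℝ} (ha : 0 < a) (h : frobSq (X ^ M) ≤ a ^ (2 * M)) :
    IsContraction (((a⁻¹ : ℝ) : ℂ) • X) := by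
  obtain ⟨U, d, hU, hU', rfl⟩ := exists_diagonalization hX
  rw [pow_conj_diagonal hU' d M hU, frobSq_conj_diagonal hU'] at h
  refine isContraction_smul_of_abs_le hU ha fun j => ?_
  have h1 : (d j ^ M) ^ 2 ≤ a ^ (2 * M) :=
    (Finset.single_le_sum (f := fun j => (d j ^ M) ^ 2) (fun _ _ => sq_nonneg _)
      (Finset.mem_univ j)).trans h
  have h2 : |d j| ^ (2 * M) ≤ a ^ (2 * M) := by
    rw [pow_mul', ← abs_pow, sq_abs]; exact h1
  exact (pow_le_pow_iff_left₀ (abs_nonneg _) ha.le (by omega)).1 h2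

/-- The squared moduli of the entries of a unitary matrix are doubly stochastic: rows allow Jensen's
inequality for the even power, columns the final summation. -/
theorem sum_pow_diag_conj_le (hU : U * Uᴴ = 1) (hU' : Uᴴ * U = 1) (d : Fin N → ℝ) (n : ℕ) :
    ∑ i, (∑ j, ‖U i j‖ ^ 2 * d j) ^ (2 * n) ≤ ∑ j, d j ^ (2 * n) := by
  calc ∑ i, (∑ j, ‖U i j‖ ^ 2 * d j) ^ (2 * n) ≤ ∑ i, ∑ j, ‖U i j‖ ^ 2 * d j ^ (2 * n) :=
        Finset.sum_le_sum fun i _ => Real.pow_arith_mean_le_arith_mean_pow_of_even _ _ _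
          (fun _ _ => by positivity) (sum_norm_sq_row hU i) (even_two_mul n)
    _ = ∑ j, d j ^ (2 * n) := by
        rw [Finset.sum_comm]
        refine Finset.sum_congr rfl fun j _ => ?_
        rw [← Finset.sum_mul, sum_norm_sq_col hU', one_mul]

/-- In an eigenbasis of A + B each eigenvalue is the sum of the corresponding diagonal entries of
`A` and `B`. Convexity of the even power splits this sum, and `sum_pow_diag_conj_le` compares each
part with the trace of the power. -/
theorem frobSq_pow_add_le {A B : Matrix (Fin N) (Fin N) ℂ} (hA : A.IsHermitian)
    (hB : B.IsHermitian) (n : ℕ) :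
    frobSq ((A + B) ^ n) ≤ 2 ^ (2 * n - 1) * (frobSq (A ^ n) + frobSq (B ^ n)) := by
  obtain ⟨W, s, hW, hW', hs⟩ := exists_diagonalization (hA.add hB)
  obtain ⟨U, d, hU, hU', hd⟩ := exists_diagonalization hA
  obtain ⟨V, e, hV, hV', he⟩ := exists_diagonalization hB
  have key : ∀ u, s u = ∑ j, ‖(Wᴴ * U) u j‖ ^ 2 * d j + ∑ j, ‖(Wᴴ * V) u j‖ ^ 2 * e j := by
    intro u
    have h1 := conj_diagonal_apply_self (Wᴴ * W) s u
    have h2 := conj_diagonal_apply_self (Wᴴ * U) d u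
    have h3 := conj_diagonal_apply_self (Wᴴ * V) e u
    have hc : ∀ Y D : Matrix (Fin N) (Fin N) ℂ,
        Wᴴ * Y * D * (Wᴴ * Y)ᴴ = Wᴴ * (Y * D * Yᴴ) * W := by
      intro Y D
      simp only [Matrix.conjTranspose_mul, Matrix.conjTranspose_conjTranspose, Matrix.mul_assoc]
    rw [hc] at h1 h2 h3
    rw [← hs, Matrix.mul_add, Matrix.add_mul, Matrix.add_apply] at h1
    rw [← hd] at h2
    rw [← he] at h3
    rw [h2, h3, hW'] at h1
    have h4 : ∑ j, ‖(1 : Matrix (Fin N) (Fin N) ℂ) u j‖ ^ 2 * s j = s u := by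
      rw [Finset.sum_eq_single u]
      · simp
      · intro j _ hj; simp [hj.symm]
      · simp
    rw [h4] at h1
    exact_mod_cast h1.symm
  have hu : ∀ {Y : Matrix (Fin N) (Fin N) ℂ}, Y * Yᴴ = 1 → Yᴴ * Y = 1 →
      (Wᴴ * Y) * (Wᴴ * Y)ᴴ = 1 ∧ (Wᴴ * Y)ᴴ * (Wᴴ * Y) = 1 := by
    intro Y hY hY'
    rw [Matrix.conjTranspose_mul, Matrix.conjTranspose_conjTranspose]
    constructor
    · rw [Matrix.mul_assoc, ← Matrix.mul_assoc Y, hY, Matrix.one_mul, hW']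
    · rw [Matrix.mul_assoc, ← Matrix.mul_assoc W, hW, Matrix.one_mul, hY']
  have hf : ∀ {X Y : Matrix (Fin N) (Fin N) ℂ} {t : Fin N → ℝ}, Y * Yᴴ = 1 → Yᴴ * Y = 1 →
      X = Y * Matrix.diagonal (fun j => (t j : ℂ)) * Yᴴ → frobSq (X ^ n) = ∑ j, t j ^ (2 * n) := by
    intro X Y t hY hY' hX
    rw [hX, pow_conj_diagonal hY' t n hY, frobSq_conj_diagonal hY']
    simp only [pow_mul']
  rw [hf hW hW' hs, hf hU hU' hd, hf hV hV' he]
  have h1 := sum_pow_diag_conj_le (hu hU hU').1 (hu hU hU').2 d n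
  have h2 := sum_pow_diag_conj_le (hu hV hV').1 (hu hV hV').2 e n
  calc ∑ u, s u ^ (2 * n) ≤ ∑ u, 2 ^ (2 * n - 1) *
        ((∑ j, ‖(Wᴴ * U) u j‖ ^ 2 * d j) ^ (2 * n) +
          (∑ j, ‖(Wᴴ * V) u j‖ ^ 2 * e j) ^ (2 * n)) := by
        refine Finset.sum_le_sum fun u _ => ?_
        rw [key u]
        exact (even_two_mul n).add_pow_le
    _ ≤ _ := by
        rw [← Finset.mul_sum, Finset.sum_add_distrib]
        gcongr

/-- Interpolation by t^n ≤ 1 + t^M, applied to t = d²/C for each eigenvalue d. -/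
theorem frobSq_pow_le {X : Matrix (Fin N) (Fin N) ℂ} (hX : X.IsHermitian) {n M : ℕ} (hnM : n ≤ M)
    {C : ℝ} (hC : 0 < C) : frobSq (X ^ n) ≤ C ^ n * (N + frobSq (X ^ M) / C ^ M) := by
  obtain ⟨U, d, hU, hU', rfl⟩ := exists_diagonalization hX
  rw [pow_conj_diagonal hU' d n hU, frobSq_conj_diagonal hU', pow_conj_diagonal hU' d M hU,
    frobSq_conj_diagonal hU']
  have h1 : ∀ t : ℝ, 0 ≤ t → t ^ n ≤ 1 + t ^ M := by
    intro t ht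
    rcases le_total t 1 with h | h
    · have := pow_le_one₀ (n := n) ht h
      have := pow_nonneg ht M
      linarith
    · have := pow_le_pow_right₀ h hnM
      linarith
  calc ∑ j, (d j ^ n) ^ 2 ≤ ∑ j, C ^ n * (1 + (d j ^ M) ^ 2 / C ^ M) := by
        refine Finset.sum_le_sum fun j _ => ?_
        have := mul_le_mul_of_nonneg_left (h1 (d j ^ 2 / C) (by positivity)) (pow_pos hC n).le
        rw [div_pow, div_pow, mul_div_cancel₀ _ (pow_pos hC n).ne'] at this
        rwa [← pow_mul, ← pow_mul, mul_comm n, mul_comm M, pow_mul, pow_mul]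
    _ = _ := by
        rw [← Finset.mul_sum, Finset.sum_add_distrib, Finset.sum_div]
        simp

theorem sum_norm_sq_diag_le (X : Matrix (Fin N) (Fin N) ℂ) : ∑ i, ‖X i i‖ ^ 2 ≤ frobSq X := by
  rw [frobSq_eq_sum]
  exact Finset.sum_le_sum fun i _ =>
    Finset.single_le_sum (f := fun j => ‖X i j‖ ^ 2) (fun _ _ => by positivity) (Finset.mem_univ i)

theorem frobSq_nonneg (X : Matrix (Fin N) (Fin N) ℂ) : 0 ≤ frobSq X := by
  rw [frobSq_eq_sum]; positivity

theorem sum_norm_sq_diag_pow_add_le {A B : Matrix (Fin N) (Fin N) ℂ} (hA : A.IsHermitian)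
    (hB : B.IsHermitian) {n M : ℕ} (hnM : n ≤ M) {C : ℝ} (hC : 0 < C) :
    ∑ i, ‖((A + B) ^ n) i i‖ ^ 2 ≤
      (4 * C) ^ n * (2 * N + (frobSq (A ^ M) + frobSq (B ^ M)) / C ^ M) := by
  have hA0 := frobSq_nonneg (A ^ n)
  have hB0 := frobSq_nonneg (B ^ n)
  have h4 : (2 : ℝ) ^ (2 * n - 1) ≤ 4 ^ n := by
    calc (2 : ℝ) ^ (2 * n - 1) ≤ 2 ^ (2 * n) := pow_le_pow_right₀ (by norm_num) (by omega)
      _ = 4 ^ n := by rw [pow_mul]; norm_num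
  calc ∑ i, ‖((A + B) ^ n) i i‖ ^ 2 ≤ frobSq ((A + B) ^ n) := sum_norm_sq_diag_le _
    _ ≤ 2 ^ (2 * n - 1) * (frobSq (A ^ n) + frobSq (B ^ n)) := frobSq_pow_add_le hA hB n
    _ ≤ 4 ^ n * (C ^ n * (N + frobSq (A ^ M) / C ^ M) + C ^ n * (N + frobSq (B ^ M) / C ^ M)) := by
        gcongr
        · exact frobSq_pow_le hA hnM hC
        · exact frobSq_pow_le hB hnM hC
    _ = _ := by rw [mul_pow]; ring

end Traces

/-! ### Moments of a random scale that dominates the operator norm -/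

section Scale

/-- A scale that dominates the operator norm of a matrix `X` with `frobSq (X ^ M) = η`. -/
noncomputable def normScale (M : ℕ) (Y η : ℝ) : ℝ := (η + Y) ^ (((2 * M : ℕ) : ℝ)⁻¹)

variable {M : ℕ} {Y η : ℝ}

theorem normScale_pos (hY : 0 < Y) (hη : 0 ≤ η) : 0 < normScale M Y η :=
  Real.rpow_pos_of_pos (by linarith) _

theorem le_normScale_pow (hM : 0 < M) (hY : 0 < Y) (hη : 0 ≤ η) :
    η ≤ normScale M Y η ^ (2 * M) := by
  rw [normScale, Real.rpow_inv_natCast_pow (by linarith) (by omega)]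
  linarith

/-- Writing η + Y = Y(1 + η/Y), the second factor is at least 1 and its exponent e/(2M) is at most
1, so it is bounded by its first power. If η has mean at most Y, the expectation costs only a factor
2. -/
theorem normScale_pow_le (hM : 0 < M) (hY : 0 < Y) (hη : 0 ≤ η) {e : ℕ} (he : e ≤ 2 * M) :
    normScale M Y η ^ e ≤ Y ^ ((e : ℝ) / (2 * M : ℕ)) * (1 + η / Y) := by
  have hM' : (0 : ℝ) < (2 * M : ℕ) := by positivity
  have h1 : η + Y = Y * (1 + η / Y) := by field_simp; ring
  have h2 : (1 : ℝ) ≤ 1 + η / Y := by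
    have : 0 ≤ η / Y := by positivity
    linarith
  rw [normScale, ← Real.rpow_natCast, ← Real.rpow_mul (by linarith), inv_mul_eq_div, h1,
    Real.mul_rpow hY.le (by linarith)]
  gcongr
  refine (Real.rpow_le_rpow_of_exponent_le h2 ?_).trans_eq (Real.rpow_one _)
  rw [div_le_one hM']
  exact_mod_cast he

variable {Ω : Type*} [MeasurableSpace Ω] {μ : Measure Ω} [IsProbabilityMeasure μ]

theorem integral_normScale_pow_le (hM : 0 < M) (hY : 0 < Y) {η : Ω → ℝ} (hη : ∀ ω, 0 ≤ η ω)
    (hint : Integrable η μ) (hle : ∫ ω, η ω ∂μ ≤ Y) {e : ℕ} (he : e ≤ 2 * M) :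
    Integrable (fun ω => normScale M Y (η ω) ^ e) μ ∧
      ∫ ω, normScale M Y (η ω) ^ e ∂μ ≤ 2 * Y ^ ((e : ℝ) / (2 * M : ℕ)) := by
  have hb : Integrable (fun ω => Y ^ ((e : ℝ) / (2 * M : ℕ)) * (1 + η ω / Y)) μ :=
    ((integrable_const _).add (hint.div_const _)).const_mul _
  have hm : AEStronglyMeasurable (fun ω => normScale M Y (η ω) ^ e) μ := by
    simp only [normScale]
    exact (((hint.aemeasurable.add_const _).pow_const _).pow_const _).aestronglyMeasurable
  have hi : Integrable (fun ω => normScale M Y (η ω) ^ e) μ := hb.mono' hm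
    (Eventually.of_forall fun ω => by
      rw [Real.norm_of_nonneg (pow_nonneg (normScale_pos hY (hη ω)).le _)]
      exact normScale_pow_le hM hY (hη ω) he)
  refine ⟨hi, (integral_mono hi hb fun ω => normScale_pow_le hM hY (hη ω) he).trans ?_⟩
  rw [integral_const_mul, integral_add (integrable_const _) (hint.div_const _), integral_const,
    integral_div]
  have : (∫ ω, η ω ∂μ) / Y ≤ 1 := (div_le_one hY).2 hle
  have h0 : 0 ≤ Y ^ ((e : ℝ) / (2 * M : ℕ)) := Real.rpow_nonneg hY.le _
  simp only [probReal_univ, smul_eq_mul, mul_one]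
  nlinarith

end Scale

end DiagFreeSum

namespace DiagFreeSum

/-! ### The bound for a fixed dimension -/

section FixedDimension

theorem pow_self_div_factorial_le (m : ℕ) : (m.factorial : ℝ)⁻¹ * (m : ℝ) ^ m ≤ 3 ^ m := by
  have h1 := Real.pow_div_factorial_le_exp (m : ℝ) (by positivity) m
  have h2 : Real.exp (m : ℝ) ≤ 3 ^ m := by
    rw [← Real.exp_one_pow]
    gcongr
    exact Real.exp_one_lt_three.le
  rw [inv_mul_eq_div]
  exact h1.trans h2

/-- One of the factors m^m is cancelled by 1/m! up to 3^m, which combines with 2^m to 6^m. The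
remaining m^(2n+1+m) is at most (2n+1)^(4n+2); without the cancellation the exponent would be too
large for the later comparison with `N`. -/
theorem sum_patterns_le (n : ℕ) : ∑ m ∈ Finset.range (2 * n + 2),
    (m.factorial : ℝ)⁻¹ * (m ^ (2 * n + 1) * (m ^ (2 * m) * 2 ^ m)) ≤
      (2 * n + 2) * (6 ^ (2 * n + 1) * (2 * n + 1) ^ (4 * n + 2)) := by
  have h : ∀ m ∈ Finset.range (2 * n + 2),
      (m.factorial : ℝ)⁻¹ * ((m : ℝ) ^ (2 * n + 1) * (m ^ (2 * m) * 2 ^ m)) ≤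
        6 ^ (2 * n + 1) * (2 * n + 1) ^ (4 * n + 2) := by
    intro m hm
    have hm' : m ≤ 2 * n + 1 := by have := Finset.mem_range.1 hm; omega
    have hmr : (m : ℝ) ≤ 2 * n + 1 := by exact_mod_cast hm'
    have h1 : (1 : ℝ) ≤ 2 * n + 1 := by
      have : (0 : ℝ) ≤ n := by positivity
      linarith
    calc (m.factorial : ℝ)⁻¹ * ((m : ℝ) ^ (2 * n + 1) * (m ^ (2 * m) * 2 ^ m))
        = ((m.factorial : ℝ)⁻¹ * (m : ℝ) ^ m) * 2 ^ m * ((m : ℝ) ^ (2 * n + 1) * m ^ m) := by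
          rw [two_mul m, pow_add (m : ℝ) m m]; ring
      _ ≤ 3 ^ m * 2 ^ m * ((2 * n + 1) ^ (2 * n + 1) * (2 * n + 1) ^ m) := by
          gcongr
          exact pow_self_div_factorial_le m
      _ = 6 ^ m * (2 * n + 1) ^ (2 * n + 1 + m) := by
          rw [← mul_pow, ← pow_add]; norm_num
      _ ≤ _ := by
          exact mul_le_mul (pow_le_pow_right₀ (by norm_num) hm')
            (pow_le_pow_right₀ h1 (by omega)) (by positivity) (by positivity)
  refine (Finset.sum_le_sum h).trans_eq ?_
  simp

variable {Ω : Type*} [MeasurableSpace Ω] {μ : Measure Ω} [IsProbabilityMeasure μ] {N : ℕ}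
  {A B : Ω → Matrix (Fin N) (Fin N) ℂ}

/-- The bound on the mean square errors of the moments up to order `n`. -/
noncomputable def momentBound (N M n : ℕ) (D : ℝ) : ℝ :=
  4 ^ n * ((2 * n + 2) * (6 ^ (2 * n + 1) * (2 * n + 1) ^ (4 * n + 2))) *
    (4 * (N * D ^ M) ^ ((n : ℝ) / M))

/-- The operator norms enter with total power 2k, so their scales contribute Y^(2k/(2M)) whatever
the split between the colours. Replacing `k` by `n` and `C` by `D` ≥ 1 gives one bound for all
orders up to `n`. -/
theorem integral_sum_momentError_le_momentBound (hA : Measurable A) (hB : Measurable B)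
    (hAh : ∀ ω, (A ω).IsHermitian) (hBh : ∀ ω, (B ω).IsHermitian) (hind : IndepFun A B μ)
    (hperm : PermInvariant μ A ∨ PermInvariant μ B) {M : ℕ} (hM : 0 < M) {C D : ℝ} (hC : 0 < C)
    (hCD : C ≤ D) (hD : 1 ≤ D)
    (hAi : Integrable (fun ω => frobSq (A ω ^ M)) μ)
    (hBi : Integrable (fun ω => frobSq (B ω ^ M)) μ)
    (hAC : ∫ ω, frobSq (A ω ^ M) ∂μ ≤ N * C ^ M) (hBC : ∫ ω, frobSq (B ω ^ M) ∂μ ≤ N * C ^ M)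
    {n k : ℕ} (hkn : k ≤ n) (hnM : n ≤ M) (hn : 2 * (2 * n + 1) ≤ N) (x : Fin N) :
    Integrable (fun ω => ∑ i, ‖momentError x (A ω) (B ω) k i‖ ^ 2) μ ∧
      ∫ ω, ∑ i, ‖momentError x (A ω) (B ω) k i‖ ^ 2 ∂μ ≤ momentBound N M n D := by
  have hN : (1 : ℝ) ≤ N := by exact_mod_cast (by omega : 1 ≤ N)
  have hY : (0 : ℝ) < N * C ^ M := by positivity
  set Y : ℝ := N * C ^ M with hYdef
  have hMr : (0 : ℝ) < M := by exact_mod_cast hM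
  have ha := fun e (he : e ≤ 2 * k) => integral_normScale_pow_le (e := e) hM hY
    (fun ω => frobSq_nonneg (A ω ^ M)) hAi hAC (by omega)
  have hb := fun e (he : e ≤ 2 * k) => integral_normScale_pow_le (e := e) hM hY
    (fun ω => frobSq_nonneg (B ω ^ M)) hBi hBC (by omega)
  have key := integral_sum_momentError_le (n := k) (Q := 4 * Y ^ ((k : ℝ) / M)) hA hB hind hperm
    (fun ω => normScale_pos hY (frobSq_nonneg (A ω ^ M)))
    (fun ω => normScale_pos hY (frobSq_nonneg (B ω ^ M)))
    (fun ω => isContraction_smul_of_frobSq_le (hAh ω) hM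
      (normScale_pos hY (frobSq_nonneg (A ω ^ M))) (le_normScale_pow hM hY (frobSq_nonneg _)))
    (fun ω => isContraction_smul_of_frobSq_le (hBh ω) hM
      (normScale_pos hY (frobSq_nonneg (B ω ^ M))) (le_normScale_pow hM hY (frobSq_nonneg _)))
    (fun e he => (ha e he).1) (fun e he => (hb e he).1) (by omega)
    (by
      intro e e' hee
      calc _ ≤ (2 * Y ^ ((e : ℝ) / (2 * M : ℕ))) * (2 * Y ^ ((e' : ℝ) / (2 * M : ℕ))) := by
            refine mul_le_mul (ha e (by omega)).2 (hb e' (by omega)).2 ?_ (by positivity)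
            exact integral_nonneg fun ω => pow_nonneg (normScale_pos hY (frobSq_nonneg _)).le _
        _ = 4 * (Y ^ ((e : ℝ) / (2 * M : ℕ)) * Y ^ ((e' : ℝ) / (2 * M : ℕ))) := by ring
        _ = 4 * Y ^ ((k : ℝ) / M) := by
            rw [← Real.rpow_add hY, ← add_div]
            have : (e : ℝ) + e' = 2 * k := by exact_mod_cast hee
            rw [this]
            congr 2
            push_cast
            field_simp
      ) x
  refine ⟨key.1, key.2.trans ?_⟩
  have hkr : (k : ℝ) ≤ n := by exact_mod_cast hkn
  have hk0 : (0 : ℝ) ≤ k := by positivity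
  have hND : (1 : ℝ) ≤ N * D ^ M := one_le_mul_of_one_le_of_one_le hN (one_le_pow₀ hD)
  have h1 : Y ^ ((k : ℝ) / M) ≤ (N * D ^ M) ^ ((n : ℝ) / M) := by
    calc Y ^ ((k : ℝ) / M) ≤ (N * D ^ M) ^ ((k : ℝ) / M) := by
          refine Real.rpow_le_rpow hY.le ?_ (by positivity)
          rw [hYdef]
          gcongr
      _ ≤ _ := by
          apply Real.rpow_le_rpow_of_exponent_le hND
          gcongr
  have h2 : ∑ m ∈ Finset.range (2 * k + 2),
      (m.factorial : ℝ)⁻¹ * ((m : ℝ) ^ (2 * k + 1) * (m ^ (2 * m) * 2 ^ m)) ≤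
        (2 * n + 2) * (6 ^ (2 * n + 1) * (2 * n + 1) ^ (4 * n + 2)) := by
    refine (sum_patterns_le k).trans ?_
    have : (2 * k + 1 : ℝ) ^ (4 * k + 2) ≤ (2 * n + 1 : ℝ) ^ (4 * n + 2) := by
      calc (2 * k + 1 : ℝ) ^ (4 * k + 2) ≤ (2 * n + 1 : ℝ) ^ (4 * k + 2) := by gcongr
        _ ≤ _ := pow_le_pow_right₀ (by linarith) (by omega)
    have h6 : (6 : ℝ) ^ (2 * k + 1) ≤ 6 ^ (2 * n + 1) :=
      pow_le_pow_right₀ (by norm_num) (by omega)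
    gcongr
  have h3 : (4 : ℝ) ^ k ≤ 4 ^ n := pow_le_pow_right₀ (by norm_num) hkn
  rw [momentBound]
  have hs0 : (0 : ℝ) ≤ ∑ m ∈ Finset.range (2 * k + 2),
      (m.factorial : ℝ)⁻¹ * ((m : ℝ) ^ (2 * k + 1) * (m ^ (2 * m) * 2 ^ m)) := by positivity
  gcongr

variable {x : Fin N}

/-- The constant `L` dominates 1, 1/|z| and 1/Im z, so one power of it covers all coefficients of
the moment errors, including that of the remainder. Cauchy–Schwarz over the 2p + 1 orders gives the
factor p + p + 1, and 8 is twice the square of the 2 in the remainder. -/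
theorem sum_norm_cauchyError_sq_le {A B : Matrix (Fin N) (Fin N) ℂ} (hA : A.IsHermitian)
    (hB : B.IsHermitian) {z : ℂ} (hz : 0 < z.im) {L : ℝ} (hL : 1 ≤ L) (hLz : ‖z‖⁻¹ ≤ L)
    (hLi : z.im⁻¹ ≤ L) (p : ℕ) :
    ∑ i, ‖cauchyError x A B z i‖ ^ 2 ≤
      2 * L ^ (2 * (p + p + 1)) * (p + p + 1) * ∑ k ∈ Finset.range (p + p + 1),
        ∑ i, ‖momentError x A B k i‖ ^ 2 +
      8 / (‖z‖ ^ 2) ^ (p + p) / z.im ^ 2 * ∑ i, ‖((A + B) ^ (p + p)) i i‖ ^ 2 := by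
  have hz0 : z ≠ 0 := by rintro rfl; simp at hz
  set n := p + p with hn
  have key : ∀ i, ‖cauchyError x A B z i‖ ^ 2 ≤ 2 * L ^ (2 * (n + 1)) * (p + p + 1) *
      ∑ k ∈ Finset.range (n + 1), ‖momentError x A B k i‖ ^ 2 +
      8 / (‖z‖ ^ 2) ^ n / z.im ^ 2 * ‖((A + B) ^ n) i i‖ ^ 2 := by
    intro i
    have h1 := norm_cauchyError_le_sum (x := x) hA hB hz p i
    rw [← hn] at h1
    set m : ℕ → ℝ := fun k => ‖momentError x A B k i‖ with hm
    have hm0 : ∀ k, 0 ≤ m k := fun k => norm_nonneg _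
    set s : ℝ := ‖((A + B) ^ n) i i‖ with hs
    have h2 : ∑ k ∈ Finset.range n, m k / ‖z‖ ^ (k + 1) ≤
        L ^ (n + 1) * ∑ k ∈ Finset.range n, m k := by
      rw [Finset.mul_sum]
      refine Finset.sum_le_sum fun k hk => ?_
      have hk' := Finset.mem_range.1 hk
      have : (‖z‖ ^ (k + 1))⁻¹ ≤ L ^ (n + 1) := by
        rw [← inv_pow]
        exact (pow_le_pow_left₀ (by positivity) hLz _).trans (pow_le_pow_right₀ hL (by omega))
      rw [div_eq_mul_inv, mul_comm]
      exact mul_le_mul_of_nonneg_right this (hm0 k)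
    have h3 : m n / (‖z‖ ^ n * z.im) ≤ L ^ (n + 1) * m n := by
      have : (‖z‖ ^ n * z.im)⁻¹ ≤ L ^ (n + 1) := by
        rw [mul_inv, ← inv_pow, pow_succ]
        gcongr
      rw [div_eq_mul_inv, mul_comm]
      exact mul_le_mul_of_nonneg_right this (hm0 n)
    have h4 : ‖cauchyError x A B z i‖ ≤ L ^ (n + 1) * ∑ k ∈ Finset.range (n + 1), m k +
        2 * s / (‖z‖ ^ n * z.im) := by
      rw [Finset.sum_range_succ, mul_add]
      rw [add_div] at h1
      linarith
    have h5 : (∑ k ∈ Finset.range (n + 1), m k) ^ 2 ≤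
        (p + p + 1) * ∑ k ∈ Finset.range (n + 1), m k ^ 2 := by
      have := sq_sum_le_card_mul_sum_sq (s := Finset.range (n + 1)) (f := m)
      simpa [hn] using this
    calc ‖cauchyError x A B z i‖ ^ 2 ≤ (L ^ (n + 1) * ∑ k ∈ Finset.range (n + 1), m k +
        2 * s / (‖z‖ ^ n * z.im)) ^ 2 := by gcongr
      _ ≤ 2 * ((L ^ (n + 1) * ∑ k ∈ Finset.range (n + 1), m k) ^ 2 +
          (2 * s / (‖z‖ ^ n * z.im)) ^ 2) := add_sq_le
      _ = 2 * L ^ (2 * (n + 1)) * (∑ k ∈ Finset.range (n + 1), m k) ^ 2 +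
          8 / (‖z‖ ^ 2) ^ n / z.im ^ 2 * s ^ 2 := by
          rw [mul_pow, ← pow_mul, div_pow, mul_pow, mul_pow, ← pow_mul, ← pow_mul, mul_comm 2 n]
          field_simp
          ring
      _ ≤ 2 * L ^ (2 * (n + 1)) * ((p + p + 1) * ∑ k ∈ Finset.range (n + 1), m k ^ 2) +
          8 / (‖z‖ ^ 2) ^ n / z.im ^ 2 * s ^ 2 := by gcongr
      _ = _ := by ring
  refine (Finset.sum_le_sum fun i _ => key i).trans (le_of_eq ?_)
  rw [Finset.sum_add_distrib, ← Finset.mul_sum, ← Finset.mul_sum, Finset.sum_comm]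

/-- Two terms with opposite demands on `p`: the moment errors carry 1/N but grow with the order,
while the truncation error decays with it. The trace terms have normalised mean at most 4, so 8
becomes 32. -/
theorem integral_cauchyError_le (hA : Measurable A) (hB : Measurable B)
    (hAh : ∀ ω, (A ω).IsHermitian) (hBh : ∀ ω, (B ω).IsHermitian) (hind : IndepFun A B μ)
    (hperm : PermInvariant μ A ∨ PermInvariant μ B) {M : ℕ} (hM : 0 < M) {C D : ℝ} (hC : 0 < C)
    (hCD : C ≤ D) (hD : 1 ≤ D)
    (hAi : Integrable (fun ω => frobSq (A ω ^ M)) μ)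
    (hBi : Integrable (fun ω => frobSq (B ω ^ M)) μ)
    (hAC : ∫ ω, frobSq (A ω ^ M) ∂μ ≤ N * C ^ M) (hBC : ∫ ω, frobSq (B ω ^ M) ∂μ ≤ N * C ^ M)
    {p : ℕ} (hnM : p + p ≤ M) (hn : 2 * (2 * (p + p) + 1) ≤ N)
    {z : ℂ} (hz : 0 < z.im) {L : ℝ} (hL : 1 ≤ L) (hLz : ‖z‖⁻¹ ≤ L) (hLi : z.im⁻¹ ≤ L)
    (x : Fin N) :
    Integrable (fun ω => (N : ℝ)⁻¹ *
      frobSq (cauchyFreeSum x (A ω) (B ω) z - cauchySum (A ω) (B ω) z)) μ ∧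
    ∫ ω, (N : ℝ)⁻¹ * frobSq (cauchyFreeSum x (A ω) (B ω) z - cauchySum (A ω) (B ω) z) ∂μ ≤
      (N : ℝ)⁻¹ * (2 * L ^ (2 * (p + p + 1)) * (p + p + 1) ^ 2 * momentBound N M (p + p) D) +
      32 / z.im ^ 2 * (4 * C / ‖z‖ ^ 2) ^ (p + p) := by
  have hz0 : z ≠ 0 := by rintro rfl; simp at hz
  have hN : (0 : ℝ) < N := by exact_mod_cast (by omega : 0 < N)
  simp only [frobSq_cauchy_sub]
  set n := p + p with hndef
  have hmom := fun k (hk : k ∈ Finset.range (n + 1)) =>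
    integral_sum_momentError_le_momentBound hA hB hAh hBh hind hperm hM hC hCD hD hAi hBi hAC hBC
      (Nat.lt_succ_iff.1 (Finset.mem_range.1 hk)) hnM hn x
  have hint : Integrable (fun ω => (N : ℝ)⁻¹ * ∑ i, ‖cauchyError x (A ω) (B ω) z i‖ ^ 2) μ := by
    refine Integrable.const_mul (integrable_finsetSum _ fun i _ => ?_) _
    have hm := (measurable_cauchyError hA hB hAh hBh x hz i).norm.pow_const 2
    refine (integrable_const ((2 / z.im) ^ 2)).mono' hm.aestronglyMeasurable
      (Eventually.of_forall fun ω => ?_)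
    rw [Real.norm_of_nonneg (by positivity)]
    have := norm_cauchyError_le (x := x) (hAh ω) (hBh ω) hz i
    gcongr
  refine ⟨hint, ?_⟩
  set K₁ : ℝ := 2 * L ^ (2 * (n + 1)) * (p + p + 1) with hK₁
  set K₂ : ℝ := 8 / (‖z‖ ^ 2) ^ n / z.im ^ 2 with hK₂
  have hK₁0 : 0 ≤ K₁ := by positivity
  have hK₂0 : 0 ≤ K₂ := by positivity
  have hpt : ∀ ω, (N : ℝ)⁻¹ * ∑ i, ‖cauchyError x (A ω) (B ω) z i‖ ^ 2 ≤
      (N : ℝ)⁻¹ * (K₁ * ∑ k ∈ Finset.range (n + 1), ∑ i, ‖momentError x (A ω) (B ω) k i‖ ^ 2 +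
      K₂ * ((4 * C) ^ n * (2 * N + (frobSq (A ω ^ M) + frobSq (B ω ^ M)) / C ^ M))) := by
    intro ω
    refine mul_le_mul_of_nonneg_left ?_ (by positivity)
    refine (sum_norm_cauchyError_sq_le (hAh ω) (hBh ω) hz hL hLz hLi p).trans ?_
    rw [← hndef]
    gcongr
    exact sum_norm_sq_diag_pow_add_le (hAh ω) (hBh ω) hnM hC
  have hi1 : Integrable (fun ω => K₁ * ∑ k ∈ Finset.range (n + 1),
      ∑ i, ‖momentError x (A ω) (B ω) k i‖ ^ 2) μ :=
    (integrable_finsetSum _ fun k hk => (hmom k hk).1).const_mul _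
  have hi2 : Integrable (fun ω => (frobSq (A ω ^ M) + frobSq (B ω ^ M)) / C ^ M) μ :=
    (hAi.add hBi).div_const _
  have hi3 : Integrable (fun ω => K₂ * ((4 * C) ^ n *
      (2 * N + (frobSq (A ω ^ M) + frobSq (B ω ^ M)) / C ^ M))) μ :=
    (((integrable_const _).add hi2).const_mul _).const_mul _
  refine (integral_mono hint ((hi1.add hi3).const_mul _) hpt).trans ?_
  have hv1 : ∫ ω, K₁ * ∑ k ∈ Finset.range (n + 1),
      ∑ i, ‖momentError x (A ω) (B ω) k i‖ ^ 2 ∂μ ≤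
      K₁ * ((p + p + 1) * momentBound N M n D) := by
    rw [integral_const_mul, integral_finsetSum _ fun k hk => (hmom k hk).1]
    gcongr
    refine (Finset.sum_le_sum fun k hk => (hmom k hk).2).trans_eq ?_
    simp [hndef]
  have hv2 : ∫ ω, (frobSq (A ω ^ M) + frobSq (B ω ^ M)) / C ^ M ∂μ ≤ 2 * N := by
    rw [integral_div, integral_add hAi hBi, div_le_iff₀ (by positivity)]
    linarith
  have hv3 : ∫ ω, K₂ * ((4 * C) ^ n *
      (2 * N + (frobSq (A ω ^ M) + frobSq (B ω ^ M)) / C ^ M)) ∂μ ≤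
      K₂ * ((4 * C) ^ n * (4 * N)) := by
    rw [integral_const_mul, integral_const_mul, integral_add (integrable_const _) hi2,
      integral_const, probReal_univ, one_smul]
    gcongr
    linarith
  simp only [Pi.add_apply]
  rw [integral_const_mul, integral_add hi1 hi3]
  calc _ ≤ (N : ℝ)⁻¹ * (K₁ * ((p + p + 1) * momentBound N M n D) +
        K₂ * ((4 * C) ^ n * (4 * N))) := by gcongr
    _ = _ := by
        rw [hK₁, hK₂, div_pow]
        field_simp
        ring

end FixedDimension

end DiagFreeSum

namespace DiagFreeSum

/-! ### Asymptotics along a speed -/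

section Asymptotics

variable {M : ℕ → ℕ}

theorem tendsto_log_log : Tendsto (fun N : ℕ => Real.log (Real.log N)) atTop atTop :=
  Real.tendsto_log_atTop.comp (Real.tendsto_log_atTop.comp tendsto_natCast_atTop_atTop)

/-- A speed is o(log N), so every exponential in M(N) is smaller than every positive power of `N`.
-/
theorem IsSpeed.eventually_mul_le (hM : IsSpeed M) (κ : ℝ) {δ : ℝ} (hδ : 0 < δ) :
    ∀ᶠ N : ℕ in atTop, κ * M N ≤ δ * Real.log N := by
  filter_upwards [hM.2, tendsto_log_log.eventually_ge_atTop (max 1 (|κ| / δ)),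
    eventually_ge_atTop 1] with N h1 h2 h3
  have hl : 0 ≤ Real.log N := Real.log_nonneg (by exact_mod_cast h3)
  have h4 : 1 ≤ Real.log (Real.log N) := (le_max_left _ _).trans h2
  have h5 : |κ| ≤ δ * Real.log (Real.log N) := by
    have := (le_max_right _ _).trans h2
    rwa [div_le_iff₀ hδ, mul_comm] at this
  calc κ * M N ≤ |κ| * M N := by gcongr; exact le_abs_self κ
    _ ≤ δ * Real.log (Real.log N) * (Real.log N / Real.log (Real.log N)) := by gcongr
    _ = δ * Real.log N := by field_simp

theorem IsSpeed.eventually_mul_pow_le (hM : IsSpeed M) {a K δ : ℝ} (ha : 0 < a) (hK : 0 < K)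
    (hδ : 0 < δ) : ∀ᶠ N : ℕ in atTop, a * K ^ M N ≤ (N : ℝ) ^ δ := by
  filter_upwards [hM.eventually_mul_le (|Real.log a| + Real.log K) hδ, eventually_ge_atTop 1,
    hM.1.eventually_ge_atTop 1] with N h1 h2 h3
  have hN : (0 : ℝ) < N := by exact_mod_cast h2
  have hM1 : (1 : ℝ) ≤ M N := by exact_mod_cast h3
  rw [← Real.log_le_log_iff (by positivity) (by positivity), Real.log_mul ha.ne' (by positivity),
    Real.log_pow, Real.log_rpow hN]
  have : Real.log a ≤ |Real.log a| * M N :=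
    (le_abs_self _).trans (le_mul_of_one_le_right (abs_nonneg _) hM1)
  linarith

/-- This is where the exact form of the speed enters: log M ≤ log log N, whence M log M ≤ log N. -/
theorem IsSpeed.eventually_pow_self_le (hM : IsSpeed M) :
    ∀ᶠ N : ℕ in atTop, (M N : ℝ) ^ M N ≤ N := by
  filter_upwards [hM.2, tendsto_log_log.eventually_ge_atTop 1, eventually_ge_atTop 2,
    hM.1.eventually_ge_atTop 1] with N h1 h2 h3 h4
  have hN : (1 : ℝ) < N := by exact_mod_cast h3
  have hM0 : (0 : ℝ) < M N := by exact_mod_cast h4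
  have hl : 0 < Real.log N := Real.log_pos hN
  rw [← Real.log_le_log_iff (by positivity) (by linarith), Real.log_pow]
  have h5 : Real.log (M N) ≤ Real.log (Real.log N) := by
    apply Real.log_le_log hM0
    exact h1.trans (div_le_self hl.le h2)
  calc (M N : ℝ) * Real.log (M N) ≤
        Real.log N / Real.log (Real.log N) * Real.log (Real.log N) := by gcongr
    _ = Real.log N := by field_simp

/-- The power of `N` has two sources: 78/100 from the number of patterns and 19/100 from the
operator norms. Everything else is exponential in `M`, with base 192 L D, where 192 = 2·2·4·2·6. -/
theorem moments_term_le {N M n : ℕ} {L D : ℝ} (hL : 1 ≤ L) (hD : 1 ≤ D) (hN : 1 ≤ N)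
    (hM : 100 ≤ M) (hn : 100 * n ≤ 19 * M) (hMN : (M : ℝ) ^ M ≤ N) :
    2 * L ^ (2 * (n + 1)) * (n + 1) ^ 2 * momentBound N M n D ≤
      8 * (192 * L * D) ^ M * (N : ℝ) ^ (97 / 100 : ℝ) := by
  have hMr : (100 : ℝ) ≤ M := by exact_mod_cast hM
  have hNr : (1 : ℝ) ≤ N := by exact_mod_cast hN
  have hnr : 100 * (n : ℝ) ≤ 19 * M := by exact_mod_cast hn
  have hn0 : (0 : ℝ) ≤ n := by positivity
  have h1 : L ^ (2 * (n + 1)) ≤ L ^ M := pow_le_pow_right₀ hL (by omega)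
  have hM2 : (M : ℝ) ≤ 2 ^ M := by exact_mod_cast Nat.lt_two_pow_self.le
  have h2 : (n + 1 : ℝ) ^ 2 ≤ (2 ^ M) ^ 2 := by gcongr; linarith
  have h3 : (2 * n + 2 : ℝ) ≤ 2 ^ M := by linarith
  have h4 : (4 : ℝ) ^ n ≤ 4 ^ M := pow_le_pow_right₀ (by norm_num) (by omega)
  have h5 : (6 : ℝ) ^ (2 * n + 1) ≤ 6 ^ M := pow_le_pow_right₀ (by norm_num) (by omega)
  -- Here 2n + 1 ≤ M and 4n + 2 ≤ 0.76 M + 2 ≤ 0.78 M, the last step because M ≥ 100.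
  have h6 : (2 * n + 1 : ℝ) ^ (4 * n + 2) ≤ (N : ℝ) ^ (78 / 100 : ℝ) := by
    calc (2 * n + 1 : ℝ) ^ (4 * n + 2) ≤ (M : ℝ) ^ (4 * n + 2) := by gcongr; linarith
      _ = (M : ℝ) ^ ((4 * n + 2 : ℕ) : ℝ) := (Real.rpow_natCast _ _).symm
      _ ≤ (M : ℝ) ^ ((M : ℝ) * (78 / 100)) := by
          apply Real.rpow_le_rpow_of_exponent_le (by linarith)
          push_cast
          linarith
      _ = ((M : ℝ) ^ M) ^ (78 / 100 : ℝ) := by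
          rw [Real.rpow_mul (by positivity), Real.rpow_natCast]
      _ ≤ _ := by gcongr
  have h7 : ((N : ℝ) * D ^ M) ^ ((n : ℝ) / M) ≤ (N : ℝ) ^ (19 / 100 : ℝ) * D ^ M := by
    have hDM : 1 ≤ D ^ M := one_le_pow₀ hD
    calc ((N : ℝ) * D ^ M) ^ ((n : ℝ) / M) ≤ ((N : ℝ) * D ^ M) ^ (19 / 100 : ℝ) := by
          apply Real.rpow_le_rpow_of_exponent_le (one_le_mul_of_one_le_of_one_le hNr hDM)
          rw [div_le_iff₀ (by linarith)]
          linarith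
      _ = (N : ℝ) ^ (19 / 100 : ℝ) * (D ^ M) ^ (19 / 100 : ℝ) :=
          Real.mul_rpow (by positivity) (by positivity)
      _ ≤ _ := by
          gcongr
          refine (Real.rpow_le_rpow_of_exponent_le hDM (by norm_num)).trans_eq (Real.rpow_one _)
  calc 2 * L ^ (2 * (n + 1)) * (n + 1) ^ 2 * momentBound N M n D
      ≤ 2 * L ^ M * (2 ^ M) ^ 2 * (4 ^ M * (2 ^ M * (6 ^ M * (N : ℝ) ^ (78 / 100 : ℝ))) *
        (4 * ((N : ℝ) ^ (19 / 100 : ℝ) * D ^ M))) := by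
        rw [momentBound]
        gcongr
    _ = 8 * (2 * 2 * 4 * 2 * 6 * L * D) ^ M *
        ((N : ℝ) ^ (78 / 100 : ℝ) * (N : ℝ) ^ (19 / 100 : ℝ)) := by
        simp only [mul_pow]
        ring
    _ = _ := by
        rw [← Real.rpow_add (by linarith)]
        norm_num

/-- The error bound beats the target along a speed. -/
theorem IsSpeed.eventually_bound_le (hM : IsSpeed M) {C D L c r y t : ℝ} (hL : 1 ≤ L) (hD : 1 ≤ D)
    (hC : 0 ≤ C) (hc : c < 1 / 6) (hr : 0 < r) (hry : r < y) (hCr : 4 * C ≤ r ^ 2) (ht : 0 < t) :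
    ∀ᶠ N : ℕ in atTop, ∃ p : ℕ, p + p ≤ M N ∧ 2 * (2 * (p + p) + 1) ≤ N ∧
      (N : ℝ)⁻¹ * (2 * L ^ (2 * (p + p + 1)) * (p + p + 1) ^ 2 * momentBound N (M N) (p + p) D) +
      32 / t ^ 2 * (4 * C / y ^ 2) ^ (p + p) ≤ 4 / y ^ 2 * (r / y) ^ (2 * c * (M N : ℝ)) := by
  have hy : 0 < y := hr.trans hry
  set ρ : ℝ := r / y with hρ
  have hρ0 : 0 < ρ := by positivity
  have hρ1 : ρ < 1 := (div_lt_one hy).2 hry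
  have hq0 : 0 < ρ ^ (2 * c) := Real.rpow_pos_of_pos hρ0 _
  have hs0 : 0 ≤ ρ ^ (34 / 100 - 2 * c) := (Real.rpow_pos_of_pos hρ0 _).le
  have hs1 : ρ ^ (34 / 100 - 2 * c) < 1 := Real.rpow_lt_one hρ0.le hρ1 (by linarith)
  have htend : Tendsto (fun N => 32 / t ^ 2 * (ρ ^ (34 / 100 - 2 * c)) ^ M N) atTop (𝓝 0) := by
    simpa using ((tendsto_pow_atTop_nhds_zero_of_lt_one hs0 hs1).comp hM.1).const_mul (32 / t ^ 2)
  -- The spare power N^(3/100) has to absorb the exponential factor and also the inverse of the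
  -- target, hence the division by ρ^(2c) in `K`.
  filter_upwards [hM.1.eventually_ge_atTop 100, hM.eventually_pow_self_le, eventually_ge_atTop 1,
    hM.eventually_mul_pow_le (a := 8 * (y ^ 2 / 2)) (K := 192 * L * D / ρ ^ (2 * c))
      (δ := 3 / 100) (by positivity) (by positivity) (by norm_num),
    htend.eventually_le_const (u := 2 / y ^ 2) (by positivity)] with N hM100 hMN hN1 hbeat htail
  set m := M N with hm
  have hmr : (100 : ℝ) ≤ m := by exact_mod_cast hM100
  -- The order 2p is at most 0.19 m, so that the moment errors stay below N^0.97, yet 4p ≥ 0.34 m.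
  -- The rounding loss is covered by m ≥ 100.
  obtain ⟨p, hp1, hp2⟩ : ∃ p : ℕ, 34 * m ≤ 400 * p ∧ 100 * (p + p) ≤ 19 * m :=
    ⟨(19 * m) / 200, by omega, by omega⟩
  have hp1r : 34 * (m : ℝ) ≤ 400 * p := by exact_mod_cast hp1
  have hNr : (0 : ℝ) < N := by exact_mod_cast hN1
  have hmN : m * m ≤ N := by
    have : (m : ℝ) ^ 2 ≤ N := (pow_le_pow_right₀ (by linarith) (by omega)).trans hMN
    rw [← sq]
    exact_mod_cast this
  have hmN' : 100 * m ≤ N := (Nat.mul_le_mul_right m hM100).trans hmN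
  have hpow : (ρ ^ (2 * c)) ^ m = ρ ^ (2 * c * (m : ℝ)) := (Real.rpow_mul_natCast hρ0.le _ _).symm
  refine ⟨p, by omega, by omega, ?_⟩
  have hfirst : (N : ℝ)⁻¹ * (2 * L ^ (2 * (p + p + 1)) * (p + p + 1) ^ 2 *
      momentBound N m (p + p) D) ≤ 2 / y ^ 2 * ρ ^ (2 * c * (m : ℝ)) := by
    have h1 := moments_term_le hL hD hN1 hM100 hp2 hMN
    push_cast at h1
    have h2 : (N : ℝ) = (N : ℝ) ^ (97 / 100 : ℝ) * (N : ℝ) ^ (3 / 100 : ℝ) := by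
      rw [← Real.rpow_add hNr]; norm_num
    rw [inv_mul_le_iff₀ hNr]
    refine h1.trans ?_
    rw [div_pow, hpow] at hbeat
    have hT : 0 < ρ ^ (2 * c * (m : ℝ)) := Real.rpow_pos_of_pos hρ0 _
    calc 8 * (192 * L * D) ^ m * (N : ℝ) ^ (97 / 100 : ℝ)
        = (N : ℝ) ^ (97 / 100 : ℝ) * (8 * (y ^ 2 / 2) *
          ((192 * L * D) ^ m / ρ ^ (2 * c * (m : ℝ)))) *
          (2 / y ^ 2 * ρ ^ (2 * c * (m : ℝ))) := by field_simp
      _ ≤ (N : ℝ) ^ (97 / 100 : ℝ) * (N : ℝ) ^ (3 / 100 : ℝ) *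
          (2 / y ^ 2 * ρ ^ (2 * c * (m : ℝ))) := by gcongr
      _ = _ := by rw [← h2]
  have hsecond : 32 / t ^ 2 * (4 * C / y ^ 2) ^ (p + p) ≤ 2 / y ^ 2 * ρ ^ (2 * c * (m : ℝ)) := by
    -- The truncation error is then at most a constant times ρ^(4p). As 4p ≥ 0.34 m and 2c < 0.34,
    -- it beats ρ^(2cm) with a geometric factor to spare, which absorbs the constant.
    have h1 : 4 * C / y ^ 2 ≤ ρ ^ 2 := by rw [hρ, div_pow]; gcongr
    have h2 : (4 * C / y ^ 2) ^ (p + p) ≤ ρ ^ (2 * c * (m : ℝ)) *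
        (ρ ^ (34 / 100 - 2 * c)) ^ m := by
      calc (4 * C / y ^ 2) ^ (p + p) ≤ (ρ ^ 2) ^ (p + p) := by gcongr
        _ = ρ ^ ((4 * p : ℕ) : ℝ) := by
            rw [Real.rpow_natCast, ← pow_mul]; congr 1; ring
        _ ≤ ρ ^ (2 * c * (m : ℝ) + (34 / 100 - 2 * c) * (m : ℝ)) := by
            apply Real.rpow_le_rpow_of_exponent_ge hρ0 hρ1.le
            push_cast
            linarith
        _ = _ := by rw [Real.rpow_add hρ0, Real.rpow_mul_natCast hρ0.le (34 / 100 - 2 * c)]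
    have hT : 0 < ρ ^ (2 * c * (m : ℝ)) := Real.rpow_pos_of_pos hρ0 _
    calc 32 / t ^ 2 * (4 * C / y ^ 2) ^ (p + p) ≤ 32 / t ^ 2 * (ρ ^ (2 * c * (m : ℝ)) *
        (ρ ^ (34 / 100 - 2 * c)) ^ m) := by gcongr
      _ = (32 / t ^ 2 * (ρ ^ (34 / 100 - 2 * c)) ^ m) * ρ ^ (2 * c * (m : ℝ)) := by ring
      _ ≤ _ := by gcongr
  calc _ ≤ 2 / y ^ 2 * ρ ^ (2 * c * (m : ℝ)) + 2 / y ^ 2 * ρ ^ (2 * c * (m : ℝ)) :=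
        add_le_add hfirst hsecond
    _ = _ := by ring

end Asymptotics

end DiagFreeSum

/-! ### The theorem -/

theorem theorem1
    {Ω : ℕ → Type*} [∀ N, MeasurableSpace (Ω N)]
    (P : ∀ N, Measure (Ω N)) [∀ N, IsProbabilityMeasure (P N)]
    (A B : ∀ N, Ω N → Matrix (Fin N) (Fin N) ℂ)
    (hAmeas : ∀ N, Measurable (A N)) (hBmeas : ∀ N, Measurable (B N))
    (hAherm : ∀ N ω, (A N ω).IsHermitian) (hBherm : ∀ N ω, (B N ω).IsHermitian)
    (hindep : ∀ N, IndepFun (A N) (B N) (P N))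
    (hperm : (∀ N, DiagFreeSum.PermInvariant (P N) (A N)) ∨
      (∀ N, DiagFreeSum.PermInvariant (P N) (B N)))
    (M : ℕ → ℕ) (hM : DiagFreeSum.IsSpeed M) (h₁ h₂ C : ℝ)
    (hA₁ : DiagFreeSum.TrafficGrowth P A M h₁) (hB₁ : DiagFreeSum.TrafficGrowth P B M h₂)
    (hA₂ : DiagFreeSum.FrobeniusGrowth P A M C) (hB₂ : DiagFreeSum.FrobeniusGrowth P B M C)
    (c : ℝ) (hc₀ : 0 ≤ c) (hc₁ : c ≤ 1 / (h₁ + h₂ + 6))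
    (r₀ : ℝ) (hr₀ : r₀ = Real.sqrt (max (4 * C) (2 * c ^ 2)))
    (z : ℂ) (hz : 0 < z.im) (hzr : r₀ ^ 2 < ‖z‖ ^ 2) :
    ∀ᶠ N : ℕ in atTop, ∀ x : Fin N,
      Integrable (fun ω => (N : ℝ)⁻¹ * DiagFreeSum.frobSq
        (DiagFreeSum.cauchyFreeSum x (A N ω) (B N ω) z -
          DiagFreeSum.cauchySum (A N ω) (B N ω) z)) (P N) ∧
      ∫ ω, (N : ℝ)⁻¹ * DiagFreeSum.frobSq
        (DiagFreeSum.cauchyFreeSum x (A N ω) (B N ω) z -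
          DiagFreeSum.cauchySum (A N ω) (B N ω) z) ∂(P N)
        ≤ 4 / ‖z‖ ^ 2 * (r₀ / ‖z‖) ^ (2 * c * (M N : ℝ)) := by
  have hh : 0 < h₁ + h₂ := add_pos hA₁.1 hB₁.1
  -- This keeps 2c below 1/3, hence below the exponent 34/100 reached by the truncation.
  have hc : c < 1 / 6 := hc₁.trans_lt (one_div_lt_one_div_of_lt (by norm_num) (by linarith))
  have hC : 0 < C := hA₂.1
  have hmax : 0 < max (4 * C) (2 * c ^ 2) := lt_max_of_lt_left (by linarith)
  have hr : 0 < r₀ := hr₀ ▸ Real.sqrt_pos.2 hmax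
  have hCr : 4 * C ≤ r₀ ^ 2 := by
    rw [hr₀, Real.sq_sqrt hmax.le]
    exact le_max_left _ _
  have hry : r₀ < ‖z‖ := lt_of_pow_lt_pow_left₀ 2 (norm_nonneg z) hzr
  filter_upwards [hM.eventually_bound_le (L := max 1 (max ‖z‖⁻¹ z.im⁻¹)) (D := max C 1)
    (le_max_left _ _) (le_max_right _ _) hC.le hc hr hry hCr hz, hM.1.eventually_ge_atTop 1]
    with N hN hM1 x
  obtain ⟨p, hp, hpN, hbound⟩ := hN
  have hN0 : (0 : ℝ) < N := by exact_mod_cast (by omega : 0 < N)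
  have hfrob : ∀ {X : Ω N → Matrix (Fin N) (Fin N) ℂ},
      ∫ ω, (N : ℝ)⁻¹ * DiagFreeSum.frobSq (X ω ^ M N) ∂(P N) ≤ C ^ M N →
      ∫ ω, DiagFreeSum.frobSq (X ω ^ M N) ∂(P N) ≤ N * C ^ M N := by
    intro X h
    rwa [integral_const_mul, inv_mul_le_iff₀ hN0] at h
  obtain ⟨h1, h2⟩ := DiagFreeSum.integral_cauchyError_le (hAmeas N) (hBmeas N) (hAherm N)
    (hBherm N) (hindep N) (hperm.imp (fun h => h N) fun h => h N) hM1 hC (le_max_left C 1)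
    (le_max_right C 1) (hA₂.2 N).1 (hB₂.2 N).1 (hfrob (hA₂.2 N).2) (hfrob (hB₂.2 N).2) hp hpN hz
    (L := max 1 (max ‖z‖⁻¹ z.im⁻¹)) (le_max_left _ _)
    ((le_max_left _ _).trans (le_max_right _ _)) ((le_max_right _ _).trans (le_max_right _ _)) x
  exact ⟨h1, h2.trans hbound⟩
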